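/- Let $L\ge 1$ and let $\Lambda\subset\mathbb R^L$ be a lattice of full rank with fundamental volume $\nu$. Write $\|x\|^2=\frac1L\sum_{i=1}^L x_i^2$ for the dimension-normalized squared norm. Let $p$ be a probability density on $\mathbb R$ with finite differential entropy $h(p)=-\int p\log_2 p$ (the integral converging absolutely), and let $X\in\mathbb R^L$ have density $p_L(x)=\prod_{i=1}^L p(x_i)$. *Labeling.* Let $\Lambda'\subseteq\Lambda$ be a geometrically similar sublattice (obtained from $\Lambda$ by scaling, rotating and possibly reflecting) of index $N$. Let $V_0$ be a discrete Voronoi set of $0$: a set of representatives of $\Lambda/\Lambda'$ consisting of points $\lambda$ with $\|\lambda\|\le\|\lambda-\lambda''\|$ for all $\lambda''\in\Lambda'$. Let $S=-S\subset\Lambda'$ consist of $N$ shortest vectors of $\Lambda'$ (ties broken arbitrarily); its elements $v$ represent the $N$ shortest sublattice edges $\{0,v\}$. Let $b:V_0\to S$ be a bijection such that $b(\lambda)=\pm b(\mu)$ whenever $\lambda-\mu\in\Lambda'$ or $\lambda+\mu\in\Lambda'$. For $\lambda\in V_0$ let $\alpha_u(\lambda)$ be a shift $\{y,y+b(\lambda)\}$,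 $y\in\Lambda'$, of the edge $\{0,b(\lambda)\}$ minimizing $\frac12(\|\lambda-y\|^2+\|\lambda-y-b(\lambda)\|^2)$ over $y\in\Lambda'$, that is, one whose midpoint is nearest to $\lambda$; extend $\alpha_u$ to $\Lambda$ by $\alpha_u(\lambda+\lambda')=\alpha_u(\lambda)+\lambda'$ for $\lambda'\in\Lambda'$. A labeling function is a one-to-one map $\alpha=(\alpha_1,\alpha_2):\Lambda\to\Lambda'\times\Lambda'$ with $\{\alpha_1(\lambda),\alpha_2(\lambda)\}=\alpha_u(\lambda)$ for all $\lambda\in\Lambda$. *Quantizer.* Given $\Lambda'$, $\alpha$, a scale factor $\beta>0$ and a nearest-point map $Q:\mathbb R^L\to\Lambda$ (ties broken arbitrarily), the multiple description vector quantizer (MDVQ) with codebook $\beta\Lambda$ decodes $x$ to $\beta\alpha_i(Q(x/\beta))$ when only channel $i\in\{1,2\}$ works. Its average side distortion is $\bar d_s=\frac12(\bar d_1+\bar d_2)$ with $\bar d_i=\mathbb E\|X-\beta\alpha_i(Q(X/\beta))\|^2$, and the rate of channel $i$ is $R_i=\mathcal H(\alpha_i(Q(X/\beta)))/L$ bits per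 sample, where $\mathcal H$ is Shannon entropy. *Claim.* Let $0<a<1$. Consider any sequence of such MDVQs built from $\Lambda$ (with varying $\Lambda'$, $\alpha$, $Q$, $\beta$) and real numbers $R\to\infty$ such that along the sequence $N=2^{L(aR+1)}$ and $R$ is the rate per channel, in at least one of the following two senses: (i) both entropies satisfy $R_1-R\to0$ and $R_2-R\to0$; or (ii) the high-rate expression for the rate satisfies $h(p)-\frac1L\log_2(N\beta^L\nu)-R\to0$ (for instance, $\beta^L=2^{Lh(p)}2^{-LR(1+a)}/(2^L\nu)$). Then $\bar d_1$ and $\bar d_2$ are finite and $$\lim_{R\to\infty}\bar d_s\,2^{2R(1-a)}=G(S_L)\,2^{2h(p)},$$ where $G(S_L)=\int_{B}\|x\|^2dx\,/\operatorname{vol}(B)^{1+2/L}$ is the normalized second moment of a ball $B\subset\mathbb R^L$. In particular the limit does not depend on the lattice. -/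

import Mathlib

open Filter Topology MeasureTheory

namespace MDQ

/-- The Euclidean space `ℝ^L`. -/
abbrev Space (L : ℕ) : Type := EuclideanSpace ℝ (Fin L)

/-- The dimension-normalized squared norm `(1/L) ∑ xᵢ²`. -/
noncomputable def sqNorm {L : ℕ} (x : Space L) : ℝ := ‖x‖ ^ 2 / L

/-! ### The source -/

/-- `p` is a probability density function on `ℝ`. -/
structure IsDensity (p : ℝ → ℝ) : Prop where
  measurable : Measurable p
  nonneg : ∀ t, 0 ≤ p t
  integral_eq_one : ∫ t, p t = 1

/-- The differential entropy integral of `p` converges absolutely, i.e. `h(p)` is a real number. -/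
def HasFiniteDiffEntropy (p : ℝ → ℝ) : Prop :=
  Integrable (fun t => p t * Real.logb 2 (p t))

/-- The differential entropy `h(p)`, in bits. -/
noncomputable def diffEntropy (p : ℝ → ℝ) : ℝ := -∫ t, p t * Real.logb 2 (p t)

/-- The law of a block of `L` independent samples with density `p`:
its density is `p_L(x) = ∏ p(xᵢ)`. -/
noncomputable def sourceLaw (p : ℝ → ℝ) (L : ℕ) : Measure (Space L) :=
  volume.withDensity (fun x => ENNReal.ofReal (∏ i, p (x i)))

/-- The Shannon entropy, in bits and possibly infinite, of the discrete random variable `f`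
under `μ`. -/
noncomputable def entropy {Ω U : Type*} [MeasurableSpace Ω] (μ : Measure Ω) (f : Ω → U) : ENNReal :=
  ∑' u : U, ENNReal.ofReal (-(μ.real (f ⁻¹' {u}) * Real.logb 2 (μ.real (f ⁻¹' {u}))))

/-! ### Lattices and the labeling function -/

section Labeling

variable {L : ℕ}

/-- `Λ'` is a sublattice of `Λ` that is obtained from `Λ` by scaling, rotating and possibly
reflecting. -/
def IsSimilarSublattice (Λ Λ' : Submodule ℤ (Space L)) : Prop :=
  Λ' ≤ Λ ∧ ∃ c : ℝ, c ≠ 0 ∧ ∃ O : Space L ≃ₗᵢ[ℝ] Space L,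
    ∀ x, x ∈ Λ' ↔ ∃ y ∈ Λ, x = c • O y

/-- The index `[Λ : Λ']`. -/
noncomputable def latticeIndex (Λ Λ' : Submodule ℤ (Space L)) : ℕ :=
  Λ'.toAddSubgroup.relIndex Λ.toAddSubgroup

/-- `V₀` is a discrete Voronoi set of the sublattice point `0`: it consists of points of `Λ` that
are at least as close to `0` as to any other point of `Λ'`, with ties broken in such a way that
every point of `Λ` is a shift by `Λ'` of exactly one point of `V₀`. -/
structure IsDiscreteVoronoi (Λ Λ' : Submodule ℤ (Space L)) (V₀ : Finset (Space L)) : Prop where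
  mem : ∀ v ∈ V₀, v ∈ Λ
  nearest : ∀ v ∈ V₀, ∀ w ∈ Λ', ‖v‖ ≤ ‖v - w‖
  existsUnique : ∀ x ∈ Λ, ∃! v, v ∈ V₀ ∧ x - v ∈ Λ'

/-- `S` consists of the endpoints `v` of `N` shortest sublattice edges `{0, v}`; the edges of
positive length occur in pairs `{0, v}`, `{0, -v}`. Ties in length are broken arbitrarily. -/
structure IsShortestEdges (Λ' : Submodule ℤ (Space L)) (N : ℕ) (S : Finset (Space L)) : Prop where
  mem : ∀ v ∈ S, v ∈ Λ'
  card : S.card = N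
  shortest : ∀ v ∈ S, ∀ w ∈ Λ', w ∉ S → ‖v‖ ≤ ‖w‖
  neg_mem : ∀ v ∈ S, -v ∈ S

/-- The side distortion `(‖x - y‖² + ‖x - z‖²) / 2` incurred when `x` is labeled by an edge with
endpoints `y` and `z`. By the parallelogram law, among all shifts of a given edge it is smallest
for those whose midpoint is nearest to `x`. -/
noncomputable def edgeDistortion (x y z : Space L) : ℝ := (sqNorm (x - y) + sqNorm (x - z)) / 2

/-- The undirected label `{α₁(x), α₂(x)}` of a lattice point `x`. -/
def undirected {Λ Λ' : Submodule ℤ (Space L)} (α : Λ → Λ' × Λ') (x : Λ) : Sym2 (Space L) :=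
  s(((α x).1 : Space L), ((α x).2 : Space L))

/-- `α` is a labeling function obtained by the following construction. The points of a discrete
Voronoi set `V₀` are matched one-to-one by `b` with `N` shortest sublattice edges `{0, v}`, where
`N = [Λ : Λ']`, equivalent points (`x - y ∈ Λ'` or `x + y ∈ Λ'`) being matched with equivalent
edges (`{0, v}` and `{0, ± v}`). The undirected label of `x ∈ V₀` is a shift by a vector of `Λ'` of
the edge matched with `x`, closest to `x` among all these shifts. The undirected labels are then
extended to `Λ` by the shift property, and the edges are oriented so that `α` is one-to-one. -/
structure IsLabeling (Λ Λ' : Submodule ℤ (Space L)) (α : Λ → Λ' × Λ') : Prop where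
  injective : Function.Injective α
  shift : ∀ x y : Λ, (y : Space L) ∈ Λ' →
    undirected α (x + y) = (undirected α x).map (fun z => z + (y : Space L))
  construction : ∃ (V₀ S : Finset (Space L)) (b : Space L → Space L),
    IsDiscreteVoronoi Λ Λ' V₀ ∧
    IsShortestEdges Λ' (latticeIndex Λ Λ') S ∧
    Set.BijOn b V₀ S ∧
    (∀ x ∈ V₀, ∀ y ∈ V₀, (x - y ∈ Λ' ∨ x + y ∈ Λ') → (b x = b y ∨ b x = -b y)) ∧
    (∀ x : Λ, (x : Space L) ∈ V₀ → ∃ y ∈ Λ',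
      undirected α x = s(y, y + b x) ∧
      ∀ z ∈ Λ', edgeDistortion (x : Space L) y (y + b x) ≤ edgeDistortion (x : Space L) z (z + b x))

end Labeling

/-! ### The multiple description vector quantizer -/

/-- A multiple description vector quantizer built from the lattice `Λ`: the codebook is `scale • Λ`,
the labels are taken from `scale • sub` for a geometrically similar sublattice `sub`, and
`nearest` maps every vector to a nearest point of `Λ`, ties being broken arbitrarily. -/
structure Quantizer {L : ℕ} (Λ : Submodule ℤ (Space L)) where
  sub : Submodule ℤ (Space L)
  similar : IsSimilarSublattice Λ sub
  label : Λ → sub × sub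
  isLabeling : IsLabeling Λ sub label
  nearest : Space L → Λ
  nearest_le : ∀ x, ∀ y ∈ Λ, ‖x - (nearest x : Space L)‖ ≤ ‖x - y‖
  scale : ℝ
  scale_pos : 0 < scale

namespace Quantizer

variable {L : ℕ} {Λ : Submodule ℤ (Space L)} (M : Quantizer Λ)

/-- The index `N = [Λ : Λ']`. -/
noncomputable def index : ℕ := latticeIndex Λ M.sub

/-- The label of the code vector of `x`, in unscaled coordinates: the vectors sent over the two
channels are `scale • (encode x).1` and `scale • (encode x).2`. -/
noncomputable def encode (x : Space L) : M.sub × M.sub := M.label (M.nearest (M.scale⁻¹ • x))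

/-- The distortion `‖x - λ'₁‖²` when only channel 1 works. -/
noncomputable def error₁ (x : Space L) : ℝ :=
  sqNorm (x - M.scale • ((M.encode x).1 : Space L))

/-- The distortion `‖x - λ'₂‖²` when only channel 2 works. -/
noncomputable def error₂ (x : Space L) : ℝ :=
  sqNorm (x - M.scale • ((M.encode x).2 : Space L))

/-- The average side distortion, the mean of the average distortions of the two channels. -/
noncomputable def sideDistortion (p : ℝ → ℝ) : ℝ :=
  ((∫ x, M.error₁ x ∂(sourceLaw p L)) + ∫ x, M.error₂ x ∂(sourceLaw p L)) / 2

/-- The rate of channel 1 in bits per sample: the entropy of the first label, divided by `L`. -/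
noncomputable def rate₁ (p : ℝ → ℝ) : ENNReal :=
  entropy (sourceLaw p L) (fun x => (M.encode x).1) / L

/-- The rate of channel 2 in bits per sample. -/
noncomputable def rate₂ (p : ℝ → ℝ) : ENNReal :=
  entropy (sourceLaw p L) (fun x => (M.encode x).2) / L

/-- The high-rate expression `h(p) - (1/L) log₂ (N ν)` for the rate of each channel, where `ν` is
the volume of a fundamental region of the codebook `scale • Λ`. -/
noncomputable def highRate (p : ℝ → ℝ) : ℝ :=
  diffEntropy p - Real.logb 2 (M.index * (M.scale ^ L * ZLattice.covolume Λ)) / L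

end Quantizer

/-- The normalized second moment `G(S_L)` of a ball in `ℝ^L`: `∫ ‖x‖² / vol ^ (1 + 2/L)`, with the
dimension-normalized norm. It does not depend on the radius; the unit ball is used. -/
noncomputable def sphereSecondMoment (L : ℕ) : ℝ :=
  (∫ x in Metric.ball (0 : Space L) 1, sqNorm x) /
    (volume.real (Metric.ball (0 : Space L) 1)) ^ (1 + 2 / (L : ℝ))

end MDQ

/-! Write `β` for the scale, `ν` for the covolume of `Λ` and `c` for the similarity factor of the
sublattice, so that `N = c ^ L` and `c = 2 ^ (a R + 1)`.

Distortion. By the parallelogram law, the average side error of `x` labelled by an edge is the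
squared distance from `x` to the midpoint plus a quarter of the squared edge length. The covering
radius of `Λ'` is `O(c)`, so after scaling midpoints are `O(β c)` away, while edge lengths live on
the scale `β c ^ 2`; only the lengths survive in the limit. Over any translate of `V₀` the edges run
through the `N` shortest vectors of `Λ'` exactly once. Since `β c → 0` and translation is continuous
in `L¹`, the source density is almost invariant under these shifts, so the mean squared length is
asymptotically the plain average over the `N` shortest vectors
(`Quantizer.abs_sideDistortion_sub_le`). Those are `c` times the `N` shortest vectors of `Λ`, which
fill out a ball (`tendsto_moment`); this is where `G(S_L)` appears and the shape of the lattice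
drops out. The high-rate expression says `β c ν ^ (1/L) ≈ 2 ^ (h - R)`, which makes `(β c ^ 2) ^ 2 *
2 ^ (2R(1 - a))` converge (`tendsto_sideDistortion`).

Rate. In sense (i) one must show that the entropy rate agrees asymptotically with the high-rate
expression (`tendsto_highRate_sub`). Lower bound: reflecting a lattice point in the midpoint of its
edge gives a point with the same edge in the opposite orientation. Hence, of the at most `2N` points
whose edge contains a given vertex, essentially half have it as first label, up to `O(N / c)`
exceptional classes (`LabelData.ncard_fiber_le`, `exists_card_exceptional_le`). The cells of the
first label thus have volume at most `(1 + O(1/c)) N β ^ L ν`, and quantization with such cells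
costs at most the logarithm of that volume. Upper bound: Gibbs' inequality compares the label
distribution with the masses that a function `exp ψ` gives to the Voronoi cells of the scaled
sublattice (`Quantizer.labelEntropy_le`). A label is `O(β c ^ 2)` away from the source vector, so
`ψ` has to be uniformly continuous, with cross entropy close to the differential entropy, and `β c ^
2` has to tend to zero. Finite differential entropy alone supplies no such `ψ`; one is obtained by
smoothing the label distribution of one quantizer of the sequence with finite entropy
(`exists_log_density_of_entropy`), then corrected by a bounded function
(`exists_uniformContinuous_crossEntropy_le`). If `β c ^ 2` stayed away from zero, the same smoothing
at width `β c ^ 2` would bound the entropy by `log N + O(1)`, hence the rate by `a R + O(1)`,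
contradicting `a < 1`. -/

namespace MDQ

/-! ### The density of a block of samples -/

/-- The density `∏ p(xᵢ)` of a block of independent samples. -/
noncomputable def blockDensity (p : ℝ → ℝ) (L : ℕ) (x : Space L) : ℝ := ∏ i, p (x i)

section Source

variable {p : ℝ → ℝ} {L : ℕ}

/-- A non-integrable function has Bochner integral `0`, so the normalization to `1` already forces
integrability. -/
theorem IsDensity.integrable (hp : IsDensity p) : Integrable p := by
  by_contra h
  have := hp.integral_eq_one
  rw [integral_undef h] at this
  exact zero_ne_one this

theorem sourceLaw_eq : sourceLaw p L =
    volume.withDensity (fun x => ENNReal.ofReal (blockDensity p L x)) := rfl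

theorem IsDensity.measurable_blockDensity (hp : IsDensity p) :
    Measurable (blockDensity p L) := by
  unfold blockDensity
  refine Finset.measurable_prod _ fun i _ => hp.measurable.comp ?_
  fun_prop

theorem IsDensity.blockDensity_nonneg (hp : IsDensity p) (x : Space L) :
    0 ≤ blockDensity p L x := Finset.prod_nonneg fun _ _ => hp.nonneg _

theorem integrable_prod_coord {f : Fin L → ℝ → ℝ} (hf : ∀ i, Integrable (f i)) :
    Integrable (fun x : Space L => ∏ i, f i (x i)) := by
  have h := Integrable.fintype_prod (𝕜 := ℝ) (μ := fun _ : Fin L => (volume : Measure ℝ)) hf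
  have := (PiLp.volume_preserving_ofLp (Fin L)).integrable_comp_of_integrable h
  exact this

theorem integral_prod_coord (f : Fin L → ℝ → ℝ) :
    ∫ x : Space L, ∏ i, f i (x i) = ∏ i, ∫ t, f i t := by
  rw [← integral_fintype_prod_volume_eq_prod]
  exact (PiLp.volume_preserving_ofLp (Fin L)).integral_comp
    (MeasurableEquiv.toLp 2 (Fin L → ℝ)).symm.measurableEmbedding
    (fun y : Fin L → ℝ => ∏ i, f i (y i))

theorem IsDensity.integrable_blockDensity (hp : IsDensity p) :
    Integrable (blockDensity p L) := integrable_prod_coord fun _ => hp.integrable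

theorem IsDensity.integral_blockDensity (hp : IsDensity p) :
    ∫ x, blockDensity p L x = 1 := by
  simp only [blockDensity]
  rw [integral_prod_coord (fun _ => p)]
  simp [hp.integral_eq_one]

theorem IsDensity.isProbabilityMeasure (hp : IsDensity p) :
    IsProbabilityMeasure (sourceLaw p L) := by
  constructor
  rw [sourceLaw_eq, withDensity_apply _ MeasurableSet.univ, Measure.restrict_univ,
    ← ofReal_integral_eq_lintegral_ofReal hp.integrable_blockDensity
      (ae_of_all _ hp.blockDensity_nonneg), hp.integral_blockDensity, ENNReal.ofReal_one]

theorem sourceLaw_absolutelyContinuous : sourceLaw p L ≪ volume :=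
  withDensity_absolutelyContinuous _ _

theorem IsDensity.integral_sourceLaw (hp : IsDensity p) (f : Space L → ℝ) :
    ∫ x, f x ∂(sourceLaw p L) = ∫ x, blockDensity p L x * f x := by
  rw [sourceLaw_eq, integral_withDensity_eq_integral_toReal_smul
    hp.measurable_blockDensity.ennreal_ofReal (by simp)]
  simp [ENNReal.toReal_ofReal (hp.blockDensity_nonneg _)]

theorem IsDensity.sourceLaw_real (hp : IsDensity p) {E : Set (Space L)}
    (hE : NullMeasurableSet E) :
    (sourceLaw p L).real E = ∫ x in E, blockDensity p L x := by
  rw [Measure.real, sourceLaw_eq, withDensity_apply₀ _ hE,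
    integral_eq_lintegral_of_nonneg_ae (ae_of_all _ hp.blockDensity_nonneg)
      hp.integrable_blockDensity.aestronglyMeasurable.restrict]

/-- The logarithm turns the product into a sum. Each summand is kept as a product of one-variable
functions so that `integral_prod_coord` applies to it; if some factor vanishes, both sides are zero.
-/
theorem negMulLog_blockDensity (x : Space L) :
    Real.negMulLog (blockDensity p L x) =
      ∑ i, ∏ j, (if j = i then Real.negMulLog (p (x j)) else p (x j)) := by
  unfold blockDensity
  by_cases h : ∃ j, p (x j) = 0
  · obtain ⟨j, hj⟩ := h
    rw [Finset.prod_eq_zero (Finset.mem_univ j) hj, Real.negMulLog_zero]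
    refine (Finset.sum_eq_zero fun i _ => Finset.prod_eq_zero (Finset.mem_univ j) ?_).symm
    split_ifs <;> simp [hj]
  · push Not at h
    rw [Real.negMulLog, Real.log_prod (fun i _ => h i), Finset.mul_sum]
    refine Finset.sum_congr rfl fun i _ => ?_
    rw [← Finset.mul_prod_erase _ _ (Finset.mem_univ i),
      ← Finset.mul_prod_erase _ (fun j => if j = i then _ else _) (Finset.mem_univ i)]
    rw [Finset.prod_congr rfl fun j hj => if_neg (Finset.ne_of_mem_erase hj)]
    simp only [if_true, Real.negMulLog]
    ring

theorem negMulLog_eq_logb (t : ℝ) :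
    Real.negMulLog t = -Real.log 2 * (t * Real.logb 2 t) := by
  have : Real.log 2 ≠ 0 := (Real.log_pos one_lt_two).ne'
  rw [Real.negMulLog, Real.logb]
  field_simp

theorem HasFiniteDiffEntropy.integrable_negMulLog (hh : HasFiniteDiffEntropy p) :
    Integrable (fun t => Real.negMulLog (p t)) := by
  simp only [negMulLog_eq_logb]
  exact Integrable.const_mul hh _

theorem integral_negMulLog_eq : ∫ t, Real.negMulLog (p t) = Real.log 2 * diffEntropy p := by
  simp only [negMulLog_eq_logb, diffEntropy]
  rw [integral_const_mul]
  ring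

theorem HasFiniteDiffEntropy.integrable_negMulLog_blockDensity (hh : HasFiniteDiffEntropy p)
    (hp : IsDensity p) : Integrable (fun x => Real.negMulLog (blockDensity p L x)) := by
  simp only [negMulLog_blockDensity]
  refine integrable_finsetSum _ fun i _ =>
    integrable_prod_coord (f := fun j t => if j = i then Real.negMulLog (p t) else p t) fun j => ?_
  by_cases h : j = i
  · simpa [h] using hh.integrable_negMulLog
  · simpa [h] using hp.integrable

theorem HasFiniteDiffEntropy.integral_negMulLog_blockDensity (hh : HasFiniteDiffEntropy p)
    (hp : IsDensity p) :
    ∫ x, Real.negMulLog (blockDensity p L x) = Real.log 2 * (L * diffEntropy p) := by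
  simp only [negMulLog_blockDensity]
  have hi : ∀ i j : Fin L, Integrable (fun t => if j = i then Real.negMulLog (p t) else p t) := by
    intro i j
    by_cases h : j = i
    · simpa [h] using hh.integrable_negMulLog
    · simpa [h] using hp.integrable
  rw [integral_finsetSum _ fun i _ => integrable_prod_coord (hi i)]
  have : ∀ i : Fin L, ∫ x : Space L,
      ∏ j, (if j = i then Real.negMulLog (p (x j)) else p (x j)) =
        Real.log 2 * diffEntropy p := by
    intro i
    rw [integral_prod_coord (fun j t => if j = i then Real.negMulLog (p t) else p t),
      ← Finset.mul_prod_erase _ _ (Finset.mem_univ i),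
      Finset.prod_eq_one fun j hj => ?_]
    · simp [integral_negMulLog_eq]
    · simp [Finset.ne_of_mem_erase hj, hp.integral_eq_one]
  simp only [this, Finset.sum_const, Finset.card_univ, Fintype.card_fin, nsmul_eq_mul]
  ring

/-- Translation is continuous in `L¹`. -/
theorem exists_forall_integral_translate_sub_le {E : Type*} [NormedAddCommGroup E]
    [NormedSpace ℝ E] [FiniteDimensional ℝ E] [MeasurableSpace E] [BorelSpace E]
    {μ : Measure E} [μ.IsAddHaarMeasure] {f : E → ℝ} (hf : Integrable f μ) {ε : ℝ} (hε : 0 < ε) :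
    ∃ δ > 0, ∀ t : E, ‖t‖ < δ → ∫ x, |f (x + t) - f x| ∂μ < ε := by
  have hm : MemLp f 1 μ := memLp_one_iff_integrable.2 hf
  -- Translations form a continuous family of measure preserving maps, and composition with such a
  -- family is continuous in `L¹`; continuity is then used at `t = 0`.
  have hgm : ∀ t : E, MeasurePreserving
      (((ContinuousMap.mk (fun z : E × E => z.2 + z.1) (by fun_prop)).curry t : C(E, E))) μ μ :=
    fun t => measurePreserving_add_right μ t
  have hc : Continuous fun t : E => Lp.compMeasurePreserving _ (hgm t) (hm.toLp f) :=
    continuous_const.compMeasurePreservingLp (ContinuousMap.continuous _) hgm ENNReal.one_ne_top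
  obtain ⟨δ, hδ, h⟩ := Metric.continuousAt_iff.1 (hc.continuousAt (x := 0)) ε hε
  refine ⟨δ, hδ, fun t ht => ?_⟩
  have := h (x := t) (by simpa using ht)
  rw [L1.dist_eq_integral_dist] at this
  refine lt_of_eq_of_lt (integral_congr_ae ?_) this
  have h1 := (hgm t).quasiMeasurePreserving.ae_eq_comp hm.coeFn_toLp
  filter_upwards [Lp.coeFn_compMeasurePreserving (hm.toLp f) (hgm t),
    Lp.coeFn_compMeasurePreserving (hm.toLp f) (hgm 0), h1, hm.coeFn_toLp] with x e1 e2 e3 e4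
  rw [e1, e2, e3, Real.dist_eq]
  simp only [Function.comp, ContinuousMap.curry_apply, ContinuousMap.coe_mk, add_zero, e4]

end Source

/-! ### Entropy of a countable partition -/

section Entropy

variable {Ω U : Type*} [MeasurableSpace Ω] {μ : Measure Ω} {P : Ω → ℝ} {A : Ω → U}

/-- The probability, under the density `P`, of the fibre of `A` over `u`. -/
noncomputable def fiberProb (μ : Measure Ω) (P : Ω → ℝ) (A : Ω → U) (u : U) : ℝ :=
  ∫ x in A ⁻¹' {u}, P x ∂μ

theorem fiberProb_nonneg (hP : ∀ x, 0 ≤ P x) (u : U) : 0 ≤ fiberProb μ P A u :=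
  integral_nonneg fun x => hP x

/-- Null-measurability is the right hypothesis: with arbitrary tie-breaking the cells of a quantizer
need not be measurable. -/
theorem hasSum_integral_fiber [Countable U] (hA : ∀ u, NullMeasurableSet (A ⁻¹' {u}) μ)
    {f : Ω → ℝ} (hf : Integrable f μ) :
    HasSum (fun u => ∫ x in A ⁻¹' {u}, f x ∂μ) (∫ x, f x ∂μ) := by
  have hU : ⋃ u, A ⁻¹' {u} = Set.univ := by
    ext x; simp
  have := hasSum_integral_iUnion_ae hA (fun u v huv => (Disjoint.preimage A
    (Set.disjoint_singleton.2 huv)).aedisjoint) (f := f) (by rw [hU]; exact hf.integrableOn)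
  rwa [hU, Measure.restrict_univ] at this

theorem fiberProb_le_one [Countable U] (hP : ∀ x, 0 ≤ P x) (hi : Integrable P μ)
    (h1 : ∫ x, P x ∂μ = 1) (u : U) : fiberProb μ P A u ≤ 1 :=
  h1 ▸ setIntegral_le_integral hi (ae_of_all _ hP)

/-- Quantization with cells of volume at most `V` reduces the differential entropy by at most
`log V`. -/
theorem integral_negMulLog_le [Countable U] (hP : ∀ x, 0 ≤ P x) (hi : Integrable P μ)
    (h1 : ∫ x, P x ∂μ = 1) (hlog : Integrable (fun x => Real.negMulLog (P x)) μ)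
    (hA : ∀ u, NullMeasurableSet (A ⁻¹' {u}) μ) {V : ℝ} (hV : 0 < V)
    (hvol : ∀ u, μ (A ⁻¹' {u}) ≤ ENNReal.ofReal V)
    (hs : Summable fun u => Real.negMulLog (fiberProb μ P A u)) :
    ∫ x, Real.negMulLog (P x) ∂μ ≤ Real.log V + ∑' u, Real.negMulLog (fiberProb μ P A u) := by
  have hsum := hasSum_integral_fiber hA hlog
  have hf := hasSum_integral_fiber hA hi
  rw [h1] at hf
  have hR := (hf.mul_right (Real.log V)).add hs.hasSum
  rw [one_mul] at hR
  refine hasSum_le (fun u => ?_) hsum hR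
  change _ ≤ fiberProb μ P A u * Real.log V + _
  set f := fiberProb μ P A u with hfdef
  rcases (fiberProb_nonneg (μ := μ) (A := A) hP u).eq_or_lt with h0 | h0
  · rw [← hfdef] at h0
    rw [← h0, zero_mul, Real.negMulLog_zero, add_zero]
    refine le_of_eq (integral_eq_zero_of_ae ?_)
    have := (integral_eq_zero_iff_of_nonneg_ae (ae_of_all _ hP) hi.restrict).1 h0.symm
    filter_upwards [this] with x hx
    simp [hx]
  · rw [← hfdef] at h0
    have hm : 0 < f / V := by positivity
    have hfin : μ (A ⁻¹' {u}) ≠ ⊤ := ((hvol u).trans_lt ENNReal.ofReal_lt_top).ne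
    -- Tangent line to the concave function `-t log t` at `t = f / V`, the mean density over a cell
    -- of volume `V`. Integrating it over the cell is Jensen's inequality.
    have key : ∀ x, Real.negMulLog (P x) ≤ f / V - P x - P x * Real.log (f / V) := by
      intro x
      rcases (hP x).eq_or_lt with hx | hx
      · rw [← hx]; simp [hm.le]
      · have := Real.log_le_sub_one_of_pos (div_pos hm hx)
        rw [Real.log_div hm.ne' hx.ne'] at this
        have h2 := mul_le_mul_of_nonneg_left this hx.le
        rw [mul_sub, mul_sub, mul_div_cancel₀ _ hx.ne'] at h2
        rw [Real.negMulLog]; linarith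
    have hc : IntegrableOn (fun _ : Ω => f / V) (A ⁻¹' {u}) μ :=
      integrableOn_const hfin
    have hc' : Integrable (fun x => f / V - P x) (μ.restrict (A ⁻¹' {u})) := hc.sub hi.restrict
    calc ∫ x in A ⁻¹' {u}, Real.negMulLog (P x) ∂μ
        ≤ ∫ x in A ⁻¹' {u}, (f / V - P x - P x * Real.log (f / V)) ∂μ :=
          integral_mono hlog.restrict ((hc.sub hi.restrict).sub (hi.restrict.mul_const _)) key
      _ = μ.real (A ⁻¹' {u}) * (f / V) - f - f * Real.log (f / V) := by
          rw [integral_sub hc' (hi.restrict.mul_const _),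
            integral_sub hc hi.restrict, integral_mul_const, setIntegral_const, smul_eq_mul]
          rfl
      _ ≤ V * (f / V) - f - f * Real.log (f / V) := by
          gcongr
          exact ENNReal.toReal_le_of_le_ofReal hV.le (hvol u)
      _ = f * Real.log V + Real.negMulLog f := by
          rw [Real.log_div h0.ne' hV.ne', Real.negMulLog]
          field_simp
          ring

/-- Gibbs' inequality: the entropy is at most the cross entropy with respect to any weights. -/
theorem summable_negMulLog_and_tsum_le [Countable U] (hP : ∀ x, 0 ≤ P x) (hi : Integrable P μ)
    (h1 : ∫ x, P x ∂μ = 1) (hA : ∀ u, NullMeasurableSet (A ⁻¹' {u}) μ) {r : U → ℝ}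
    (hr : Summable r) (hr0 : ∀ u, 0 ≤ r u) {φ : Ω → ℝ} (hφ : Integrable (fun x => P x * φ x) μ)
    (hle : ∀ x, Real.exp (-φ x) ≤ r (A x)) :
    Summable (fun u => Real.negMulLog (fiberProb μ P A u)) ∧
      ∑' u, Real.negMulLog (fiberProb μ P A u) ≤ ∫ x, P x * φ x ∂μ + ∑' u, r u - 1 := by
  have hf := hasSum_integral_fiber hA hi
  rw [h1] at hf
  have hR := ((hasSum_integral_fiber hA hφ).add hr.hasSum).sub hf
  have h0 : ∀ u, 0 ≤ Real.negMulLog (fiberProb μ P A u) := fun u =>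
    Real.negMulLog_nonneg (fiberProb_nonneg hP u) (fiberProb_le_one hP hi h1 u)
  -- Fibrewise, `log t ≤ t - 1` at `t = r / f` gives `-f log f ≤ -f log r + r - f`, and `exp (-φ) ≤
  -- r ∘ A` bounds `-f log r` by the integral of `P φ`.
  have hle : ∀ u, Real.negMulLog (fiberProb μ P A u) ≤
      ∫ x in A ⁻¹' {u}, P x * φ x ∂μ + r u - ∫ x in A ⁻¹' {u}, P x ∂μ := by
    intro u
    change _ ≤ _ + _ - fiberProb μ P A u
    set f := fiberProb μ P A u with hfdef
    rcases (fiberProb_nonneg (μ := μ) (A := A) hP u).eq_or_lt with h0 | h0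
    · have hz : ∫ x in A ⁻¹' {u}, P x * φ x ∂μ = 0 := by
        refine integral_eq_zero_of_ae ?_
        have := (integral_eq_zero_iff_of_nonneg_ae (ae_of_all _ hP) hi.restrict).1 h0.symm
        filter_upwards [this] with x hx
        simp [hx]
      rw [← hfdef] at h0
      rw [hz, ← h0]; simp [hr0 u]
    · rw [← hfdef] at h0
      have hne : (A ⁻¹' {u}).Nonempty := by
        by_contra h
        rw [Set.not_nonempty_iff_eq_empty] at h
        rw [hfdef, fiberProb, h] at h0
        simp at h0
      obtain ⟨x₀, hx₀⟩ := hne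
      have hru : 0 < r u := by
        have := hle x₀
        rw [hx₀] at this
        exact (Real.exp_pos _).trans_le this
      have hφu : ∀ x ∈ A ⁻¹' {u}, P x * (-Real.log (r u)) ≤ P x * φ x := by
        intro x hx
        refine mul_le_mul_of_nonneg_left ?_ (hP x)
        have := hle x
        rw [show A x = u from hx] at this
        have := (Real.le_log_iff_exp_le hru).2 this
        linarith
      have h2 : f * (-Real.log (r u)) ≤ ∫ x in A ⁻¹' {u}, P x * φ x ∂μ := by
        rw [hfdef, fiberProb, ← integral_mul_const]
        exact setIntegral_mono_on₀ (hi.restrict.mul_const _) hφ.restrict (hA u) hφu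
      have h3 := Real.log_le_sub_one_of_pos (div_pos hru h0)
      rw [Real.log_div hru.ne' h0.ne'] at h3
      have h4 := mul_le_mul_of_nonneg_left h3 h0.le
      rw [mul_sub, mul_sub, mul_div_cancel₀ _ h0.ne'] at h4
      rw [Real.negMulLog]
      linarith
  have hsum := Summable.of_nonneg_of_le h0 hle hR.summable
  exact ⟨hsum, (hasSum_le hle hsum.hasSum hR)⟩

end Entropy

/-! ### Entropies of source labels as sums of `negMulLog` in nats -/

section SourceEntropy

variable {p : ℝ → ℝ} {L : ℕ} {U : Type*} {A : Space L → U}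

theorem IsDensity.entropy_eq (hp : IsDensity p)
    (hA : ∀ u, NullMeasurableSet (A ⁻¹' {u})) :
    entropy (sourceLaw p L) A = ∑' u, ENNReal.ofReal
      (Real.negMulLog (fiberProb volume (blockDensity p L) A u) / Real.log 2) := by
  refine tsum_congr fun u => congrArg _ ?_
  rw [hp.sourceLaw_real (hA u), ← fiberProb, negMulLog_eq_logb]
  have : Real.log 2 ≠ 0 := (Real.log_pos one_lt_two).ne'
  field_simp

theorem IsDensity.negMulLog_fiberProb_nonneg [Countable U] (hp : IsDensity p) (u : U) :
    0 ≤ Real.negMulLog (fiberProb volume (blockDensity p L) A u) :=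
  Real.negMulLog_nonneg (fiberProb_nonneg hp.blockDensity_nonneg u)
    (fiberProb_le_one hp.blockDensity_nonneg hp.integrable_blockDensity
      hp.integral_blockDensity u)

theorem IsDensity.summable_of_entropy_ne_top [Countable U] (hp : IsDensity p)
    (hA : ∀ u, NullMeasurableSet (A ⁻¹' {u})) (h : entropy (sourceLaw p L) A ≠ ⊤) :
    Summable fun u => Real.negMulLog (fiberProb volume (blockDensity p L) A u) := by
  rw [hp.entropy_eq hA] at h
  have h2 : Real.log 2 ≠ 0 := (Real.log_pos one_lt_two).ne'
  have := (ENNReal.summable_toReal h).mul_right (Real.log 2)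
  refine this.congr fun u => ?_
  rw [ENNReal.toReal_ofReal (div_nonneg (hp.negMulLog_fiberProb_nonneg u)
    (Real.log_pos one_lt_two).le)]
  field_simp

theorem IsDensity.toReal_entropy [Countable U] (hp : IsDensity p)
    (hA : ∀ u, NullMeasurableSet (A ⁻¹' {u})) :
    (entropy (sourceLaw p L) A).toReal =
      (∑' u, Real.negMulLog (fiberProb volume (blockDensity p L) A u)) / Real.log 2 := by
  rw [hp.entropy_eq hA, ENNReal.tsum_toReal_eq (by simp), ← tsum_div_const]
  exact tsum_congr fun u => ENNReal.toReal_ofReal (div_nonneg (hp.negMulLog_fiberProb_nonneg u)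
    (Real.log_pos one_lt_two).le)

end SourceEntropy

/-! ### Uniformly continuous approximations of the logarithm of a density -/

section LogApproximation

theorem integrable_of_lintegral_fiber_le {Ω U : Type*} [MeasurableSpace Ω] {μ : Measure Ω}
    {A : Ω → U} [Countable U] (hA : ∀ u, NullMeasurableSet (A ⁻¹' {u}) μ) {f : Ω → ℝ}
    (hf : AEStronglyMeasurable f μ) {c : U → ℝ} (hc : Summable c) (hc0 : ∀ u, 0 ≤ c u)
    (hle : ∀ u, ∫⁻ x in A ⁻¹' {u}, ‖f x‖ₑ ∂μ ≤ ENNReal.ofReal (c u)) : Integrable f μ := by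
  refine ⟨hf, ?_⟩
  have hU : ⋃ u, A ⁻¹' {u} = Set.univ := by
    ext x; simp
  rw [hasFiniteIntegral_iff_enorm, ← setLIntegral_univ, ← hU,
    lintegral_iUnion₀ hA (fun u v huv => (Disjoint.preimage A
      (Set.disjoint_singleton.2 huv)).aedisjoint)]
  refine (ENNReal.tsum_le_tsum hle).trans_lt ?_
  rw [← ENNReal.ofReal_tsum_of_nonneg hc0 hc]
  exact ENNReal.ofReal_lt_top

/-- If `-ψ` exceeds the self-information of the quantizer output by at most `C`, then its mean
exceeds the entropy by at most `C`. -/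
theorem integrable_mul_of_neg_le_log_fiberProb {Ω U : Type*} [MeasurableSpace Ω] {μ : Measure Ω}
    {A : Ω → U} [Countable U] (hA : ∀ u, NullMeasurableSet (A ⁻¹' {u}) μ) {P : Ω → ℝ}
    (hP : ∀ x, 0 ≤ P x) (hi : Integrable P μ) (h1 : ∫ x, P x ∂μ = 1)
    (hs : Summable fun u => Real.negMulLog (fiberProb μ P A u)) {ψ : Ω → ℝ}
    (hψ : AEStronglyMeasurable ψ μ) (hψ0 : ∀ x, ψ x ≤ 0) {C : ℝ} (hC : 0 ≤ C)
    (hle : ∀ x, 0 < fiberProb μ P A (A x) → -ψ x ≤ -Real.log (fiberProb μ P A (A x)) + C) :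
    Integrable (fun x => P x * ψ x) μ ∧
      -∫ x, P x * ψ x ∂μ ≤ ∑' u, Real.negMulLog (fiberProb μ P A u) + C := by
  have hf0 : ∀ u, 0 ≤ fiberProb μ P A u := fiberProb_nonneg hP
  have hf : HasSum (fiberProb μ P A) 1 := h1 ▸ hasSum_integral_fiber hA hi
  suffices hPψ : Integrable (fun x => P x * ψ x) μ by
    refine ⟨hPψ, ?_⟩
    have hsum := hs.hasSum.add (hf.mul_right C)
    rw [one_mul] at hsum
    refine hasSum_le (fun u => ?_) (hasSum_integral_fiber hA hPψ).neg hsum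
    rw [← integral_neg]
    rcases (hf0 u).eq_or_lt with h0 | h0
    · have := (integral_eq_zero_iff_of_nonneg_ae (ae_of_all _ hP) hi.restrict).1 h0.symm
      rw [← h0, integral_eq_zero_of_ae]
      · simp
      · filter_upwards [this] with x hx
        simp [hx]
    · have h3 : fiberProb μ P A u * (-Real.log (fiberProb μ P A u) + C) =
          Real.negMulLog (fiberProb μ P A u) + fiberProb μ P A u * C := by
        rw [Real.negMulLog]; ring
      rw [← h3]
      change _ ≤ (∫ x in A ⁻¹' {u}, P x ∂μ) * _
      rw [← integral_mul_const]
      refine setIntegral_mono_on₀ hPψ.restrict.neg (hi.restrict.mul_const _) (hA u)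
        fun x hx => ?_
      have hx' : A x = u := hx
      have := hle x
      rw [hx'] at this
      rw [← mul_neg]
      exact mul_le_mul_of_nonneg_left (this h0) (hP x)
  refine integrable_of_lintegral_fiber_le hA (hi.aestronglyMeasurable.mul hψ)
    (c := fun u => fiberProb μ P A u * (-Real.log (fiberProb μ P A u) + C)) ?_ ?_ ?_
  · refine (hs.add (hf.summable.mul_right C)).congr fun u => ?_
    rw [Real.negMulLog]; ring
  · intro u
    have := Real.log_nonpos (hf0 u) (fiberProb_le_one hP hi h1 u)
    exact mul_nonneg (hf0 u) (by linarith)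
  · intro u
    have hcu : 0 ≤ -Real.log (fiberProb μ P A u) + C := by
      have := Real.log_nonpos (hf0 u) (fiberProb_le_one hP hi h1 u)
      linarith
    have hint : ∫⁻ x in A ⁻¹' {u}, ENNReal.ofReal (P x * (-Real.log (fiberProb μ P A u) + C)) ∂μ =
        ENNReal.ofReal (fiberProb μ P A u * (-Real.log (fiberProb μ P A u) + C)) := by
      rw [← ofReal_integral_eq_lintegral_ofReal (hi.restrict.mul_const _)
        (ae_of_all _ fun x => mul_nonneg (hP x) hcu), integral_mul_const]
      rfl
    rw [← hint]
    -- On a fibre of probability zero the hypothesis on `ψ` says nothing, but there `P` vanishes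
    -- almost everywhere.
    rcases (hf0 u).eq_or_lt with h0 | h0
    · have := (integral_eq_zero_iff_of_nonneg_ae (ae_of_all _ hP) hi.restrict).1 h0.symm
      refine lintegral_mono_ae ?_
      filter_upwards [this] with x hx
      simp [hx]
    · refine lintegral_mono_ae ((ae_restrict_iff'₀ (hA u)).2 (ae_of_all _ fun x hx => ?_))
      have hx' : A x = u := hx
      rw [Real.enorm_eq_ofReal_abs, abs_mul, abs_of_nonneg (hP x), abs_of_nonpos (hψ0 x)]
      refine ENNReal.ofReal_le_ofReal (mul_le_mul_of_nonneg_left ?_ (hP x))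
      have := hle x
      rw [hx'] at this
      exact this h0

/-- The Japanese bracket `(1 + ‖x‖) ^ (-r)`. -/
noncomputable def bracket {E : Type*} [Norm E] (r : ℝ) (x : E) : ℝ := (1 + ‖x‖) ^ (-r)

variable {E : Type*} [NormedAddCommGroup E]

theorem bracket_pos (r : ℝ) (x : E) : 0 < bracket r x := by
  unfold bracket; positivity

theorem bracket_le_one {r : ℝ} (hr : 0 ≤ r) (x : E) : bracket r x ≤ 1 :=
  Real.rpow_le_one_of_one_le_of_nonpos (by linarith [norm_nonneg x]) (by linarith)

/-- Peetre's inequality, from `1 + ‖y‖ ≤ (1 + ‖x - y‖)(1 + ‖x‖)`. The estimate passes to mixtures of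
translates, whose logarithm therefore has modulus of continuity `r log (1 + ‖x - y‖)`. -/
theorem bracket_le_mul {r : ℝ} (hr : 0 ≤ r) (x y : E) :
    bracket r x ≤ (1 + ‖x - y‖) ^ r * bracket r y := by
  have hx : 0 < 1 + ‖x‖ := by positivity
  have hy : 0 < 1 + ‖y‖ := by positivity
  have hd : 0 < 1 + ‖x - y‖ := by positivity
  have h1 : 1 + ‖y‖ ≤ (1 + ‖x - y‖) * (1 + ‖x‖) := by
    have h2 : ‖y‖ ≤ ‖x‖ + ‖x - y‖ := by
      rw [norm_sub_rev]; exact norm_le_norm_add_norm_sub' y x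
    nlinarith [norm_nonneg x, norm_nonneg (x - y)]
  have h4 := Real.rpow_le_rpow hy.le h1 hr
  rw [Real.mul_rpow hd.le hx.le] at h4
  unfold bracket
  rw [Real.rpow_neg hx.le, Real.rpow_neg hy.le, ← div_eq_mul_inv, le_div_iff₀ (by positivity),
    ← div_eq_inv_mul, div_le_iff₀ (by positivity)]
  exact h4

variable [NormedSpace ℝ E] [FiniteDimensional ℝ E] [MeasurableSpace E] [BorelSpace E]
  {μ : Measure E} [μ.IsAddHaarMeasure]

/-- If some quantizer with bounded cells has finite output entropy, then the source density has
finite cross entropy with respect to a density whose logarithm is uniformly continuous, and that is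
spread out over any given distance `t`. -/
theorem exists_log_density_of_entropy {U : Type*} [Countable U] {P : E → ℝ} (hP : ∀ x, 0 ≤ P x)
    (hi : Integrable P μ) (h1 : ∫ x, P x ∂μ = 1) {A : E → U}
    (hA : ∀ u, NullMeasurableSet (A ⁻¹' {u}) μ) (a : U → E) {D : ℝ}
    (hD : ∀ x, ‖x - a (A x)‖ ≤ D) (hs : Summable fun u => Real.negMulLog (fiberProb μ P A u))
    {t : ℝ} (ht : 0 < t) :
    ∃ ψ : E → ℝ, (∀ x y, ψ x - ψ y ≤ (Module.finrank ℝ E + 1) * Real.log (1 + ‖x - y‖ / t)) ∧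
      UniformContinuous ψ ∧ Integrable (fun x => Real.exp (ψ x)) μ ∧
      ∫ x, Real.exp (ψ x) ∂μ = t ^ Module.finrank ℝ E *
        ∫ x, bracket (Module.finrank ℝ E + 1 : ℝ) (x : E) ∂μ ∧
      Integrable (fun x => P x * ψ x) μ ∧
      -∫ x, P x * ψ x ∂μ ≤ ∑' u, Real.negMulLog (fiberProb μ P A u) +
        (Module.finrank ℝ E + 1) * Real.log (1 + D / t) := by
  -- An exponent larger than the dimension makes the bracket integrable.
  set r : ℝ := Module.finrank ℝ E + 1 with hr
  have hr0 : 0 ≤ r := by positivity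
  have hD0 : 0 ≤ D := (norm_nonneg _).trans (hD 0)
  set f : U → ℝ := fiberProb μ P A with hfdef
  have hf : HasSum f 1 := h1 ▸ hasSum_integral_fiber hA hi
  have hf0 : ∀ u, 0 ≤ f u := fiberProb_nonneg hP
  -- The sum over `u` smooths the output law of the quantizer, placed at the reproduction points `a
  -- u`, by a heavy-tailed kernel of width `t`. Then `ψ` is its logarithm.
  set F : U → E → ℝ := fun u x => f u * bracket r (t⁻¹ • (x - a u)) with hF
  have hF0 : ∀ u x, 0 ≤ F u x := fun u x => mul_nonneg (hf0 u) (bracket_pos _ _).le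
  have hFf : ∀ u x, F u x ≤ f u := fun u x =>
    mul_le_of_le_one_right (hf0 u) (bracket_le_one hr0 _)
  have hFs : ∀ x, Summable fun u => F u x := fun x =>
    Summable.of_nonneg_of_le (fun u => hF0 u x) (fun u => hFf u x) hf.summable
  set g : E → ℝ := fun x => ∑' u, F u x with hg
  have hgle : ∀ x, g x ≤ 1 := fun x => hasSum_le (fun u => hFf u x) (hFs x).hasSum hf
  have hFg : ∀ u x, F u x ≤ g x := fun u x => (hFs x).le_tsum u fun v _ => hF0 v x
  obtain ⟨u₀, hu₀⟩ : ∃ u, 0 < f u := by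
    by_contra! h
    have : f = 0 := funext fun u => le_antisymm (h u) (hf0 u)
    rw [this] at hf
    exact one_ne_zero (hf.unique hasSum_zero)
  have hg0 : ∀ x, 0 < g x := fun x =>
    (mul_pos hu₀ (bracket_pos r (t⁻¹ • (x - a u₀)))).trans_le (hFg u₀ x)
  have hnorm : ∀ x : E, ‖t⁻¹ • x‖ = ‖x‖ / t := fun x => by
    rw [norm_smul, norm_inv, Real.norm_of_nonneg ht.le, inv_mul_eq_div]
  have hgexp : ∀ x y, g x ≤ (1 + ‖x - y‖ / t) ^ r * g y := by
    intro x y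
    refine hasSum_le (fun u => ?_) (hFs x).hasSum ((hFs y).hasSum.mul_left _)
    have := bracket_le_mul hr0 (t⁻¹ • (x - a u)) (t⁻¹ • (y - a u))
    rw [← smul_sub, sub_sub_sub_cancel_right, hnorm] at this
    calc F u x ≤ f u * ((1 + ‖x - y‖ / t) ^ r * bracket r (t⁻¹ • (y - a u))) :=
          mul_le_mul_of_nonneg_left this (hf0 u)
      _ = _ := by simp only [hF]; ring
  have hlog : ∀ x y, Real.log (g x) - Real.log (g y) ≤ r * Real.log (1 + ‖x - y‖ / t) := by
    intro x y
    have := Real.log_le_log (hg0 x) (hgexp x y)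
    rw [Real.log_mul (by positivity) (hg0 y).ne', Real.log_rpow (by positivity)] at this
    linarith
  have hlip : LipschitzWith (Real.toNNReal (r / t)) fun x => Real.log (g x) := by
    refine LipschitzWith.of_dist_le_mul fun x y => ?_
    rw [Real.coe_toNNReal _ (by positivity), Real.dist_eq, dist_eq_norm]
    have h0 : r * Real.log (1 + ‖x - y‖ / t) ≤ r / t * ‖x - y‖ := by
      have := Real.log_le_sub_one_of_pos (x := 1 + ‖x - y‖ / t) (by positivity)
      calc _ ≤ r * (1 + ‖x - y‖ / t - 1) := by gcongr
        _ = _ := by ring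
    have h1 := hlog x y
    have h2 := hlog y x
    rw [norm_sub_rev] at h2
    exact abs_le.2 ⟨by linarith, by linarith⟩
  have hgc : Continuous g := by
    have : g = fun x => Real.exp (Real.log (g x)) := funext fun x => (Real.exp_log (hg0 x)).symm
    rw [this]
    exact Real.continuous_exp.comp hlip.continuous
  have hK : Integrable (fun x : E => bracket r (t⁻¹ • x)) μ :=
    (integrable_one_add_norm (E := E) (r := r) (by simp [hr])).comp_smul (inv_ne_zero ht.ne')
  have hKm : Measurable (bracket r : E → ℝ) := by unfold bracket; fun_prop
  have hKI : ∫ x, bracket r (t⁻¹ • x) ∂μ = t ^ Module.finrank ℝ E * ∫ x, bracket r (x : E) ∂μ := by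
    rw [Measure.integral_comp_inv_smul_of_nonneg μ _ ht.le, smul_eq_mul]
  -- Tonelli: all translates of the kernel have the same integral and the weights `f u` add up to
  -- `1`.
  have hlin : ∫⁻ x, ENNReal.ofReal (g x) ∂μ =
      ENNReal.ofReal (∫ x, bracket r (t⁻¹ • x) ∂μ) := by
    have : ∀ x, ENNReal.ofReal (g x) = ∑' u, ENNReal.ofReal (F u x) := fun x => by
      rw [hg, ENNReal.ofReal_tsum_of_nonneg (hF0 · x) (hFs x)]
    simp only [this]
    rw [lintegral_tsum fun u => by
      refine Measurable.aemeasurable (Measurable.ennreal_ofReal ?_)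
      exact (hKm.comp ((measurable_id.sub_const _).const_smul _)).const_mul _]
    have h2 : ∀ u, ∫⁻ x, ENNReal.ofReal (F u x) ∂μ =
        ENNReal.ofReal (f u * ∫ x, bracket r (t⁻¹ • x) ∂μ) := by
      intro u
      rw [← ofReal_integral_eq_lintegral_ofReal ((hK.comp_sub_right (a u)).const_mul _)
        (ae_of_all _ fun x => hF0 u x), integral_const_mul,
        integral_sub_right_eq_self fun x => bracket r (t⁻¹ • x)]
    simp only [h2]
    have hI : 0 ≤ ∫ x, bracket r (t⁻¹ • x) ∂μ := integral_nonneg fun x => (bracket_pos r _).le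
    generalize ∫ x, bracket r (t⁻¹ • x) ∂μ = I at hI
    rw [← ENNReal.ofReal_tsum_of_nonneg (fun u => mul_nonneg (hf0 u) hI)
      (hf.summable.mul_right I), tsum_mul_right, hf.tsum_eq, one_mul]
  have hgint : Integrable g μ := by
    refine ⟨hgc.aestronglyMeasurable, ?_⟩
    rw [hasFiniteIntegral_iff_ofReal (ae_of_all _ fun x => (hg0 x).le), hlin]
    exact ENNReal.ofReal_lt_top
  have hexp : (fun x => Real.exp (Real.log (g x))) = g := funext fun x => Real.exp_log (hg0 x)
  refine ⟨fun x => Real.log (g x), hlog, hlip.uniformContinuous, by rwa [hexp], ?_, ?_⟩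
  · rw [hexp, ← hKI, integral_eq_lintegral_of_nonneg_ae (ae_of_all _ fun x => (hg0 x).le)
      hgc.aestronglyMeasurable, hlin, ENNReal.toReal_ofReal
      (integral_nonneg fun x => (bracket_pos r _).le)]
  · have hneg : ∀ x, Real.log (g x) ≤ 0 := fun x => Real.log_nonpos (hg0 x).le (hgle x)
    have hDt : 0 ≤ D / t := by positivity
    have hC : 0 ≤ r * Real.log (1 + D / t) := mul_nonneg hr0 (Real.log_nonneg (by linarith))
    refine integrable_mul_of_neg_le_log_fiberProb hA hP hi h1 hs
      hlip.continuous.aestronglyMeasurable hneg hC fun x h0 => ?_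
    -- The single term `u = A x` of the mixture suffices: its centre is within `D` of `x`.
    have hb : (1 + D / t) ^ (-r) ≤ bracket r (t⁻¹ • (x - a (A x))) := by
      refine Real.rpow_le_rpow_of_nonpos (by positivity) ?_ (by linarith)
      rw [hnorm]
      have := hD x
      gcongr
    have h5 : f (A x) * (1 + D / t) ^ (-r) ≤ g x :=
      (mul_le_mul_of_nonneg_left hb h0.le).trans (hFg (A x) x)
    have h6 := Real.log_le_log (by positivity) h5
    rw [Real.log_mul h0.ne' (by positivity), Real.log_rpow (by positivity)] at h6
    linarith

end LogApproximation

/-! ### Truncation, and differential entropy as a limit of cross entropies -/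

section LogApproximation

/-- Truncation of a real number to `[-n, n]`. -/
noncomputable def truncate (n t : ℝ) : ℝ := max (-n) (min n t)

theorem abs_truncate_le {n : ℝ} (hn : 0 ≤ n) (t : ℝ) : |truncate n t| ≤ n :=
  abs_le.2 ⟨le_max_left _ _, max_le (by linarith) (min_le_left _ _)⟩

theorem truncate_eq_self {n t : ℝ} (h : |t| ≤ n) : truncate n t = t := by
  rw [abs_le] at h
  rw [truncate, min_eq_right h.2, max_eq_right h.1]

theorem abs_truncate_sub_le (n s t : ℝ) : |truncate n s - truncate n t| ≤ |s - t| := by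
  refine (abs_max_sub_max_le_max _ _ _ _).trans ?_
  rw [sub_self, abs_zero]
  refine max_le (abs_nonneg _) ((abs_min_sub_min_le_max _ _ _ _).trans ?_)
  rw [sub_self, abs_zero]
  exact max_le (abs_nonneg _) le_rfl

theorem abs_truncate_le_abs {n : ℝ} (hn : 0 ≤ n) (t : ℝ) : |truncate n t| ≤ |t| := by
  have := abs_truncate_sub_le n t 0
  rwa [truncate_eq_self (by simpa using hn : |(0 : ℝ)| ≤ n), sub_zero, sub_zero] at this

/-- Provides, at `t = log (P / g)`, the dominating function `g + P` for `g * exp (truncate n t)`,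
uniformly in `n`. -/
theorem exp_truncate_le {n : ℝ} (hn : 0 ≤ n) (t : ℝ) : Real.exp (truncate n t) ≤ 1 + Real.exp t := by
  rcases le_total t 0 with h | h
  · have : truncate n t ≤ 0 := max_le (by linarith) ((min_le_right _ _).trans h)
    linarith [Real.exp_le_one_iff.2 this, Real.exp_pos t]
  · have : truncate n t ≤ t := max_le (by linarith) (min_le_right _ _)
    linarith [Real.exp_le_exp.2 this]

theorem measurable_truncate (n : ℝ) : Measurable (truncate n) := by
  unfold truncate; fun_prop

theorem abs_exp_sub_exp_le {n s t : ℝ} (hs : |s| ≤ n) (ht : |t| ≤ n) :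
    |Real.exp s - Real.exp t| ≤ Real.exp n * |s - t| := by
  wlog h : t ≤ s generalizing s t
  · rw [abs_sub_comm, abs_sub_comm s]
    exact this ht hs (le_of_not_ge h)
  · rw [abs_of_nonneg (sub_nonneg.2 (Real.exp_le_exp.2 h)), abs_of_nonneg (sub_nonneg.2 h)]
    have h1 := Real.add_one_le_exp (t - s)
    have h2 : Real.exp t = Real.exp s * Real.exp (t - s) := by rw [← Real.exp_add]; ring_nf
    have h3 : Real.exp s ≤ Real.exp n := Real.exp_le_exp.2 (abs_le.1 hs).2
    have h4 : Real.exp s * (t - s + 1) ≤ Real.exp t := by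
      rw [h2]; exact mul_le_mul_of_nonneg_left h1 (Real.exp_pos s).le
    nlinarith

/-- A bounded measurable approximation of `log (P / g)`. -/
theorem exists_measurable_log_approximation {E : Type*} [MeasurableSpace E] {μ : Measure E}
    {P g : E → ℝ} (hPm : Measurable P)
    (hP : ∀ x, 0 ≤ P x) (hi : Integrable P μ) (hgm : Measurable g) (hg0 : ∀ x, 0 < g x)
    (hgi : Integrable g μ) (hPlog : Integrable (fun x => Real.negMulLog (P x)) μ)
    (hPg : Integrable (fun x => P x * Real.log (g x)) μ) {ε : ℝ} (hε : 0 < ε) :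
    ∃ (n : ℝ) (θ : E → ℝ), 0 ≤ n ∧ Measurable θ ∧ (∀ x, |θ x| ≤ n) ∧
      -∫ x, P x * θ x ∂μ + ∫ x, g x * Real.exp (θ x) ∂μ ≤
        ∫ x, Real.negMulLog (P x) ∂μ + ∫ x, P x * Real.log (g x) ∂μ + ∫ x, P x ∂μ + ε := by
  classical
  let T : E → ℝ := fun x => Real.log (P x) - Real.log (g x)
  have hTm : Measurable T := (Real.measurable_log.comp hPm).sub (Real.measurable_log.comp hgm)
  -- Where `P = 0` the true value of `log (P / g)` is `-∞`, whereas `Real.log 0 = 0`. Taking `-n`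
  -- there makes `g * exp θ` tend to `0 = P` on that set.
  let θ : ℕ → E → ℝ := fun n x => if P x = 0 then -(n : ℝ) else truncate n (T x)
  have hθm : ∀ n, Measurable (θ n) := fun n =>
    Measurable.ite (hPm (measurableSet_singleton 0)) measurable_const
      ((measurable_truncate _).comp hTm)
  have hθn : ∀ (n : ℕ) x, |θ n x| ≤ n := fun n x => by
    by_cases h : P x = 0
    · simp [θ, h]
    · simpa only [θ, h, if_false] using abs_truncate_le n.cast_nonneg _
  have hPT : Integrable (fun x => P x * T x) μ := by
    refine (hPlog.neg.sub hPg).congr (ae_of_all _ fun x => ?_)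
    simp only [Pi.sub_apply, Pi.neg_apply, Real.negMulLog, T]; ring
  have hlim1 : Tendsto (fun n => ∫ x, P x * θ n x ∂μ) atTop (𝓝 (∫ x, P x * T x ∂μ)) := by
    refine tendsto_integral_of_dominated_convergence (fun x => |P x * T x|)
      (fun n => (hPm.mul (hθm n)).aestronglyMeasurable) hPT.abs
      (fun n => ae_of_all _ fun x => ?_) (ae_of_all _ fun x => ?_)
    · by_cases h : P x = 0
      · simp [h]
      · rw [Real.norm_eq_abs, abs_mul, abs_mul]
        simp only [θ, h, if_false]
        exact mul_le_mul_of_nonneg_left (abs_truncate_le_abs n.cast_nonneg _) (abs_nonneg _)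
    · by_cases h : P x = 0
      · simp [h]
      · refine tendsto_const_nhds.congr' ?_
        filter_upwards [tendsto_natCast_atTop_atTop.eventually_ge_atTop |T x|] with n hn
        simp only [θ, h, if_false, truncate_eq_self hn]
  have hlim2 : Tendsto (fun n => ∫ x, g x * Real.exp (θ n x) ∂μ) atTop (𝓝 (∫ x, P x ∂μ)) := by
    refine tendsto_integral_of_dominated_convergence (fun x => g x + P x)
      (fun n => (hgm.mul (hθm n).exp).aestronglyMeasurable) (hgi.add hi)
      (fun n => ae_of_all _ fun x => ?_) (ae_of_all _ fun x => ?_)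
    · rw [Real.norm_eq_abs, abs_of_nonneg (mul_nonneg (hg0 x).le (Real.exp_pos _).le)]
      by_cases h : P x = 0
      · simp only [θ, h, if_true, add_zero]
        exact mul_le_of_le_one_right (hg0 x).le (Real.exp_le_one_iff.2 (by simp))
      · simp only [θ, h, if_false]
        have h1 := exp_truncate_le n.cast_nonneg (T x)
        have h2 : Real.exp (T x) = P x / g x := by
          simp only [T]
          rw [Real.exp_sub, Real.exp_log ((hP x).lt_of_ne' h), Real.exp_log (hg0 x)]
        rw [h2] at h1
        calc _ ≤ g x * (1 + P x / g x) := mul_le_mul_of_nonneg_left h1 (hg0 x).le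
          _ = _ := by field_simp [(hg0 x).ne']
    · by_cases h : P x = 0
      · simp only [θ, h, if_true]
        rw [← mul_zero (g x)]
        exact (Real.tendsto_exp_neg_atTop_nhds_zero.comp tendsto_natCast_atTop_atTop).const_mul _
      · refine tendsto_const_nhds.congr' ?_
        filter_upwards [tendsto_natCast_atTop_atTop.eventually_ge_atTop |T x|] with n hn
        simp only [θ, h, if_false, truncate_eq_self hn, T]
        rw [Real.exp_sub, Real.exp_log ((hP x).lt_of_ne' h), Real.exp_log (hg0 x)]
        field_simp [(hg0 x).ne']
  -- The limit is the value of `-∫ P θ + ∫ g exp θ` at `θ = log (P / g)`, so some finite truncation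
  -- level is within `ε`.
  have hlim := hlim1.neg.add hlim2
  obtain ⟨n, hn⟩ := ((tendsto_order.1 hlim).2 _ (lt_add_of_pos_right _ hε)).exists
  refine ⟨n, θ n, n.cast_nonneg, hθm n, hθn n, hn.le.trans (le_of_eq ?_)⟩
  have : ∫ x, P x * T x ∂μ = -∫ x, Real.negMulLog (P x) ∂μ - ∫ x, P x * Real.log (g x) ∂μ := by
    have hneg : Integrable (fun x => -Real.negMulLog (P x)) μ := hPlog.neg
    rw [← integral_neg, ← integral_sub hneg hPg]
    refine integral_congr_ae (ae_of_all _ fun x => ?_)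
    simp only [Real.negMulLog, T]; ring
  rw [this]; ring

variable {E : Type*} [NormedAddCommGroup E] [NormedSpace ℝ E] [FiniteDimensional ℝ E]
  [MeasurableSpace E] [BorelSpace E] {μ : Measure E}

/-- The differential entropy is approximated by cross entropies with respect to positive functions
whose logarithms are uniformly continuous. -/
theorem exists_uniformContinuous_crossEntropy_le {P : E → ℝ} (hPm : Measurable P)
    (hP : ∀ x, 0 ≤ P x) (hi : Integrable P μ)
    (hPlog : Integrable (fun x => Real.negMulLog (P x)) μ) {ψ₀ : E → ℝ}
    (hψ : UniformContinuous ψ₀) (hexp : Integrable (fun x => Real.exp (ψ₀ x)) μ)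
    (hPψ : Integrable (fun x => P x * ψ₀ x) μ) {ε : ℝ} (hε : 0 < ε) :
    ∃ ψ : E → ℝ, UniformContinuous ψ ∧ Integrable (fun x => Real.exp (ψ x)) μ ∧
      Integrable (fun x => P x * ψ x) μ ∧
      -∫ x, P x * ψ x ∂μ + ∫ x, Real.exp (ψ x) ∂μ ≤
        ∫ x, Real.negMulLog (P x) ∂μ + ∫ x, P x ∂μ + ε := by
  set g : E → ℝ := fun x => Real.exp (ψ₀ x) with hg
  have hgm : Measurable g := hψ.continuous.measurable.exp
  have hg0 : ∀ x, 0 < g x := fun x => Real.exp_pos _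
  obtain ⟨n, θ, hn, hθm, hθn, hθ⟩ := exists_measurable_log_approximation hPm hP hi hgm hg0 hexp
    hPlog (by simpa only [hg, Real.log_exp] using hPψ) (half_pos hε)
  simp only [hg, Real.log_exp] at hθ
  have hC : 0 < 1 + Real.exp n := by positivity
  set η : ℝ := ε / 2 / (1 + Real.exp n) with hη
  have hη0 : 0 < η := by positivity
  have hPgi : Integrable (fun x => P x + g x) μ := hi.add hexp
  have hPg0 : ∀ x, 0 ≤ P x + g x := fun x => add_nonneg (hP x) (hg0 x).le
  have hPgm : Measurable fun x => ENNReal.ofReal (P x + g x) := (hPm.add hgm).ennreal_ofReal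
  -- Closeness in `L¹` of this finite measure controls both integrals at once: the one with weight
  -- `P` directly, and the one with weight `g` because `exp` has Lipschitz constant `exp n` on `[-n,
  -- n]`. This explains the factor `1 + exp n` in `η`.
  set κ : Measure E := μ.withDensity fun x => ENNReal.ofReal (P x + g x) with hκ
  have : IsFiniteMeasure κ := isFiniteMeasure_withDensity_ofReal hPgi.2
  have hθi : Integrable θ κ := Integrable.of_bound hθm.aestronglyMeasurable n
    (ae_of_all _ fun x => by simpa using hθn x)
  obtain ⟨φ₀, hφs, hφθ, hφc, hφi⟩ := hθi.exists_hasCompactSupport_integral_sub_le hη0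
  have hκint : ∫ x, ‖θ x - φ₀ x‖ ∂κ = ∫ x, (P x + g x) * |θ x - φ₀ x| ∂μ := by
    rw [hκ, integral_withDensity_eq_integral_toReal_smul hPgm (by simp)]
    simp [ENNReal.toReal_ofReal (hPg0 _)]
  have hκi : Integrable (fun x => (P x + g x) * |θ x - φ₀ x|) μ := by
    have := (hθi.sub hφi).abs
    rw [hκ, integrable_withDensity_iff_integrable_smul' hPgm (by simp)] at this
    simpa [ENNReal.toReal_ofReal (hPg0 _)] using this
  rw [hκint] at hφθ
  -- Truncation restores the bound `n` without moving `φ₀` away from `θ`, since `θ` itself takes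
  -- values in `[-n, n]`.
  set φ : E → ℝ := fun x => truncate n (φ₀ x) with hφ
  have hφn : ∀ x, |φ x| ≤ n := fun x => abs_truncate_le hn _
  have hφu : UniformContinuous φ := by
    have h1 : LipschitzWith 1 (truncate n) := LipschitzWith.of_dist_le_mul fun s t => by
      simpa [Real.dist_eq] using abs_truncate_sub_le n s t
    exact h1.uniformContinuous.comp (hφs.uniformContinuous_of_continuous hφc)
  have hd : ∀ x, |θ x - φ x| ≤ |θ x - φ₀ x| := fun x => by
    have := abs_truncate_sub_le n (θ x) (φ₀ x)
    rwa [truncate_eq_self (hθn x)] at this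
  have bdd : ∀ {h w : E → ℝ}, Integrable h μ → Measurable w → (∃ C, ∀ x, |w x| ≤ C) →
      Integrable (fun x => h x * w x) μ := fun {h w} hh hw ⟨C, hC⟩ =>
    hh.mul_bdd hw.aestronglyMeasurable (ae_of_all _ fun x => by simpa using hC x)
  have hPφ : Integrable (fun x => P x * φ x) μ := bdd hi hφu.continuous.measurable ⟨n, hφn⟩
  have hPθ : Integrable (fun x => P x * θ x) μ := bdd hi hθm ⟨n, hθn⟩
  have hen : ∀ {t : ℝ}, |t| ≤ n → |Real.exp t| ≤ Real.exp n := fun {t} ht => by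
    rw [abs_of_pos (Real.exp_pos _)]; exact Real.exp_le_exp.2 (abs_le.1 ht).2
  have hgφ : Integrable (fun x => g x * Real.exp (φ x)) μ :=
    bdd hexp hφu.continuous.measurable.exp ⟨Real.exp n, fun x => hen (hφn x)⟩
  have hgθ : Integrable (fun x => g x * Real.exp (θ x)) μ :=
    bdd hexp hθm.exp ⟨Real.exp n, fun x => hen (hθn x)⟩
  have hexpeq : ∀ x, Real.exp (ψ₀ x + φ x) = g x * Real.exp (φ x) := fun x => Real.exp_add _ _
  -- `exp ψ` is not normalized; its total mass is carried along as a separate term, in the form in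
  -- which Gibbs' inequality uses it.
  refine ⟨fun x => ψ₀ x + φ x, hψ.add hφu, by simpa only [hexpeq] using hgφ,
    (hPψ.add hPφ).congr (ae_of_all _ fun x => (mul_add _ _ _).symm), ?_⟩
  simp only [hexpeq, mul_add]
  rw [integral_add hPψ hPφ]
  have hd1 : Integrable (fun x => P x * θ x - P x * φ x) μ := hPθ.sub hPφ
  have hd2 : Integrable (fun x => g x * Real.exp (φ x) - g x * Real.exp (θ x)) μ := hgφ.sub hgθ
  have hmain : (-∫ x, P x * φ x ∂μ + ∫ x, g x * Real.exp (φ x) ∂μ) -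
      (-∫ x, P x * θ x ∂μ + ∫ x, g x * Real.exp (θ x) ∂μ) ≤ ε / 2 := by
    calc _ = ∫ x, (P x * θ x - P x * φ x) + (g x * Real.exp (φ x) - g x * Real.exp (θ x)) ∂μ := by
          rw [integral_add hd1 hd2, integral_sub hPθ hPφ, integral_sub hgφ hgθ]
          ring
      _ ≤ ∫ x, (1 + Real.exp n) * ((P x + g x) * |θ x - φ₀ x|) ∂μ := by
          refine integral_mono (hd1.add hd2) (hκi.const_mul _) fun x => ?_
          have h1 : θ x - φ x ≤ |θ x - φ₀ x| := (le_abs_self _).trans (hd x)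
          have h2 : Real.exp (φ x) - Real.exp (θ x) ≤ Real.exp n * |θ x - φ₀ x| := by
            refine (le_abs_self _).trans ((abs_exp_sub_exp_le (hφn x) (hθn x)).trans ?_)
            rw [abs_sub_comm]
            exact mul_le_mul_of_nonneg_left (hd x) (Real.exp_pos _).le
          have h3 := mul_le_mul_of_nonneg_left h1 (hP x)
          have h4 := mul_le_mul_of_nonneg_left h2 (hg0 x).le
          have h5 : 0 ≤ Real.exp n * (P x * |θ x - φ₀ x|) :=
            mul_nonneg (Real.exp_pos _).le (mul_nonneg (hP x) (abs_nonneg _))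
          have h6 : 0 ≤ g x * |θ x - φ₀ x| := mul_nonneg (hg0 x).le (abs_nonneg _)
          simp only
          nlinarith
      _ = (1 + Real.exp n) * ∫ x, (P x + g x) * |θ x - φ₀ x| ∂μ := integral_const_mul _ _
      _ ≤ (1 + Real.exp n) * η := mul_le_mul_of_nonneg_left hφθ hC.le
      _ = ε / 2 := by rw [hη]; field_simp
  linarith

end LogApproximation

/-! ### Geometry of a lattice with a nearest-point map -/

section Lattice

variable {L : ℕ} {Λ : Submodule ℤ (Space L)}

/-- `Q` maps every vector to a nearest lattice point. -/
def IsNearest (Λ : Submodule ℤ (Space L)) (Q : Space L → Λ) : Prop :=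
  ∀ x, ∀ y ∈ Λ, ‖x - (Q x : Space L)‖ ≤ ‖x - y‖

/-- The points with two nearest candidates. -/
def tieSet (Λ : Submodule ℤ (Space L)) : Set (Space L) :=
  {x | ∃ y ∈ Λ, ∃ z ∈ Λ, y ≠ z ∧ ‖x - y‖ = ‖x - z‖}

/-- The closed Voronoi cell of `y`. -/
def voronoi (Λ : Submodule ℤ (Space L)) (y : Space L) : Set (Space L) :=
  {x | ∀ z ∈ Λ, ‖x - y‖ ≤ ‖x - z‖}

theorem isClosed_voronoi (y : Space L) : IsClosed (voronoi Λ y) := by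
  simp only [voronoi, Set.ofPred_forall]
  exact isClosed_iInter fun z => isClosed_iInter fun _ => isClosed_le (by fun_prop) (by fun_prop)

/-- Ties lie on countably many perpendicular bisectors, each a proper affine subspace. -/
theorem volume_tieSet [Countable Λ] : volume (tieSet Λ) = 0 := by
  have : tieSet Λ ⊆ ⋃ q : {q : Λ × Λ // q.1 ≠ q.2},
      (AffineSubspace.perpBisector (q.1.1 : Space L) q.1.2 : Set (Space L)) := by
    rintro x ⟨y, hy, z, hz, hne, h⟩
    refine Set.mem_iUnion.2 ⟨⟨(⟨y, hy⟩, ⟨z, hz⟩), fun e => hne (congrArg Subtype.val e)⟩, ?_⟩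
    simpa [AffineSubspace.mem_perpBisector_iff_dist_eq, dist_eq_norm] using h
  refine measure_mono_null this (measure_iUnion_null fun q => Measure.addHaar_affineSubspace _ _ ?_)
  rw [Ne, AffineSubspace.perpBisector_eq_top]
  exact fun h => q.2 (Subtype.ext h)

/-- Rounding down the coordinates in a lattice basis leaves a remainder in a bounded parallelepiped.
-/
theorem exists_covering_radius (Λ : Submodule ℤ (Space L)) [DiscreteTopology Λ] [IsZLattice ℝ Λ] :
    ∃ ρ : ℝ, 0 < ρ ∧ ∀ x : Space L, ∃ y ∈ Λ, ‖x - y‖ ≤ ρ := by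
  let b := Module.Free.chooseBasis ℤ Λ
  let b' := b.ofZLatticeBasis ℝ Λ
  refine ⟨∑ i, ‖b' i‖ + 1, by positivity, fun x => ⟨ZSpan.floor b' x, ?_, ?_⟩⟩
  · exact (b.ofZLatticeBasis_span ℝ Λ).le (ZSpan.floor b' x).2
  · exact (ZSpan.norm_fract_le b' x).trans (by linarith)

namespace IsNearest

variable {Q : Space L → Λ}

theorem fiber_subset (hQ : IsNearest Λ Q) (u : Λ) : Q ⁻¹' {u} ⊆ voronoi Λ u := by
  rintro x hx z hz
  have : Q x = u := hx
  exact this ▸ hQ x z hz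

theorem eq_of_mem_voronoi (hQ : IsNearest Λ Q) {x : Space L} (hx : x ∉ tieSet Λ) {u : Λ}
    (hu : x ∈ voronoi Λ u) : Q x = u := by
  by_contra h
  exact hx ⟨Q x, (Q x).2, u, u.2, fun e => h (Subtype.ext e),
    le_antisymm (hQ x u u.2) (hu _ (Q x).2)⟩

/-- The tie set is invariant under `Λ`, and off it the nearest point is unique, so equivariance
holds whatever the tie-breaking. -/
theorem map_add (hQ : IsNearest Λ Q) {x : Space L} (hx : x ∉ tieSet Λ) (d : Λ) :
    Q (x + d) = Q x + d := by
  refine hQ.eq_of_mem_voronoi ?_ fun z hz => ?_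
  · rintro ⟨y, hy, z, hz, hne, h⟩
    refine hx ⟨y - d, Λ.sub_mem hy d.2, z - d, Λ.sub_mem hz d.2, by simpa using hne, ?_⟩
    rwa [sub_sub_eq_add_sub, sub_sub_eq_add_sub]
  · have := hQ x (z - d) (Λ.sub_mem hz d.2)
    rw [sub_sub_eq_add_sub] at this
    simpa using this

/-- Tie-breaking changes a cell only inside the null tie set. Hence cells are null-measurable with
no measurability assumption on `Q`. -/
theorem fiber_ae_eq [Countable Λ] (hQ : IsNearest Λ Q) (u : Λ) :
    Q ⁻¹' {u} =ᵐ[volume] voronoi Λ u := by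
  refine (hQ.fiber_subset u).eventuallyLE.antisymm ?_
  rw [ae_le_set]
  refine measure_mono_null (fun x hx => ?_) (volume_tieSet (Λ := Λ))
  by_contra h
  exact hx.2 (hQ.eq_of_mem_voronoi h hx.1)

theorem nullMeasurableSet_fiber [Countable Λ] (hQ : IsNearest Λ Q) (u : Λ) :
    NullMeasurableSet (Q ⁻¹' {u}) :=
  (isClosed_voronoi (u : Space L)).measurableSet.nullMeasurableSet.congr (hQ.fiber_ae_eq u).symm

theorem ae_scaled_notMem_tieSet [Countable Λ] {β : ℝ} (hβ : 0 < β) :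
    ∀ᵐ x : Space L, β⁻¹ • x ∉ tieSet Λ := by
  rw [ae_iff]
  simp only [not_not]
  change volume ((fun x => β⁻¹ • x) ⁻¹' tieSet Λ) = 0
  rw [Measure.addHaar_preimage_smul _ (inv_ne_zero hβ.ne'), volume_tieSet, mul_zero]

theorem ae_map_add [Countable Λ] (hQ : IsNearest Λ Q) {β : ℝ} (hβ : 0 < β) :
    ∀ᵐ x : Space L, ∀ d : Λ, Q (β⁻¹ • (x + β • (d : Space L))) = Q (β⁻¹ • x) + d := by
  filter_upwards [ae_scaled_notMem_tieSet (Λ := Λ) hβ] with x hx d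
  rw [smul_add, inv_smul_smul₀ hβ.ne']
  exact hQ.map_add hx d

theorem nullMeasurableSet_scaled_fiber [Countable Λ] (hQ : IsNearest Λ Q) {β : ℝ} (hβ : 0 < β)
    (u : Λ) : NullMeasurableSet ((fun x => Q (β⁻¹ • x)) ⁻¹' {u}) := by
  have hc : IsClosed ((fun x : Space L => β⁻¹ • x) ⁻¹' voronoi Λ u) :=
    (isClosed_voronoi (u : Space L)).preimage (by fun_prop)
  refine hc.measurableSet.nullMeasurableSet.congr ?_
  filter_upwards [ae_scaled_notMem_tieSet (Λ := Λ) hβ] with x hx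
  exact propext ⟨fun h => hQ.eq_of_mem_voronoi hx h, fun h => hQ.fiber_subset u h⟩

variable [DiscreteTopology Λ] [IsZLattice ℝ Λ]

theorem exists_radius (Λ : Submodule ℤ (Space L)) [DiscreteTopology Λ] [IsZLattice ℝ Λ] :
    ∃ ρ : ℝ, 0 < ρ ∧ ∀ Q : Space L → Λ, IsNearest Λ Q → ∀ x, ‖x - (Q x : Space L)‖ ≤ ρ := by
  obtain ⟨ρ, h0, h⟩ := exists_covering_radius Λ
  refine ⟨ρ, h0, fun Q hQ x => ?_⟩
  obtain ⟨y, hy, hxy⟩ := h x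
  exact (hQ x y hy).trans hxy

theorem isAddFundamentalDomain (hQ : IsNearest Λ Q) :
    IsAddFundamentalDomain Λ (Q ⁻¹' {0}) (volume : Measure (Space L)) where
  nullMeasurableSet := hQ.nullMeasurableSet_fiber 0
  ae_covers := by
    have : ∀ᵐ x : Space L, x ∉ tieSet Λ := measure_eq_zero_iff_ae_notMem.1 volume_tieSet
    filter_upwards [this] with x hx
    refine ⟨-Q x, ?_⟩
    change Q (-Q x +ᵥ x) = 0
    rw [Submodule.vadd_def, vadd_eq_add, add_comm, hQ.map_add hx, add_neg_cancel]
  aedisjoint := by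
    intro g h hne
    refine measure_mono_null (fun x hx => ?_) (volume_tieSet (Λ := Λ))
    by_contra hT
    have key : ∀ d : Λ, x ∈ (fun y => d +ᵥ y) '' (Q ⁻¹' {0}) → Q x = d := by
      rintro d ⟨y, hy, rfl⟩
      have hy0 : Q y = 0 := hy
      refine hQ.eq_of_mem_voronoi hT fun z hz => ?_
      have := hQ y (z - d) (Λ.sub_mem hz d.2)
      rw [hy0] at this
      simp only [Submodule.vadd_def, vadd_eq_add]
      simpa [sub_sub_eq_add_sub, add_comm] using this
    exact hne ((key g hx.1).symm.trans (key h hx.2))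

/-- The cell of `0` is a fundamental domain, and the closed Voronoi cells are translates of one
another. -/
theorem volume_fiber (hQ : IsNearest Λ Q) (u : Λ) :
    volume (Q ⁻¹' {u}) = ENNReal.ofReal (ZLattice.covolume Λ) := by
  have h0 : volume (Q ⁻¹' {(0 : Λ)}) = ENNReal.ofReal (ZLattice.covolume Λ) := by
    obtain ⟨ρ, -, hρ⟩ := exists_radius Λ
    have hfin : volume (Q ⁻¹' {(0 : Λ)}) ≠ ⊤ := by
      refine ((measure_mono fun x hx => ?_).trans_lt
        (measure_closedBall_lt_top (x := (0 : Space L)) (r := ρ))).ne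
      have hx0 : Q x = 0 := hx
      have := hρ Q hQ x
      rw [hx0] at this
      simpa using this
    rw [ZLattice.covolume_eq_measure_fundamentalDomain Λ volume hQ.isAddFundamentalDomain,
      Measure.real, ENNReal.ofReal_toReal hfin]
  have hv : voronoi Λ (u : Space L) = (fun x => x - (u : Space L)) ⁻¹' voronoi Λ ((0 : Λ) : Space L) := by
    ext x
    simp only [voronoi, Set.mem_preimage, Set.mem_ofPred_eq, ZeroMemClass.coe_zero, sub_zero]
    refine ⟨fun h z hz => ?_, fun h z hz => ?_⟩
    · have := h (z + u) (Λ.add_mem hz u.2)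
      rwa [sub_add_eq_sub_sub_swap] at this
    · have := h (z - u) (Λ.sub_mem hz u.2)
      rwa [sub_sub_sub_cancel_right] at this
  rw [measure_congr (hQ.fiber_ae_eq u), hv,
    (measurePreserving_sub_right volume (u : Space L)).measure_preimage
      (isClosed_voronoi _).measurableSet.nullMeasurableSet, ← measure_congr (hQ.fiber_ae_eq 0), h0]

theorem volume_scaled_fiber (hQ : IsNearest Λ Q) {β : ℝ} (hβ : 0 < β) (u : Λ) :
    volume ((fun x => Q (β⁻¹ • x)) ⁻¹' {u}) =
      ENNReal.ofReal (β ^ L * ZLattice.covolume Λ) := by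
  have : (fun x => Q (β⁻¹ • x)) ⁻¹' {u} = (fun x => β⁻¹ • x) ⁻¹' (Q ⁻¹' {u}) := rfl
  rw [this, Measure.addHaar_preimage_smul _ (inv_ne_zero hβ.ne'), hQ.volume_fiber,
    ← ENNReal.ofReal_mul (abs_nonneg _)]
  congr 2
  simp [abs_of_pos hβ]

/-- The region quantized to a finite set of lattice points. -/
theorem volume_real_preimage (hQ : IsNearest Λ Q) (S : Finset Λ) :
    volume.real (Q ⁻¹' S) = S.card * ZLattice.covolume Λ := by
  have : Q ⁻¹' S = ⋃ u ∈ S, Q ⁻¹' {u} := by ext x; simp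
  rw [this, measureReal_biUnion_finset₀ (fun u _ v _ huv => (Disjoint.preimage Q
    (Set.disjoint_singleton.2 huv)).aedisjoint) (fun u _ => hQ.nullMeasurableSet_fiber u)
    fun u _ => by simp [hQ.volume_fiber]]
  simp [Measure.real, hQ.volume_fiber, ENNReal.toReal_ofReal (ZLattice.covolume_pos Λ volume).le]

end IsNearest

end Lattice

/-! ### Counting lattice points in balls and on hyperplanes -/

section Counting

variable {L : ℕ} {Λ : Submodule ℤ (Space L)}

theorem volume_real_ball {r : ℝ} (hr : 0 ≤ r) (z : Space L) :
    volume.real (Metric.closedBall z r) = r ^ L * volume.real (Metric.ball (0 : Space L) 1) := by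
  rw [Measure.addHaar_real_closedBall _ _ hr, finrank_euclideanSpace_fin]

theorem volume_real_ball_zero {r : ℝ} (hr : 0 < r) :
    volume.real (Metric.ball (0 : Space L) r) =
      r ^ L * volume.real (Metric.ball (0 : Space L) 1) := by
  rw [Measure.real, Measure.addHaar_ball_of_pos _ _ hr, finrank_euclideanSpace_fin,
    ENNReal.toReal_mul, ENNReal.toReal_ofReal (by positivity), Measure.real]

theorem volume_real_unitBall_pos : 0 < volume.real (Metric.ball (0 : Space L) 1) :=
  ENNReal.toReal_pos (Metric.measure_ball_pos _ _ one_pos).ne' measure_ball_lt_top.ne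

theorem setIntegral_norm_sq_ball {r : ℝ} (hr : 0 < r) :
    ∫ x in Metric.ball (0 : Space L) r, ‖x‖ ^ 2 =
      r ^ (L + 2) * ∫ x in Metric.ball (0 : Space L) 1, ‖x‖ ^ 2 := by
  have := Measure.setIntegral_comp_smul_of_pos (μ := (volume : Measure (Space L)))
    (fun x => ‖x‖ ^ 2) (Metric.ball (0 : Space L) 1) hr
  rw [smul_unitBall_of_pos hr, finrank_euclideanSpace_fin] at this
  simp only [norm_smul, mul_pow, Real.norm_eq_abs, sq_abs, smul_eq_mul] at this
  rw [integral_const_mul] at this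
  rw [eq_inv_mul_iff_mul_eq₀ (by positivity)] at this
  rw [← this]; ring

theorem integrableOn_norm_sq {s : Set (Space L)} {r : ℝ} (h : s ⊆ Metric.ball 0 r) :
    IntegrableOn (fun x : Space L => ‖x‖ ^ 2) s := by
  refine IntegrableOn.mono_set ?_ (h.trans Metric.ball_subset_closedBall)
  exact (by fun_prop : Continuous fun x : Space L => ‖x‖ ^ 2).continuousOn.integrableOn_compact
    (isCompact_closedBall _ _)

variable [DiscreteTopology Λ] [IsZLattice ℝ Λ] {Q : Space L → Λ}

/-- A ball of radius `t` contains `O((1 + t) ^ L)` lattice points. -/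
theorem exists_card_le (hQ : IsNearest Λ Q) :
    ∃ C : ℝ, 0 < C ∧ ∀ (z : Space L) (t : ℝ), 0 ≤ t → ∀ S : Finset Λ,
      (∀ u ∈ S, ‖(u : Space L) - z‖ ≤ t) → (S.card : ℝ) ≤ C * (1 + t) ^ L := by
  obtain ⟨ρ, hρ0, hρ⟩ := IsNearest.exists_radius Λ
  have hν := ZLattice.covolume_pos Λ volume
  have hω := volume_real_unitBall_pos (L := L)
  refine ⟨volume.real (Metric.ball (0 : Space L) 1) * (1 + ρ) ^ L / ZLattice.covolume Λ,
    by positivity, fun z t ht S hS => ?_⟩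
  -- Volume comparison: the cells of the points of `S` are almost disjoint, of volume `ν` each, and
  -- stay within the covering radius `ρ` of their centres.
  have hsub : Q ⁻¹' S ⊆ Metric.closedBall z (t + ρ) := by
    intro x hx
    have h1 := hS (Q x) hx
    have h2 := hρ Q hQ x
    rw [Metric.mem_closedBall, dist_eq_norm]
    calc ‖x - z‖ = ‖((Q x : Space L) - z) + (x - Q x)‖ := by congr 1; abel
      _ ≤ _ := (norm_add_le _ _).trans (add_le_add h1 h2)
  have h3 := measureReal_mono hsub (measure_closedBall_lt_top (μ := volume)).ne
  rw [hQ.volume_real_preimage, volume_real_ball (by positivity)] at h3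
  have h4 : (t + ρ) ^ L ≤ ((1 + ρ) * (1 + t)) ^ L := by
    gcongr; nlinarith
  rw [mul_pow] at h4
  rw [div_mul_eq_mul_div, le_div_iff₀ hν]
  nlinarith

theorem finite_closedBall (hQ : IsNearest Λ Q) (t : ℝ) :
    {u : Λ | ‖(u : Space L)‖ ≤ t}.Finite := by
  obtain ⟨C, -, hC⟩ := exists_card_le hQ
  by_contra h
  rcases lt_or_ge t 0 with ht | ht
  · refine h (Set.Finite.subset Set.finite_empty fun u hu => ?_)
    have := norm_nonneg (u : Space L)
    have h2 : ‖(u : Space L)‖ ≤ t := hu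
    linarith
  obtain ⟨S, hS, hcard⟩ := Set.Infinite.exists_subset_card_eq h (⌈C * (1 + t) ^ L⌉₊ + 1)
  have := hC 0 t ht S fun u hu => by simpa using hS hu
  rw [hcard] at this
  push_cast at this
  linarith [Nat.le_ceil (C * (1 + t) ^ L)]

/-- A hyperplane contains a negligible fraction of the lattice points of a large ball. -/
theorem exists_card_hyperplane_le (hQ : IsNearest Λ Q) (ρ : ℝ) (hρ : 0 ≤ ρ) :
    ∃ C : ℝ, 0 < C ∧ ∀ (w : Space L), w ≠ 0 → ∀ (s c : ℝ), 1 ≤ c → ∀ T : Finset Λ,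
      (∀ v ∈ T, ‖(v : Space L)‖ ≤ ρ * c ∧ inner ℝ (v : Space L) w = s) →
        (T.card : ℝ) * c ≤ C * c ^ L := by
  classical
  obtain ⟨C, hC0, hC⟩ := exists_card_le hQ
  let b := Module.Free.chooseBasis ℤ Λ
  set B : ℝ := ∑ i, ‖(b i : Space L)‖ with hB
  have hB0 : 0 ≤ B := Finset.sum_nonneg fun i _ => norm_nonneg _
  refine ⟨C * (1 + ρ + 2 * B) ^ L, by positivity, fun w hw s c hc T hT => ?_⟩
  -- Translating `T` by `0, 1, ..., J - 1` times a basis vector transversal to the hyperplane gives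
  -- disjoint sets. With `J = ⌈c⌉` all of them remain in a ball of radius `O(c)`, so `c * #T` is at
  -- most the number of lattice points there.
  obtain ⟨i, hi⟩ : ∃ i, inner ℝ (b i : Space L) w ≠ 0 := by
    by_contra! h
    refine hw ?_
    have : ∀ x : Space L, inner ℝ x w = 0 := by
      intro x
      rw [← (b.ofZLatticeBasis ℝ Λ).sum_repr x, sum_inner (𝕜 := ℝ)]
      refine Finset.sum_eq_zero fun i _ => ?_
      rw [inner_smul_left, b.ofZLatticeBasis_apply ℝ Λ, h i, mul_zero]
    exact inner_self_eq_zero.1 (this w)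
  set J : ℕ := ⌈c⌉₊ with hJ
  have hcJ : c ≤ J := Nat.le_ceil c
  have hJc : (J : ℝ) ≤ 2 * c := by
    have := Nat.ceil_lt_add_one (zero_le_one.trans hc)
    rw [← hJ] at this; linarith
  have hbi : ‖(b i : Space L)‖ ≤ B :=
    Finset.single_le_sum (f := fun i => ‖(b i : Space L)‖) (fun i _ => norm_nonneg _)
      (Finset.mem_univ i)
  let g : Λ × ℕ → Λ := fun q => q.1 + (q.2 : ℤ) • b i
  have hinj : Set.InjOn g (T ×ˢ Finset.range J : Finset (Λ × ℕ)) := by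
    rintro ⟨v, j⟩ hv ⟨v', j'⟩ hv' h
    simp only [Finset.coe_product, Set.mem_prod, Finset.mem_coe] at hv hv'
    have h1 := congrArg (fun z : Λ => inner ℝ (z : Space L) w) h
    simp only [g, Submodule.coe_add, Submodule.coe_smul, inner_add_left, (hT v hv.1).2,
      (hT v' hv'.1).2, ← Int.cast_smul_eq_zsmul ℝ, inner_smul_left] at h1
    have h2 : (j : ℝ) = j' := by
      have := mul_right_cancel₀ hi (add_left_cancel h1)
      simpa using this
    have h3 : j = j' := by exact_mod_cast h2
    subst h3
    simpa [g] using h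
  have hcard := hC 0 ((ρ + 2 * B) * c) (by positivity) ((T ×ˢ Finset.range J).image g) (by
    intro u hu
    obtain ⟨⟨v, j⟩, hv, rfl⟩ := Finset.mem_image.1 hu
    rw [Finset.mem_product, Finset.mem_range] at hv
    have hj : (j : ℝ) ≤ J := by exact_mod_cast hv.2.le
    simp only [g, sub_zero, Submodule.coe_add, Submodule.coe_smul, ← Int.cast_smul_eq_zsmul ℝ]
    calc _ ≤ ‖(v : Space L)‖ + j * ‖(b i : Space L)‖ := by
          refine (norm_add_le _ _).trans ?_
          rw [norm_smul]; simp
      _ ≤ ρ * c + (2 * c) * B := by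
          have := (hT v hv.1).1
          gcongr
          exact hj.trans hJc
      _ = _ := by ring)
  rw [Finset.card_image_of_injOn hinj, Finset.card_product, Finset.card_range] at hcard
  push_cast at hcard
  have h5 : (1 + (ρ + 2 * B) * c) ^ L ≤ (1 + ρ + 2 * B) ^ L * c ^ L := by
    rw [← mul_pow]
    gcongr
    nlinarith
  calc (T.card : ℝ) * c ≤ T.card * J := by gcongr
    _ ≤ _ := hcard
    _ ≤ C * ((1 + ρ + 2 * B) ^ L * c ^ L) := by gcongr
    _ = _ := by ring

end Counting

/-! ### Comparing shortest lattice vectors with a ball -/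

section Moment

variable {L : ℕ} {Λ : Submodule ℤ (Space L)} {Q : Space L → Λ} {ρ r : ℝ} {S : Finset Λ}

/-- Together with `ball_subset_preimage` this sandwiches the union of the cells of the shortest
vectors between two balls of almost equal radius. The `2 * ρ`, instead of `ρ`, allows the outer ball
to be open. -/
theorem preimage_subset_ball (hρ0 : 0 < ρ) (hρ : ∀ x, ‖x - (Q x : Space L)‖ ≤ ρ)
    (hr : ∀ v ∈ S, ‖(v : Space L)‖ ≤ r) : Q ⁻¹' S ⊆ Metric.ball 0 (r + 2 * ρ) := by
  intro x hx
  rw [mem_ball_zero_iff]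
  have h1 := hr (Q x) hx
  have h2 := norm_le_norm_add_norm_sub (Q x : Space L) x
  rw [norm_sub_rev] at h2
  linarith [hρ x]

theorem ball_subset_preimage (hρ : ∀ x, ‖x - (Q x : Space L)‖ ≤ ρ)
    (hr : ∀ w : Λ, w ∉ S → r ≤ ‖(w : Space L)‖) : Metric.ball 0 (r - ρ) ⊆ Q ⁻¹' S := by
  intro x hx
  rw [mem_ball_zero_iff] at hx
  by_contra h
  have h1 := hr (Q x) h
  have h2 := norm_le_norm_add_norm_sub x (Q x : Space L)
  linarith [hρ x]

theorem setIntegral_norm_sq_mem_Icc (hρ0 : 0 < ρ)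
    (hρ : ∀ x, ‖x - (Q x : Space L)‖ ≤ ρ) (hrρ : ρ < r) (hr : ∀ v ∈ S, ‖(v : Space L)‖ ≤ r)
    (hr' : ∀ w : Λ, w ∉ S → r ≤ ‖(w : Space L)‖) :
    ∫ x in Q ⁻¹' S, ‖x‖ ^ 2 ∈ Set.Icc
      ((r - ρ) ^ (L + 2) * ∫ x in Metric.ball (0 : Space L) 1, ‖x‖ ^ 2)
      ((r + 2 * ρ) ^ (L + 2) * ∫ x in Metric.ball (0 : Space L) 1, ‖x‖ ^ 2) := by
  have hsub := preimage_subset_ball hρ0 hρ hr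
  rw [← setIntegral_norm_sq_ball (by linarith), ← setIntegral_norm_sq_ball (by linarith)]
  exact ⟨setIntegral_mono_set (integrableOn_norm_sq hsub) (ae_of_all _ fun x => by positivity)
      (ball_subset_preimage hρ hr').eventuallyLE,
    setIntegral_mono_set (integrableOn_norm_sq le_rfl) (ae_of_all _ fun x => by positivity)
      hsub.eventuallyLE⟩

variable [DiscreteTopology Λ] [IsZLattice ℝ Λ]

theorem card_mul_covolume_le (hQ : IsNearest Λ Q) (hρ0 : 0 < ρ)
    (hρ : ∀ x, ‖x - (Q x : Space L)‖ ≤ ρ) (hr0 : 0 ≤ r) (hr : ∀ v ∈ S, ‖(v : Space L)‖ ≤ r) :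
    S.card * ZLattice.covolume Λ ≤
      (r + 2 * ρ) ^ L * volume.real (Metric.ball (0 : Space L) 1) := by
  have := measureReal_mono (μ := volume) (preimage_subset_ball hρ0 hρ hr)
  rwa [hQ.volume_real_preimage, volume_real_ball_zero (by positivity)] at this

theorem le_card_mul_covolume (hQ : IsNearest Λ Q) (hρ0 : 0 < ρ)
    (hρ : ∀ x, ‖x - (Q x : Space L)‖ ≤ ρ) (hrρ : ρ < r) (hr : ∀ v ∈ S, ‖(v : Space L)‖ ≤ r)
    (hr' : ∀ w : Λ, w ∉ S → r ≤ ‖(w : Space L)‖) :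
    (r - ρ) ^ L * volume.real (Metric.ball (0 : Space L) 1) ≤
      S.card * ZLattice.covolume Λ := by
  have := measureReal_mono (μ := volume) (ball_subset_preimage hρ hr')
    (((measure_mono (preimage_subset_ball hρ0 hρ hr)).trans_lt measure_ball_lt_top).ne)
  rwa [hQ.volume_real_preimage, volume_real_ball_zero (by linarith)] at this

/-- On the cell of `v` the function `‖x‖ ^ 2` differs from `‖v‖ ^ 2` by at most `ρ (2r + ρ)`. This
passes from integrals to sums with an error of lower order in `r`. -/
theorem abs_setIntegral_norm_sq_sub_le (hQ : IsNearest Λ Q) (hρ0 : 0 < ρ)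
    (hρ : ∀ x, ‖x - (Q x : Space L)‖ ≤ ρ) (hr : ∀ v ∈ S, ‖(v : Space L)‖ ≤ r) :
    |(∫ x in Q ⁻¹' S, ‖x‖ ^ 2) - ZLattice.covolume Λ * ∑ v ∈ S, ‖(v : Space L)‖ ^ 2| ≤
      S.card * ZLattice.covolume Λ * (ρ * (2 * r + ρ)) := by
  have hν := ZLattice.covolume_pos Λ volume
  have hsub := preimage_subset_ball hρ0 hρ hr
  have hU : Q ⁻¹' S = ⋃ u : S, Q ⁻¹' {u.1} := by ext x; simp
  have hone : ∀ v : Λ, volume.real (Q ⁻¹' {v}) = ZLattice.covolume Λ := fun v => by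
    rw [Measure.real, hQ.volume_fiber, ENNReal.toReal_ofReal hν.le]
  have hfin : ∀ v : Λ, volume (Q ⁻¹' {v}) < ⊤ := fun v => by
    rw [hQ.volume_fiber]; exact ENNReal.ofReal_lt_top
  have hint : ∫ x in Q ⁻¹' S, ‖x‖ ^ 2 = ∑ v ∈ S, ∫ x in Q ⁻¹' {v}, ‖x‖ ^ 2 := by
    rw [hU, integral_iUnion_ae (fun u => hQ.nullMeasurableSet_fiber u.1)
      (fun u v huv => (Disjoint.preimage Q
        (Set.disjoint_singleton.2 fun h => huv (Subtype.ext h))).aedisjoint)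
      (hU ▸ integrableOn_norm_sq hsub), tsum_fintype]
    exact Finset.sum_coe_sort S fun v => ∫ x in Q ⁻¹' {v}, ‖x‖ ^ 2
  rw [hint, Finset.mul_sum, ← Finset.sum_sub_distrib]
  refine (Finset.abs_sum_le_sum_abs _ _).trans ?_
  rw [mul_assoc, ← nsmul_eq_mul]
  refine Finset.sum_le_card_nsmul _ _ _ fun v hv => ?_
  have hv1 : IntegrableOn (fun x : Space L => ‖x‖ ^ 2) (Q ⁻¹' {v}) :=
    integrableOn_norm_sq (Set.Subset.trans (fun x hx => by
      have : Q x = v := hx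
      simpa [this] using hv) hsub)
  have hv2 : IntegrableOn (fun _ : Space L => ‖(v : Space L)‖ ^ 2) (Q ⁻¹' {v}) :=
    integrableOn_const (hfin v).ne
  have : (∫ x in Q ⁻¹' {v}, ‖x‖ ^ 2) - ZLattice.covolume Λ * ‖(v : Space L)‖ ^ 2 =
      ∫ x in Q ⁻¹' {v}, (‖x‖ ^ 2 - ‖(v : Space L)‖ ^ 2) := by
    rw [integral_sub hv1 hv2, setIntegral_const, hone, smul_eq_mul]
  rw [this, ← hone v, mul_comm (volume.real (Q ⁻¹' {v})), ← Real.norm_eq_abs]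
  refine norm_setIntegral_le_of_norm_le_const (hfin v) fun x hx => ?_
  have hx' : Q x = v := hx
  have h1 := hρ x
  rw [hx'] at h1
  have h2 := abs_norm_sub_norm_le x (v : Space L)
  have h3 := hr v hv
  have h4 := norm_le_norm_add_norm_sub (v : Space L) x
  rw [norm_sub_rev] at h4
  rw [Real.norm_eq_abs, sq_sub_sq, abs_mul, mul_comm]
  refine mul_le_mul (h2.trans h1) ?_ (abs_nonneg _) hρ0.le
  rw [abs_of_nonneg (by positivity)]
  linarith

end Moment

/-! ### Asymptotic second moment of the shortest vectors -/

section MomentLimit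

variable {L : ℕ} {Λ : Submodule ℤ (Space L)} [DiscreteTopology Λ] [IsZLattice ℝ Λ]
  {Q : Space L → Λ}

/-- The unnormalized second moment of the unit ball. -/
noncomputable def ballMoment (L : ℕ) : ℝ := ∫ x in Metric.ball (0 : Space L) 1, ‖x‖ ^ 2

theorem sphereSecondMoment_eq : sphereSecondMoment L =
    ballMoment L / L / volume.real (Metric.ball (0 : Space L) 1) ^ (1 + 2 / (L : ℝ)) := by
  simp only [sphereSecondMoment, sqNorm, ballMoment]
  rw [integral_div]

/-- If `m` is a longest vector of `S` and `‖m‖ > ρ`, the cells of `S` cover the ball of radius `‖m‖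
- ρ`, whose volume is then at most `c ^ L ν`. Since `K₀ = max 1 (ν / ω)` satisfies `ν / ω ≤ K₀ ^ L`,
no root has to be extracted from the constant. -/
theorem exists_norm_le_of_card_le (hL : 1 ≤ L) (hQ : IsNearest Λ Q) :
    ∃ K : ℝ, 0 < K ∧ ∀ (S : Finset Λ) (c : ℝ), 1 ≤ c → (S.card : ℝ) ≤ c ^ L →
      (∀ v ∈ S, ∀ w, w ∉ S → ‖(v : Space L)‖ ≤ ‖(w : Space L)‖) →
      ∀ v ∈ S, ‖(v : Space L)‖ ≤ K * c := by
  obtain ⟨ρ, hρ0, hρ⟩ := IsNearest.exists_radius Λ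
  have hν := ZLattice.covolume_pos Λ volume
  have hω := volume_real_unitBall_pos (L := L)
  set ν := ZLattice.covolume Λ
  set ω := volume.real (Metric.ball (0 : Space L) 1)
  set K₀ : ℝ := max 1 (ν / ω)
  have hK₀ : 1 ≤ K₀ := le_max_left _ _
  refine ⟨K₀ + ρ, by positivity, fun S c hc hcard hS v hv => ?_⟩
  obtain ⟨m, hm, hmax⟩ := S.exists_max_image (fun v => ‖(v : Space L)‖) ⟨v, hv⟩
  refine (hmax v hv).trans ?_
  by_cases h : ρ < ‖(m : Space L)‖
  · have h1 := le_card_mul_covolume hQ hρ0 (hρ Q hQ) h hmax (hS m hm)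
    have h2 : (‖(m : Space L)‖ - ρ) ^ L ≤ (K₀ * c) ^ L := by
      have h3 : ν ≤ K₀ ^ L * ω := by
        rw [← div_le_iff₀ hω]
        exact (le_max_right _ _).trans (le_self_pow₀ hK₀ (by omega))
      have h4 : (‖(m : Space L)‖ - ρ) ^ L * ω ≤ c ^ L * (K₀ ^ L * ω) :=
        h1.trans (mul_le_mul hcard h3 hν.le (by positivity))
      rw [mul_pow]
      refine le_of_mul_le_mul_right (h4.trans (le_of_eq ?_)) hω
      ring
    have h5 := le_of_pow_le_pow_left₀ (by omega) (by positivity) h2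
    nlinarith
  · push Not at h
    nlinarith

/-- The average squared length of the `N` shortest lattice vectors is asymptotically that of a
ball. -/
theorem tendsto_moment (hQ : IsNearest Λ Q) (S : ℕ → Finset Λ)
    (hne : ∀ k, (S k).Nonempty)
    (hS : ∀ k, ∀ v ∈ S k, ∀ w, w ∉ S k → ‖(v : Space L)‖ ≤ ‖(w : Space L)‖)
    (hcard : Tendsto (fun k => ((S k).card : ℝ)) atTop atTop) :
    Tendsto (fun k => (∑ v ∈ S k, ‖(v : Space L)‖ ^ 2) / (S k).card /
        ((S k).card * ZLattice.covolume Λ) ^ (2 / (L : ℝ))) atTop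
      (𝓝 (ballMoment L / volume.real (Metric.ball (0 : Space L) 1) ^ (1 + 2 / (L : ℝ)))) := by
  obtain ⟨ρ, hρ0, hρ'⟩ := IsNearest.exists_radius Λ
  have hρ := hρ' Q hQ
  have hν := ZLattice.covolume_pos Λ volume
  have hω := volume_real_unitBall_pos (L := L)
  set ν := ZLattice.covolume Λ with hνdef
  set ω := volume.real (Metric.ball (0 : Space L) 1) with hωdef
  choose m hm hmax using fun k => (S k).exists_max_image (fun v => ‖(v : Space L)‖) (hne k)
  set r : ℕ → ℝ := fun k => ‖(m k : Space L)‖ with hr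
  have hr0 : ∀ k, 0 ≤ r k := fun k => norm_nonneg _
  -- `r k` is the largest length in `S k`; it tends to infinity because a bounded ball holds
  -- boundedly many lattice points.
  have hrtop : Tendsto r atTop atTop := by
    refine tendsto_atTop.2 fun b => ?_
    filter_upwards [hcard.eventually_gt_atTop ((|b| + 2 * ρ) ^ L * ω / ν)] with k hk
    by_contra! h
    have h1 := card_mul_covolume_le hQ hρ0 hρ (abs_nonneg b) (S := S k)
      fun v hv => (hmax k v hv).trans (h.le.trans (le_abs_self b))
    rw [div_lt_iff₀ hν] at hk
    linarith
  have hratio : ∀ s : ℝ, Tendsto (fun k => (r k + s) / r k) atTop (𝓝 1) := by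
    intro s
    have h1 : Tendsto (fun k => 1 + s / r k) atTop (𝓝 (1 + 0)) :=
      tendsto_const_nhds.add (hrtop.const_div_atTop s)
    rw [add_zero] at h1
    refine h1.congr' ?_
    filter_upwards [hrtop.eventually_gt_atTop 0] with k hk
    rw [add_div, div_self hk.ne']
  have hsq : ∀ (n : ℕ) (s I : ℝ),
      Tendsto (fun k => (r k + s) ^ n * I / r k ^ n) atTop (𝓝 I) := by
    intro n s I
    have := ((hratio s).pow n).mul_const I
    rw [one_pow, one_mul] at this
    refine this.congr fun k => ?_
    rw [div_pow, div_mul_eq_mul_div]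
  have hev : ∀ᶠ k in atTop, ρ < r k := hrtop.eventually_gt_atTop ρ
  have hA : Tendsto (fun k => (S k).card * ν / r k ^ L) atTop (𝓝 ω) := by
    refine tendsto_of_tendsto_of_tendsto_of_le_of_le' (hsq L (-ρ) ω) (hsq L (2 * ρ) ω) ?_ ?_
    · filter_upwards [hev] with k hk
      exact div_le_div_of_nonneg_right
        (le_card_mul_covolume hQ hρ0 hρ hk (hmax k) (hS k _ (hm k))) (pow_nonneg (hr0 k) _)
    · filter_upwards [hev] with k hk
      exact div_le_div_of_nonneg_right
        (card_mul_covolume_le hQ hρ0 hρ (hr0 k) (hmax k)) (pow_nonneg (hr0 k) _)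
  have hB : Tendsto (fun k => (∫ x in Q ⁻¹' (S k), ‖x‖ ^ 2) / r k ^ (L + 2)) atTop
      (𝓝 (ballMoment L)) := by
    refine tendsto_of_tendsto_of_tendsto_of_le_of_le' (hsq (L + 2) (-ρ) _)
      (hsq (L + 2) (2 * ρ) _) ?_ ?_
    · filter_upwards [hev] with k hk
      have := (setIntegral_norm_sq_mem_Icc hρ0 hρ hk (hmax k) (hS k _ (hm k))).1
      gcongr
      exact this
    · filter_upwards [hev] with k hk
      have := (setIntegral_norm_sq_mem_Icc hρ0 hρ hk (hmax k) (hS k _ (hm k))).2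
      gcongr
      exact this
  have herr : Tendsto (fun k => (S k).card * ν / r k ^ L * (ρ * (2 * (r k)⁻¹ + ρ * ((r k)⁻¹) ^ 2)))
      atTop (𝓝 0) := by
    have h0 : Tendsto (fun k => (r k)⁻¹) atTop (𝓝 0) := tendsto_inv_atTop_zero.comp hrtop
    have := hA.mul (((h0.const_mul 2).add ((h0.pow 2).const_mul ρ)).const_mul ρ)
    simpa using this
  have hC : Tendsto (fun k => ν * (∑ v ∈ S k, ‖(v : Space L)‖ ^ 2) / r k ^ (L + 2)) atTop
      (𝓝 (ballMoment L)) := by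
    have hd : Tendsto (fun k => ν * (∑ v ∈ S k, ‖(v : Space L)‖ ^ 2) / r k ^ (L + 2) -
        (∫ x in Q ⁻¹' (S k), ‖x‖ ^ 2) / r k ^ (L + 2)) atTop (𝓝 0) := by
      refine squeeze_zero_norm' ?_ herr
      filter_upwards [hrtop.eventually_gt_atTop 0] with k hk
      have := abs_setIntegral_norm_sq_sub_le hQ hρ0 hρ (hmax k)
      rw [Real.norm_eq_abs, ← sub_div, abs_div, abs_sub_comm, abs_of_pos (pow_pos hk _),
        div_le_iff₀ (pow_pos hk _)]
      refine this.trans (le_of_eq ?_)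
      change _ * ν * (ρ * (2 * r k + ρ)) = _
      rw [pow_add]
      field_simp
    have := hd.add hB
    simpa using this
  -- The exponent `1 + 2 / L` turns `r ^ L` into `r ^ (L + 2)`, so the radius cancels from the
  -- quotient.
  have hD := hC.div (hA.rpow_const (Or.inl hω.ne') (p := 1 + 2 / (L : ℝ)))
    (Real.rpow_pos_of_pos hω _).ne'
  refine hD.congr' ?_
  filter_upwards [hrtop.eventually_gt_atTop 0] with k hk
  have hn : 0 < ((S k).card : ℝ) := by exact_mod_cast (hne k).card_pos
  simp only [Pi.div_apply]
  have hrL : (r k ^ L) ^ (1 + 2 / (L : ℝ)) = r k ^ (L + 2) := by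
    -- In dimension zero every vector vanishes, which contradicts `0 < r k`.
    rcases Nat.eq_zero_or_pos L with h0 | h0
    · exfalso
      subst h0
      have : (m k : Space 0) = 0 := Subsingleton.elim _ _
      simp only [hr, this, norm_zero, lt_irrefl] at hk
    · rw [← Real.rpow_natCast, ← Real.rpow_mul hk.le, ← Real.rpow_natCast]
      congr 1
      have : (L : ℝ) ≠ 0 := by positivity
      push_cast
      field_simp
  rw [Real.div_rpow (by positivity) (by positivity), hrL, Real.rpow_add (by positivity),
    Real.rpow_one]
  have hp : 0 < ((S k).card * ν) ^ (2 / (L : ℝ)) := Real.rpow_pos_of_pos (by positivity) _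
  field_simp

end MomentLimit

/-! ### Similar sublattices -/

section Similar

variable {L : ℕ} {Λ Λ' : Submodule ℤ (Space L)}

/-- `Λ'` is the image of `Λ` under `x ↦ c • O x`. -/
structure IsSimilarity (Λ Λ' : Submodule ℤ (Space L)) (c : ℝ) (O : Space L ≃ₗᵢ[ℝ] Space L) :
    Prop where
  le : Λ' ≤ Λ
  pos : 0 < c
  mem_iff : ∀ x, x ∈ Λ' ↔ ∃ y ∈ Λ, x = c • O y

/-- A negative factor is made positive by composing the isometry with `-1`. -/
theorem IsSimilarSublattice.exists_isSimilarity (h : IsSimilarSublattice Λ Λ') :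
    ∃ c O, IsSimilarity Λ Λ' c O := by
  obtain ⟨hle, c, hc, O, hO⟩ := h
  rcases lt_or_gt_of_ne hc with h0 | h0
  · refine ⟨-c, O.trans (LinearIsometryEquiv.neg ℝ), hle, by linarith, fun x => ?_⟩
    rw [hO]
    simp
  · exact ⟨c, O, hle, h0, hO⟩

namespace IsSimilarity

variable {c : ℝ} {O : Space L ≃ₗᵢ[ℝ] Space L}

theorem smul_mem (h : IsSimilarity Λ Λ' c O) {y : Space L} (hy : y ∈ Λ) : c • O y ∈ Λ' :=
  (h.mem_iff _).2 ⟨y, hy, rfl⟩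

theorem norm_smul_apply (h : IsSimilarity Λ Λ' c O) (y : Space L) : ‖c • O y‖ = c * ‖y‖ := by
  rw [norm_smul, Real.norm_of_nonneg h.pos.le, O.norm_map]

/-- The nearest-point map of `Λ'` obtained from that of `Λ`. -/
noncomputable def transport (h : IsSimilarity Λ Λ' c O) (Q : Space L → Λ) (x : Space L) : Λ' :=
  ⟨c • O (Q (c⁻¹ • O.symm x)), h.smul_mem (Q _).2⟩

theorem norm_sub_smul (h : IsSimilarity Λ Λ' c O) (x y : Space L) :
    ‖x - c • O y‖ = c * ‖c⁻¹ • O.symm x - y‖ := by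
  rw [← h.norm_smul_apply, map_sub, map_smul, smul_sub, O.apply_symm_apply,
    smul_inv_smul₀ h.pos.ne']

theorem isNearest_transport (h : IsSimilarity Λ Λ' c O) {Q : Space L → Λ} (hQ : IsNearest Λ Q) :
    IsNearest Λ' (h.transport Q) := by
  intro x y hy
  obtain ⟨z, hz, rfl⟩ := (h.mem_iff y).1 hy
  rw [h.norm_sub_smul, transport, h.norm_sub_smul]
  exact mul_le_mul_of_nonneg_left (hQ _ z hz) h.pos.le

theorem norm_sub_transport_le (h : IsSimilarity Λ Λ' c O) {Q : Space L → Λ} {ρ : ℝ}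
    (hρ : ∀ x, ‖x - (Q x : Space L)‖ ≤ ρ) (x : Space L) :
    ‖x - (h.transport Q x : Space L)‖ ≤ ρ * c := by
  rw [transport, h.norm_sub_smul, mul_comm]
  exact mul_le_mul_of_nonneg_right (hρ _) h.pos.le

/-- The similarity as a linear equivalence, from the sublattice to the lattice. -/
noncomputable def invEquiv (h : IsSimilarity Λ Λ' c O) : Space L ≃L[ℝ] Space L :=
  O.symm.toContinuousLinearEquiv.trans
    (ContinuousLinearEquiv.smulLeft (Units.mk0 c⁻¹ (inv_ne_zero h.pos.ne')))

theorem invEquiv_apply (h : IsSimilarity Λ Λ' c O) (x : Space L) :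
    h.invEquiv x = c⁻¹ • O.symm x := rfl

/-- Written as a `ZLattice.comap`, the sublattice inherits discreteness and full rank from
instances. -/
theorem eq_comap (h : IsSimilarity Λ Λ' c O) :
    Λ' = ZLattice.comap ℝ Λ h.invEquiv.toLinearMap := by
  ext x
  rw [h.mem_iff]
  change _ ↔ h.invEquiv x ∈ Λ
  rw [invEquiv_apply]
  constructor
  · rintro ⟨y, hy, rfl⟩
    rwa [map_smul, O.symm_apply_apply, inv_smul_smul₀ h.pos.ne']
  · exact fun hx => ⟨_, hx, by rw [map_smul, O.apply_symm_apply, smul_inv_smul₀ h.pos.ne']⟩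

variable [DiscreteTopology Λ]

theorem discreteTopology (h : IsSimilarity Λ Λ' c O) : DiscreteTopology Λ' := by
  rw [h.eq_comap]; infer_instance

variable [IsZLattice ℝ Λ]

theorem span_top (h : IsSimilarity Λ Λ' c O) :
    Submodule.span ℝ (Λ' : Set (Space L)) = ⊤ := by
  rw [h.eq_comap]
  exact IsZLattice.span_top

/-- The index is the quotient of the covolumes, that is, of the volumes of the Voronoi cells, and
the similarity carries one cell to the other. -/
theorem latticeIndex_eq (h : IsSimilarity Λ Λ' c O) {Q : Space L → Λ} (hQ : IsNearest Λ Q) :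
    (latticeIndex Λ Λ' : ℝ) = c ^ L := by
  have := h.discreteTopology
  have : IsZLattice ℝ Λ' := ⟨h.span_top⟩
  have hν := ZLattice.covolume_pos Λ volume
  have hν' := ZLattice.covolume_pos Λ' volume
  rw [latticeIndex, ← ZLattice.covolume_div_covolume_eq_relIndex' Λ' Λ h.le, div_eq_iff hν.ne',
    ← ENNReal.toReal_ofReal hν'.le, ← (h.isNearest_transport hQ).volume_fiber 0]
  have hset : h.transport Q ⁻¹' {0} = (fun x => c⁻¹ • x) ⁻¹' (O.symm ⁻¹' (Q ⁻¹' {0})) := by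
    ext x
    simp only [Set.mem_preimage, Set.mem_singleton_iff, transport, ← Subtype.coe_inj,
      ZeroMemClass.coe_zero, map_smul]
    simp [h.pos.ne']
  rw [hset, Measure.addHaar_preimage_smul _ (inv_ne_zero h.pos.ne'),
    (LinearIsometryEquiv.measurePreserving O.symm).measure_preimage
      (hQ.nullMeasurableSet_fiber 0), hQ.volume_fiber, ENNReal.toReal_mul,
    ENNReal.toReal_ofReal hν.le, ENNReal.toReal_ofReal (abs_nonneg _)]
  simp [abs_of_pos h.pos]

end IsSimilarity

end Similar

/-! ### Combinatorics of the labeling -/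

section Labels

variable {L : ℕ} {Λ Λ' : Submodule ℤ (Space L)} {α : Λ → Λ' × Λ'}
  {V₀ S : Finset (Space L)} {b : Space L → Space L}

/-- Parallelogram law about the midpoint. The length term does not see the shift `y`, so minimizing
the distortion over shifts means minimizing the distance to the midpoint. -/
theorem edgeDistortion_eq (x y e : Space L) : edgeDistortion x y (y + e) =
    (‖x - y - (2 : ℝ)⁻¹ • e‖ ^ 2 + ‖e‖ ^ 2 / 4) / L := by
  have h := parallelogram_law_with_norm ℝ (x - y - (2 : ℝ)⁻¹ • e) ((2 : ℝ)⁻¹ • e)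
  have h1 : x - y - (2 : ℝ)⁻¹ • e + (2 : ℝ)⁻¹ • e = x - y := by abel
  have h2 : x - y - (2 : ℝ)⁻¹ • e - (2 : ℝ)⁻¹ • e = x - (y + e) := by
    rw [sub_sub, ← add_smul]; norm_num; abel
  rw [h1, h2, norm_smul] at h
  norm_num at h
  rw [edgeDistortion, sqNorm, sqNorm, ← add_div, div_div, mul_comm (L : ℝ), ← div_div]
  congr 1
  nlinarith

/-- The data of the construction of a labeling function. -/
structure LabelData (Λ Λ' : Submodule ℤ (Space L)) (α : Λ → Λ' × Λ')
    (V₀ S : Finset (Space L)) (b : Space L → Space L) : Prop where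
  injective : Function.Injective α
  shift : ∀ x y : Λ, (y : Space L) ∈ Λ' →
    undirected α (x + y) = (undirected α x).map (fun z => z + (y : Space L))
  voronoi : IsDiscreteVoronoi Λ Λ' V₀
  edges : IsShortestEdges Λ' (latticeIndex Λ Λ') S
  bijOn : Set.BijOn b V₀ S
  equivariant : ∀ x ∈ V₀, ∀ y ∈ V₀, (x - y ∈ Λ' ∨ x + y ∈ Λ') → (b x = b y ∨ b x = -b y)
  nearest : ∀ x : Λ, (x : Space L) ∈ V₀ → ∃ y ∈ Λ', undirected α x = s(y, y + b x) ∧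
    ∀ z ∈ Λ', edgeDistortion (x : Space L) y (y + b x) ≤ edgeDistortion (x : Space L) z (z + b x)

theorem IsLabeling.exists_labelData (h : IsLabeling Λ Λ' α) :
    ∃ V₀ S b, LabelData Λ Λ' α V₀ S b := by
  obtain ⟨hinj, hshift, V₀, S, b, h1, h2, h3, h4, h5⟩ := h
  exact ⟨V₀, S, b, hinj, hshift, h1, h2, h3, h4, h5⟩

/-- `y + e / 2` is nearest to `x` among the midpoints of shifts of the edge `{0, e}`. -/
def IsNearestShift (Λ' : Submodule ℤ (Space L)) (e x y : Space L) : Prop :=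
  y ∈ Λ' ∧ ∀ z ∈ Λ', ‖x - y - (2 : ℝ)⁻¹ • e‖ ≤ ‖x - z - (2 : ℝ)⁻¹ • e‖

theorem IsNearestShift.add {e x y w : Space L} (h : IsNearestShift Λ' e x y) (hw : w ∈ Λ') :
    IsNearestShift Λ' e (x + w) (y + w) := by
  refine ⟨Λ'.add_mem h.1 hw, fun z hz => ?_⟩
  have := h.2 (z - w) (Λ'.sub_mem hz hw)
  rwa [add_sub_add_right_eq_sub, show x + w - z = x - (z - w) by abel]

/-- Reflection reverses edges. -/
theorem IsNearestShift.reflect {e x y w : Space L} (h : IsNearestShift Λ' (-e) (w - x) y)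
    (hw : w ∈ Λ') : IsNearestShift Λ' e x (w - y) := by
  refine ⟨Λ'.sub_mem hw h.1, fun z hz => ?_⟩
  have := h.2 (w - z) (Λ'.sub_mem hw hz)
  rw [← norm_neg, ← norm_neg (w - x - (w - z) - _)] at this
  rw [smul_neg] at this
  rwa [show x - (w - y) - (2 : ℝ)⁻¹ • e = -(w - x - y - -((2 : ℝ)⁻¹ • e)) by abel,
    show x - z - (2 : ℝ)⁻¹ • e = -(w - x - (w - z) - -((2 : ℝ)⁻¹ • e)) by abel]

namespace LabelData

theorem exists_rep (h : LabelData Λ Λ' α V₀ S b) (x : Λ) : ∃ v ∈ V₀, (x : Space L) - v ∈ Λ' :=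
  (h.voronoi.existsUnique x x.2).exists

theorem rep_unique (h : LabelData Λ Λ' α V₀ S b)
    {x : Space L} (hx : x ∈ Λ) {v w : Space L} (hv : v ∈ V₀) (hw : w ∈ V₀)
    (h1 : x - v ∈ Λ') (h2 : x - w ∈ Λ') : v = w :=
  (h.voronoi.existsUnique x hx).unique ⟨hv, h1⟩ ⟨hw, h2⟩

theorem card_voronoi (h : LabelData Λ Λ' α V₀ S b) : V₀.card = latticeIndex Λ Λ' := by
  rw [← h.edges.card]
  exact Finset.card_nbij b (fun v hv => h.bijOn.mapsTo hv) h.bijOn.injOn h.bijOn.surjOn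

/-- The undirected labels of the class of `v` are shifts of a single edge. -/
theorem exists_base (h : LabelData Λ Λ' α V₀ S b)
    (hle : Λ' ≤ Λ) (hL : 0 < L) {v : Space L} (hv : v ∈ V₀) :
    ∃ y, IsNearestShift Λ' (b v) v y ∧ ∀ x : Λ, ∀ w ∈ Λ', (x : Space L) = v + w →
      undirected α x = s(y + w, y + w + b v) := by
  obtain ⟨y, hy, hu, hmin⟩ := h.nearest ⟨v, h.voronoi.mem v hv⟩ hv
  refine ⟨y, ⟨hy, fun z hz => ?_⟩, fun x w hw hx => ?_⟩
  · have := hmin z hz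
    simp only [edgeDistortion_eq] at this
    rw [div_le_div_iff_of_pos_right (by positivity : (0 : ℝ) < L)] at this
    exact le_of_sq_le_sq (by linarith) (norm_nonneg _)
  · have hxe : x = ⟨v, h.voronoi.mem v hv⟩ + ⟨w, hle hw⟩ := Subtype.ext hx
    rw [hxe, h.shift _ _ hw, hu, Sym2.map_mk]
    simp only [add_right_comm]

/-- The label of `x`, in terms of its representative `v`. -/
theorem exists_undirected_eq (h : LabelData Λ Λ' α V₀ S b) (hle : Λ' ≤ Λ) (hL : 0 < L) (x : Λ)
    {v : Space L} (hv : v ∈ V₀) (hxv : (x : Space L) - v ∈ Λ') :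
    ∃ y, IsNearestShift Λ' (b v) x y ∧ undirected α x = s(y, y + b v) := by
  obtain ⟨y, hy, hu⟩ := h.exists_base hle hL hv
  refine ⟨y + (x - v), ?_, hu x _ hxv (by abel)⟩
  have := hy.add hxv
  rwa [add_sub_cancel] at this

theorem apply_eq_or {x : Λ} {y e : Space L} (hu : undirected α x = s(y, y + e)) :
    (((α x).1 : Space L) = y ∧ ((α x).2 : Space L) = y + e) ∨
      (((α x).1 : Space L) = y + e ∧ ((α x).2 : Space L) = y) :=
  Sym2.eq_iff.1 hu

/-- `v` is exceptional if it is congruent to `-v`, or if the edge matched with `v` has several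
nearest shifts. -/
def IsExceptional (Λ' : Submodule ℤ (Space L)) (b : Space L → Space L) (v : Space L) : Prop :=
  v + v ∈ Λ' ∨ ∃ y z, y ≠ z ∧ IsNearestShift Λ' (b v) v y ∧ IsNearestShift Λ' (b v) v z

/-- The reflection of `x` in the midpoint of its edge. -/
def mirror (hle : Λ' ≤ Λ) (α : Λ → Λ' × Λ') (x : Λ) : Λ :=
  ⟨(α x).1 + (α x).2 - x, Λ.sub_mem (Λ.add_mem (hle (α x).1.2) (hle (α x).2.2)) x.2⟩

/-- The mirror image of `x` is congruent to `-x`, so it is matched with the opposite edge.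
Reflection carries nearest shifts to nearest shifts, and the nearest shift is unique outside
exceptional classes. -/
theorem undirected_mirror (h : LabelData Λ Λ' α V₀ S b) (hle : Λ' ≤ Λ) (hL : 0 < L) (x : Λ)
    {v : Space L} (hv : v ∈ V₀) (hxv : (x : Space L) - v ∈ Λ') (hex : ¬IsExceptional Λ' b v) :
    undirected α (mirror hle α x) = undirected α x := by
  obtain ⟨y, hy, hu⟩ := h.exists_undirected_eq hle hL x hv hxv
  have hsum : ((α x).1 : Space L) + (α x).2 = y + (y + b v) := by
    rcases apply_eq_or hu with ⟨h1, h2⟩ | ⟨h1, h2⟩ <;> rw [h1, h2]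
    abel
  have hbv : b v ∈ Λ' := h.edges.mem _ (h.bijOn.mapsTo hv)
  set w : Space L := y + (y + b v) with hw
  have hwm : w ∈ Λ' := Λ'.add_mem hy.1 (Λ'.add_mem hy.1 hbv)
  have hm : (mirror hle α x : Space L) = w - x := by
    rw [← hsum]; rfl
  obtain ⟨μ, hμ, hxμ⟩ := h.exists_rep (mirror hle α x)
  have hvμ : v + μ ∈ Λ' := by
    have h1 := Λ'.sub_mem (Λ'.sub_mem hwm hxμ) hxv
    rw [hm] at h1
    convert h1 using 1
    abel
  -- The alternative `b v = b μ` would give `μ = v` by injectivity, hence `v + v ∈ Λ'`.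
  have hbμ : b μ = -b v := by
    rcases h.equivariant v hv μ hμ (Or.inr hvμ) with h1 | h1
    · have := h.bijOn.injOn hv hμ h1
      subst this
      exact absurd (Or.inl hvμ) hex
    · rw [h1, neg_neg]
  obtain ⟨y', hy', hu'⟩ := h.exists_undirected_eq hle hL (mirror hle α x) hμ hxμ
  rw [hbμ, hm] at hy'
  have hr := hy'.reflect hwm
  have heq : w - y' = y := by
    by_contra hne
    refine hex (Or.inr ⟨w - y' + (v - (x : Space L)), y + (v - (x : Space L)), by simpa using hne, ?_, ?_⟩)
    · have := hr.add (w := v - (x : Space L)) (by rw [← neg_sub]; exact Λ'.neg_mem hxv)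
      rwa [add_sub_cancel] at this
    · have := hy.add (w := v - (x : Space L)) (by rw [← neg_sub]; exact Λ'.neg_mem hxv)
      rwa [add_sub_cancel] at this
  have hy'' : y' = y + b v := by
    rw [sub_eq_iff_eq_add] at heq
    rw [hw, add_right_inj] at heq
    exact heq.symm
  rw [hu', hu, hbμ, hy'', add_neg_cancel_right, Sym2.eq_swap]

/-- A fixed point would be the midpoint of its edge, so that `x + x`, and with it `v + v`, would lie
in `Λ'`. -/
theorem mirror_ne (hle : Λ' ≤ Λ) (x : Λ) {v : Space L} (hxv : (x : Space L) - v ∈ Λ')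
    (hex : ¬IsExceptional Λ' b v) : mirror hle α x ≠ x := by
  intro he
  refine hex (Or.inl ?_)
  have h1 : ((α x).1 : Space L) + (α x).2 - x = x := congrArg Subtype.val he
  have h2 := Λ'.sub_mem (Λ'.sub_mem (Λ'.add_mem (α x).1.2 (α x).2.2) hxv) hxv
  rw [sub_eq_iff_eq_add] at h1
  rw [h1] at h2
  convert h2 using 1
  abel

/-- Mirror images carry opposite orientations. -/
theorem apply_mirror (h : LabelData Λ Λ' α V₀ S b) (hle : Λ' ≤ Λ) (hL : 0 < L) (x : Λ)
    {v : Space L} (hv : v ∈ V₀) (hxv : (x : Space L) - v ∈ Λ') (hex : ¬IsExceptional Λ' b v) :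
    (α (mirror hle α x)).1 = (α x).2 ∧ (α (mirror hle α x)).2 = (α x).1 ∧ (α x).1 ≠ (α x).2 := by
  have hu := h.undirected_mirror hle hL x hv hxv hex
  have hne := mirror_ne (α := α) hle x hxv hex
  have hα : α (mirror hle α x) ≠ α x := fun e => hne (h.injective e)
  rcases Sym2.eq_iff.1 hu with ⟨h1, h2⟩ | ⟨h1, h2⟩
  · exact absurd (Prod.ext (Subtype.ext h1) (Subtype.ext h2)) hα
  · have h1' := Subtype.ext h1
    have h2' := Subtype.ext h2
    refine ⟨h1', h2', fun e => hα (Prod.ext (h1'.trans e.symm) (h2'.trans e))⟩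

/-- A vertex `u` lies on at most two edges of each class. -/
theorem ncard_le_two_mul (h : LabelData Λ Λ' α V₀ S b) (hle : Λ' ≤ Λ) (hL : 0 < L) (u : Λ')
    (W : Finset (Space L)) (hW : W ⊆ V₀) (A : Set Λ)
    (hA : ∀ x ∈ A, ((α x).1 = u ∨ (α x).2 = u) ∧ ∃ v ∈ W, (x : Space L) - v ∈ Λ') :
    A.Finite ∧ A.ncard ≤ 2 * W.card := by
  classical
  choose! y hy hu using fun v (hv : v ∈ V₀) => h.exists_base hle hL hv
  -- Within the class of `v` the edges are translates of a single one, so `x` is determined by which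
  -- of the two endpoints falls on `u`.
  let F : Finset (Space L) := W.image (fun v => v + (u - y v)) ∪ W.image fun v => v + (u - y v - b v)
  have hF : ∀ x ∈ A, (x : Space L) ∈ F := by
    intro x hx
    obtain ⟨hxu, v, hv, hxv⟩ := hA x hx
    have := hu v (hW hv) x _ hxv (by abel)
    have key : (u : Space L) = y v + (x - v) ∨ (u : Space L) = y v + (x - v) + b v := by
      rcases apply_eq_or this with ⟨h1, h2⟩ | ⟨h1, h2⟩ <;> rcases hxu with rfl | rfl
      · exact Or.inl h1
      · exact Or.inr h2
      · exact Or.inr h1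
      · exact Or.inl h2
    rw [Finset.mem_union, Finset.mem_image, Finset.mem_image]
    rcases key with h1 | h1
    · exact Or.inl ⟨v, hv, by rw [h1]; abel⟩
    · exact Or.inr ⟨v, hv, by rw [h1]; abel⟩
  have hsub : (Subtype.val '' A : Set (Space L)) ⊆ F := by
    rintro _ ⟨x, hx, rfl⟩
    exact hF x hx
  refine ⟨Set.Finite.of_finite_image (F.finite_toSet.subset hsub) Subtype.val_injective.injOn, ?_⟩
  rw [← Set.ncard_image_of_injective A Subtype.val_injective]
  refine (Set.ncard_le_ncard hsub F.finite_toSet).trans ?_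
  rw [Set.ncard_coe_finset, two_mul]
  exact (Finset.card_union_le _ _).trans (add_le_add Finset.card_image_le Finset.card_image_le)

/-- Every vertex is the first label of at most `N + #exceptional` lattice points. -/
theorem ncard_fiber_le (h : LabelData Λ Λ' α V₀ S b) (hle : Λ' ≤ Λ) (hL : 0 < L) (u : Λ')
    (B : Finset (Space L)) (hB : B ⊆ V₀) (hBex : ∀ v ∈ V₀, IsExceptional Λ' b v → v ∈ B) :
    {x : Λ | (α x).1 = u}.Finite ∧
      {x : Λ | (α x).1 = u}.ncard ≤ latticeIndex Λ Λ' + B.card := by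
  set F : Set Λ := {x : Λ | (α x).1 = u} with hF
  set G : Set Λ := {x : Λ | (α x).1 = u ∧ ∃ v ∈ V₀, (x : Space L) - v ∈ Λ' ∧
    ¬IsExceptional Λ' b v} with hG
  set X : Set Λ := {x : Λ | (α x).1 = u ∧ ∃ v ∈ B, (x : Space L) - v ∈ Λ'} with hX
  have hFGX : F ⊆ G ∪ X := by
    intro x hx
    obtain ⟨v, hv, hxv⟩ := h.exists_rep x
    by_cases hex : IsExceptional Λ' b v
    · exact Or.inr ⟨hx, v, hBex v hv hex, hxv⟩
    · exact Or.inl ⟨hx, v, hv, hxv, hex⟩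
  obtain ⟨hXfin, hXcard⟩ := h.ncard_le_two_mul hle hL u B hB X fun x hx => ⟨Or.inl hx.1, hx.2⟩
  -- `F` and the mirror image of its non-exceptional part `G` consist of points whose edge contains
  -- `u`, at most `2N` in all. They are disjoint since mirroring reverses orientation.
  obtain ⟨hAfin, hAcard⟩ := h.ncard_le_two_mul hle hL u V₀ le_rfl
    (F ∪ mirror hle α '' G) (by
      rintro _ (hx | ⟨x, ⟨hx, v, hv, hxv, hex⟩, rfl⟩)
      · exact ⟨Or.inl hx, h.exists_rep _⟩
      · exact ⟨Or.inr ((h.apply_mirror hle hL x hv hxv hex).2.1.trans hx), h.exists_rep _⟩)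
  have hFfin : F.Finite := hAfin.subset Set.subset_union_left
  have hGF : G ⊆ F := fun x hx => hx.1
  have hGfin : G.Finite := hFfin.subset hGF
  have hinj : Set.InjOn (mirror hle α) G := by
    rintro x ⟨hx, v, hv, hxv, hex⟩ x' ⟨hx', v', hv', hxv', hex'⟩ he
    obtain ⟨h1, h2, -⟩ := h.apply_mirror hle hL x hv hxv hex
    obtain ⟨h1', h2', -⟩ := h.apply_mirror hle hL x' hv' hxv' hex'
    rw [he] at h1 h2
    exact h.injective (Prod.ext (h2.symm.trans h2') (h1.symm.trans h1'))
  have hdisj : Disjoint F (mirror hle α '' G) := by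
    rw [Set.disjoint_left]
    rintro _ hx ⟨x, ⟨hxu, v, hv, hxv, hex⟩, rfl⟩
    obtain ⟨h1, -, h3⟩ := h.apply_mirror hle hL x hv hxv hex
    have hx1 : (α (mirror hle α x)).1 = u := hx
    exact h3 (hxu.trans (hx1.symm.trans h1))
  rw [Set.ncard_union_eq hdisj hFfin (hGfin.image _), hinj.ncard_image,
    h.card_voronoi] at hAcard
  -- Adding `#F + #G ≤ 2N` and `#F ≤ #G + #X` with `#X ≤ 2 #B` gives `2 #F ≤ 2N + 2 #B`.
  have h3 := (Set.ncard_le_ncard hFGX (hGfin.union hXfin)).trans (Set.ncard_union_le G X)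
  exact ⟨hFfin, by omega⟩

end LabelData

end Labels

/-! ### Scarcity of exceptional classes -/

section Exceptional

variable {L : ℕ} {Λ : Submodule ℤ (Space L)} [DiscreteTopology Λ] [IsZLattice ℝ Λ]
  {Q : Space L → Λ}

theorem card_finsetSubtype {Λ : Submodule ℤ (Space L)} (T : Finset (Space L))
    (hT : ∀ v ∈ T, v ∈ Λ) : ∃ T' : Finset Λ, T'.card = T.card ∧ ∀ v ∈ T', (v : Space L) ∈ T := by
  classical
  refine ⟨T.subtype (· ∈ Λ), ?_, fun v hv => Finset.mem_subtype.1 hv⟩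
  rw [Finset.card_subtype, Finset.filter_true_of_mem hT]

/-- Only a negligible fraction of the points of a discrete Voronoi set are exceptional. -/
theorem exists_card_exceptional_le (hL : 1 ≤ L) (hQ : IsNearest Λ Q) :
    ∃ C : ℝ, 0 < C ∧ ∀ (Λ' : Submodule ℤ (Space L)) (c : ℝ) (O : Space L ≃ₗᵢ[ℝ] Space L)
      (α : Λ → Λ' × Λ') (V₀ S : Finset (Space L)) (b : Space L → Space L),
      IsSimilarity Λ Λ' c O → LabelData Λ Λ' α V₀ S b → 1 ≤ c →
      ∃ B ⊆ V₀, (∀ v ∈ V₀, LabelData.IsExceptional Λ' b v → v ∈ B) ∧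
        (B.card : ℝ) * c ≤ C * c ^ L := by
  classical
  obtain ⟨ρ, hρ0, hρ⟩ := IsNearest.exists_radius Λ
  replace hρ := hρ Q hQ
  obtain ⟨C, hC0, hC⟩ := exists_card_hyperplane_le hQ ρ hρ0.le
  -- Both `v` and its offset `m` from the midpoint have norm at most `ρ c`. So `2v`, `2v - 2m` and
  -- the difference of two nearest shifts have norm at most `4 ρ c`; divided by the similarity they
  -- lie in this finite set, which does not depend on `Λ'`.
  set W := (finite_closedBall hQ (4 * ρ)).toFinset with hW
  have hmemW : ∀ u : Λ, u ∈ W ↔ ‖(u : Space L)‖ ≤ 4 * ρ := fun u => by simp [hW]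
  refine ⟨W.card + (W ×ˢ W).card * C + 1, by positivity,
    fun Λ' c O α V₀ S b hsim h hc => ?_⟩
  have hc0 := hsim.pos
  have hρ' := hsim.norm_sub_transport_le hρ
  have hV : ∀ v ∈ V₀, ‖v‖ ≤ ρ * c := fun v hv =>
    (h.voronoi.nearest v hv _ (hsim.transport Q v).2).trans (hρ' v)
  have hscale : ∀ (u : Λ) (t : ℝ), ‖c • O (u : Space L)‖ ≤ t * c → ‖(u : Space L)‖ ≤ t := by
    intro u t hu
    rw [hsim.norm_smul_apply, mul_comm] at hu
    exact le_of_mul_le_mul_right hu hc0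
  set B := V₀.filter (LabelData.IsExceptional Λ' b) with hB
  set B₁ := V₀.filter (fun v => v + v ∈ Λ') with hB₁
  -- If `y` and `z` are both nearest shifts, put `w = z - y` and `e = 2y + b v`. Then `‖m - w‖ =
  -- ‖m‖` with `2m = 2v - e` confines `v` to the hyperplane `⟪v, w⟫ = (‖w‖ ^ 2 + ⟪e, w⟫) / 2`. The
  -- number of pairs `(e, w)` is bounded, and each hyperplane contains `O(c ^ L / c)` points.
  let T : Λ × Λ → Finset (Space L) := fun q => V₀.filter fun v => q.2 ≠ 0 ∧
    inner ℝ v (c • O (q.2 : Space L)) =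
      (‖c • O (q.2 : Space L)‖ ^ 2 + inner ℝ (c • O (q.1 : Space L)) (c • O (q.2 : Space L))) / 2
  refine ⟨B, Finset.filter_subset _ _, fun v hv hex => Finset.mem_filter.2 ⟨hv, hex⟩, ?_⟩
  have hcover : B ⊆ B₁ ∪ (W ×ˢ W).biUnion T := by
    intro v hv
    obtain ⟨hv, hex⟩ := Finset.mem_filter.1 hv
    rw [Finset.mem_union]
    rcases hex with hex | ⟨y, z, hne, hy, hz⟩
    · exact Or.inl (Finset.mem_filter.2 ⟨hv, hex⟩)
    refine Or.inr ?_
    have hbv : b v ∈ Λ' := h.edges.mem _ (h.bijOn.mapsTo hv)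
    set m := v - y - (2 : ℝ)⁻¹ • b v with hm
    have hmc : ‖m‖ ≤ ρ * c := by
      have := hy.2 _ (hsim.transport Q (v - (2 : ℝ)⁻¹ • b v)).2
      refine this.trans ?_
      rw [sub_right_comm]
      exact hρ' _
    have hmz : ‖m - (z - y)‖ = ‖m‖ := by
      rw [show m - (z - y) = v - z - (2 : ℝ)⁻¹ • b v by rw [hm]; abel]
      exact le_antisymm (hz.2 y hy.1) (hy.2 z hz.1)
    have hem : y + y + b v ∈ Λ' := Λ'.add_mem (Λ'.add_mem hy.1 hy.1) hbv
    have hwm : z - y ∈ Λ' := Λ'.sub_mem hz.1 hy.1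
    have he : v + v - (m + m) = y + y + b v := by
      have : (2 : ℝ)⁻¹ • b v + (2 : ℝ)⁻¹ • b v = b v := by rw [← add_smul]; norm_num
      calc v + v - (m + m) = y + y + ((2 : ℝ)⁻¹ • b v + (2 : ℝ)⁻¹ • b v) := by rw [hm]; abel
        _ = _ := by rw [this]
    obtain ⟨e₀, he₀, hee⟩ := (hsim.mem_iff _).1 hem
    obtain ⟨w₀, hw₀, hww⟩ := (hsim.mem_iff _).1 hwm
    have hvc := hV v hv
    rw [Finset.mem_biUnion]
    refine ⟨(⟨e₀, he₀⟩, ⟨w₀, hw₀⟩), ?_, ?_⟩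
    · rw [Finset.mem_product, hmemW, hmemW]
      refine ⟨hscale _ _ ?_, hscale _ _ ?_⟩
      · change ‖c • O e₀‖ ≤ _
        rw [← hee, ← he]
        have h1 := norm_sub_le (v + v) (m + m)
        have h2 := norm_add_le v v
        have h3 := norm_add_le m m
        linarith
      · change ‖c • O w₀‖ ≤ _
        rw [← hww]
        have h2 : ‖z - y‖ ≤ ‖m‖ + ‖m - (z - y)‖ := by
          have := norm_sub_le m (m - (z - y))
          rwa [sub_sub_cancel] at this
        rw [hmz] at h2
        nlinarith [norm_nonneg m]
    · refine Finset.mem_filter.2 ⟨hv, ?_, ?_⟩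
      · intro h0
        have h1 : w₀ = 0 := congrArg Subtype.val h0
        rw [h1, map_zero, smul_zero, sub_eq_zero] at hww
        exact hne hww.symm
      · change inner ℝ v (c • O w₀) = (‖c • O w₀‖ ^ 2 + inner ℝ (c • O e₀) (c • O w₀)) / 2
        rw [← hee, ← hww, ← he]
        have h1 := norm_sub_sq_real m (z - y)
        rw [hmz] at h1
        rw [inner_sub_left, inner_add_left, inner_add_left]
        linarith
  have hcL : c ≤ c ^ L := le_self_pow₀ hc (by omega)
  have hB₁card : (B₁.card : ℝ) ≤ W.card := by
    choose! g hg hgeq using fun v (hv : v ∈ B₁) =>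
      (hsim.mem_iff _).1 (Finset.mem_filter.1 hv).2
    have h1 : B₁.card ≤ (W.image Subtype.val).card := by
      refine Finset.card_le_card_of_injOn g (fun v hv => ?_) fun v hv v' hv' he => ?_
      · refine Finset.mem_coe.2 (Finset.mem_image.2 ⟨⟨g v, hg v hv⟩, ?_, rfl⟩)
        rw [hmemW]
        refine hscale _ _ ?_
        change ‖c • O (g v)‖ ≤ _
        rw [← hgeq v hv]
        have h1 := norm_add_le v v
        have h2 := hV v (Finset.mem_filter.1 hv).1
        nlinarith [norm_nonneg v]
      · have h1 : v + v = v' + v' := by rw [hgeq v hv, hgeq v' hv', he]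
        rw [← two_smul ℝ v, ← two_smul ℝ v'] at h1
        exact smul_right_injective _ (two_ne_zero' ℝ) h1
    exact_mod_cast h1.trans Finset.card_image_le
  have hTcard : ∀ q, ((T q).card : ℝ) * c ≤ C * c ^ L := by
    intro q
    by_cases hq : q.2 = 0
    · have : T q = ∅ := Finset.filter_eq_empty_iff.2 fun v _ hv => hv.1 hq
      rw [this]
      simp only [Finset.card_empty, Nat.cast_zero, zero_mul]
      positivity
    · obtain ⟨T', hT'c, hT'⟩ := card_finsetSubtype (Λ := Λ) (T q)
        fun v hv => h.voronoi.mem v (Finset.mem_filter.1 hv).1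
      rw [← hT'c]
      refine hC (c • O (q.2 : Space L)) ?_ _ c hc T' fun v hv =>
        ⟨hV _ (Finset.mem_filter.1 (hT' v hv)).1, (Finset.mem_filter.1 (hT' v hv)).2.2⟩
      rw [← norm_ne_zero_iff, hsim.norm_smul_apply]
      exact mul_ne_zero hc0.ne' (norm_ne_zero_iff.2 fun h0 => hq (Subtype.ext h0))
  have h1 : (B.card : ℝ) ≤ B₁.card + ∑ q ∈ W ×ˢ W, ((T q).card : ℝ) := by
    have := (Finset.card_le_card hcover).trans ((Finset.card_union_le _ _).trans
      (add_le_add_right Finset.card_biUnion_le _))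
    exact_mod_cast this
  calc (B.card : ℝ) * c ≤ (B₁.card + ∑ q ∈ W ×ˢ W, ((T q).card : ℝ)) * c := by gcongr
    _ = B₁.card * c + ∑ q ∈ W ×ˢ W, ((T q).card : ℝ) * c := by rw [add_mul, Finset.sum_mul]
    _ ≤ W.card * c ^ L + ∑ q ∈ W ×ˢ W, C * c ^ L := by
        exact add_le_add (mul_le_mul hB₁card hcL hc0.le (by positivity))
          (Finset.sum_le_sum fun q _ => hTcard q)
    _ = (W.card + (W ×ˢ W).card * C) * c ^ L := by
        rw [Finset.sum_const, nsmul_eq_mul]; ring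
    _ ≤ _ := by
        have : 0 < c ^ L := by positivity
        nlinarith

end Exceptional

/-! ### Lengths and positions of the labeling edges -/

section EdgeLengths

variable {L : ℕ} {Λ Λ' : Submodule ℤ (Space L)} {c : ℝ} {O : Space L ≃ₗᵢ[ℝ] Space L}

theorem IsSimilarity.exists_shortest (hsim : IsSimilarity Λ Λ' c O) {N : ℕ}
    {S : Finset (Space L)} (hS : IsShortestEdges Λ' N S) :
    ∃ S₀ : Finset Λ, S₀.card = N ∧
      (∀ v ∈ S₀, ∀ w, w ∉ S₀ → ‖(v : Space L)‖ ≤ ‖(w : Space L)‖) ∧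
      (∀ s ∈ S, ∃ u ∈ S₀, s = c • O (u : Space L)) ∧
      ∑ s ∈ S, ‖s‖ ^ 2 = c ^ 2 * ∑ u ∈ S₀, ‖(u : Space L)‖ ^ 2 := by
  classical
  let f : Λ → Space L := fun u => c • O (u : Space L)
  have hf : Function.Injective f := fun u v huv =>
    Subtype.ext (O.injective (smul_right_injective _ hsim.pos.ne' huv))
  set S₀ := S.preimage f hf.injOn with hS₀
  have himage : S₀.image f = S := by
    rw [hS₀, Finset.image_preimage, Finset.filter_true_of_mem]
    intro s hs
    obtain ⟨y, hy, rfl⟩ := (hsim.mem_iff s).1 (hS.mem s hs)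
    exact ⟨⟨y, hy⟩, rfl⟩
  refine ⟨S₀, ?_, fun v hv w hw => ?_, fun s hs => ?_, ?_⟩
  · rw [← hS.card, ← himage, Finset.card_image_of_injective _ hf]
  · rw [hS₀, Finset.mem_preimage] at hv hw
    have := hS.shortest _ hv _ (hsim.smul_mem w.2) hw
    rw [hsim.norm_smul_apply, hsim.norm_smul_apply] at this
    exact le_of_mul_le_mul_left this hsim.pos
  · rw [← himage, Finset.mem_image] at hs
    obtain ⟨u, hu, rfl⟩ := hs
    exact ⟨u, hu, rfl⟩
  · rw [← himage, Finset.sum_image hf.injOn, Finset.mul_sum]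
    refine Finset.sum_congr rfl fun u _ => ?_
    rw [hsim.norm_smul_apply, mul_pow]

/-- Bounds for all labelings built from `Λ`, in terms of the similarity factor `c`. -/
structure IsLabelBound (Λ : Submodule ℤ (Space L)) (D : ℝ) : Prop where
  pos : 0 < D
  dist_nearest : ∀ Q : Space L → Λ, IsNearest Λ Q → ∀ x, ‖x - (Q x : Space L)‖ ≤ D
  norm_voronoi : ∀ {Λ' c O α V₀ S b}, IsSimilarity Λ Λ' c O → LabelData Λ Λ' α V₀ S b →
    ∀ v ∈ V₀, ‖v‖ ≤ D * c
  norm_edge : ∀ {Λ' c O α V₀ S b}, IsSimilarity Λ Λ' c O → LabelData Λ Λ' α V₀ S b → 1 ≤ c →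
    ∀ v ∈ V₀, ‖b v‖ ≤ D * c ^ 2
  dist_midpoint : ∀ {Λ' c O e x y}, IsSimilarity Λ Λ' c O → IsNearestShift Λ' e x y →
    ‖x - y - (2 : ℝ)⁻¹ • e‖ ≤ D * c

/-- Voronoi points and midpoint offsets are bounded by the covering radius `ρ c` of `Λ'`. The `c ^
L` shortest vectors of `Λ` have norm `O(c)`, hence those of `Λ'` norm `O(c ^ 2)`. -/
theorem exists_isLabelBound [DiscreteTopology Λ] [IsZLattice ℝ Λ] (hL : 1 ≤ L)
    {Q : Space L → Λ} (hQ : IsNearest Λ Q) :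
    ∃ D, IsLabelBound Λ D := by
  obtain ⟨ρ, hρ0, hρ'⟩ := IsNearest.exists_radius Λ
  obtain ⟨K, hK0, hK⟩ := exists_norm_le_of_card_le hL hQ
  have hρ := hρ' Q hQ
  have hρD : ρ ≤ ρ + K := by linarith
  refine ⟨ρ + K, by positivity, fun Q hQ x => (hρ' Q hQ x).trans hρD, ?_, ?_, ?_⟩
  · intro Λ' c O α V₀ S b hsim h v hv
    exact ((h.voronoi.nearest v hv _ (hsim.transport Q v).2).trans
      (hsim.norm_sub_transport_le hρ v)).trans (mul_le_mul_of_nonneg_right hρD hsim.pos.le)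
  · intro Λ' c O α V₀ S b hsim h hc v hv
    obtain ⟨S₀, hcard, hshort, hS, -⟩ := hsim.exists_shortest h.edges
    obtain ⟨u, hu, hbu⟩ := hS (b v) (h.bijOn.mapsTo hv)
    have := hK S₀ c hc (by rw [hcard, hsim.latticeIndex_eq hQ]) hshort u hu
    rw [hbu, hsim.norm_smul_apply]
    have hc0 := hsim.pos
    calc c * ‖(u : Space L)‖ ≤ c * (K * c) := by gcongr
      _ = K * c ^ 2 := by ring
      _ ≤ _ := by gcongr; linarith
  · intro Λ' c O e x y hsim h
    have := h.2 _ (hsim.transport Q (x - (2 : ℝ)⁻¹ • e)).2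
    rw [sub_right_comm x (hsim.transport Q (x - (2 : ℝ)⁻¹ • e) : Space L)] at this
    exact (this.trans (hsim.norm_sub_transport_le hρ _)).trans
      (mul_le_mul_of_nonneg_right hρD hsim.pos.le)

namespace LabelData

variable {α : Λ → Λ' × Λ'} {V₀ S : Finset (Space L)} {b : Space L → Space L} {D : ℝ}

/-- `c ^ L` is the index, a positive integer. -/
theorem one_le_factor [DiscreteTopology Λ] [IsZLattice ℝ Λ] (hL : 1 ≤ L)
    (hsim : IsSimilarity Λ Λ' c O) {Q : Space L → Λ}
    (hQ : IsNearest Λ Q) : 1 ≤ c := by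
  have h1 := hsim.latticeIndex_eq hQ
  have h2 : 0 < c ^ L := pow_pos hsim.pos _
  by_contra! h
  have h3 : c ^ L < 1 := pow_lt_one₀ hsim.pos.le h (by omega)
  rw [← h1] at h2 h3
  have h4 : 0 < latticeIndex Λ Λ' := by exact_mod_cast h2
  have h5 : latticeIndex Λ Λ' < 1 := by exact_mod_cast h3
  omega

/-- The labels of `x` are the endpoints of an edge of bounded length whose midpoint is near `x`. -/
theorem norm_sub_midpoint_le (h : LabelData Λ Λ' α V₀ S b) (hsim : IsSimilarity Λ Λ' c O)
    (hD : IsLabelBound Λ D) (hL : 1 ≤ L) (x : Λ) :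
    ‖(x : Space L) - (2 : ℝ)⁻¹ • (((α x).1 : Space L) + (α x).2)‖ ≤ D * c := by
  obtain ⟨v, hv, hxv⟩ := h.exists_rep x
  obtain ⟨y, hy, hu⟩ := h.exists_undirected_eq hsim.le hL x hv hxv
  have hsum : ((α x).1 : Space L) + (α x).2 = y + y + b v := by
    rcases apply_eq_or hu with ⟨h1, h2⟩ | ⟨h1, h2⟩ <;> rw [h1, h2] <;> abel
  have : (2 : ℝ)⁻¹ • (y + y + b v) = y + (2 : ℝ)⁻¹ • b v := by
    rw [smul_add, smul_add, ← add_smul]; norm_num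
  rw [hsum, this, ← sub_sub]
  exact hD.dist_midpoint hsim hy

theorem norm_labels_sub (h : LabelData Λ Λ' α V₀ S b) (hle : Λ' ≤ Λ) (hL : 1 ≤ L) (x : Λ)
    {v : Space L} (hv : v ∈ V₀) (hxv : (x : Space L) - v ∈ Λ') :
    ‖((α x).1 : Space L) - (α x).2‖ = ‖b v‖ := by
  obtain ⟨y, hy, hu⟩ := h.exists_undirected_eq hle hL x hv hxv
  rcases apply_eq_or hu with ⟨h1, h2⟩ | ⟨h1, h2⟩ <;> rw [h1, h2]
  · rw [sub_add_cancel_left, norm_neg]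
  · rw [add_sub_cancel_left]

theorem norm_labels_sub_le (h : LabelData Λ Λ' α V₀ S b) (hsim : IsSimilarity Λ Λ' c O)
    (hD : IsLabelBound Λ D) (hL : 1 ≤ L) (hc : 1 ≤ c) (x : Λ) :
    ‖((α x).1 : Space L) - (α x).2‖ ≤ D * c ^ 2 := by
  obtain ⟨v, hv, hxv⟩ := h.exists_rep x
  rw [h.norm_labels_sub hsim.le hL x hv hxv]
  exact hD.norm_edge hsim h hc v hv

theorem norm_sub_label_le (h : LabelData Λ Λ' α V₀ S b) (hsim : IsSimilarity Λ Λ' c O)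
    (hD : IsLabelBound Λ D) (hL : 1 ≤ L) (hc : 1 ≤ c) (x : Λ) :
    ‖(x : Space L) - (α x).1‖ ≤ 2 * D * c ^ 2 ∧ ‖(x : Space L) - (α x).2‖ ≤ 2 * D * c ^ 2 := by
  have h1 := h.norm_sub_midpoint_le hsim hD hL x
  have h2 := h.norm_labels_sub_le hsim hD hL hc x
  set y := ((α x).1 : Space L)
  set z := ((α x).2 : Space L)
  have hcc : D * c ≤ D * c ^ 2 := by
    have := hD.pos
    gcongr
    exact le_self_pow₀ hc two_ne_zero
  have hhalf : ‖(2 : ℝ)⁻¹ • (y - z)‖ ≤ D * c ^ 2 := by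
    rw [norm_smul]
    norm_num
    linarith [norm_nonneg (y - z)]
  have e1 : (x : Space L) - y = (x - (2 : ℝ)⁻¹ • (y + z)) - (2 : ℝ)⁻¹ • (y - z) := by
    rw [sub_sub, ← smul_add, add_add_sub_cancel, ← two_smul ℝ y, inv_smul_smul₀ two_ne_zero]
  have e2 : (x : Space L) - z = (x - (2 : ℝ)⁻¹ • (y + z)) + (2 : ℝ)⁻¹ • (y - z) := by
    rw [sub_add, ← smul_sub, add_sub_sub_cancel, ← two_smul ℝ z, inv_smul_smul₀ two_ne_zero]
  rw [e1, e2]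
  exact ⟨(norm_sub_le _ _).trans (by linarith), (norm_add_le _ _).trans (by linarith)⟩

/-- Averaged over a shifted Voronoi set, the squared edge length does not depend on the shift. -/
theorem sum_norm_labels_sub (h : LabelData Λ Λ' α V₀ S b) (hle : Λ' ≤ Λ) (hL : 1 ≤ L) (x : Λ) :
    ∑ d : V₀, ‖((α (x + ⟨d, h.voronoi.mem d d.2⟩)).1 : Space L) -
      (α (x + ⟨d, h.voronoi.mem d d.2⟩)).2‖ ^ 2 = ∑ s ∈ S, ‖s‖ ^ 2 := by
  classical
  choose rep hrep hxrep using fun y : Λ => h.exists_rep y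
  have h1 : ∀ d : V₀, ‖((α (x + ⟨d, h.voronoi.mem d d.2⟩)).1 : Space L) -
      (α (x + ⟨d, h.voronoi.mem d d.2⟩)).2‖ = ‖b (rep (x + ⟨d, h.voronoi.mem d d.2⟩))‖ := fun d =>
    h.norm_labels_sub hle hL _ (hrep _) (hxrep _)
  simp only [h1]
  -- A translate of a set of representatives is again one: reducing `x + d` modulo `Λ'` permutes
  -- `V₀`.
  let g : V₀ → V₀ := fun d => ⟨rep (x + ⟨d, h.voronoi.mem d d.2⟩), hrep _⟩
  have hg : Function.Injective g := by
    intro d d' he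
    have he' : rep (x + ⟨d, h.voronoi.mem d d.2⟩) = rep (x + ⟨d', h.voronoi.mem d' d'.2⟩) :=
      congrArg Subtype.val he
    have h2 := hxrep (x + ⟨d, h.voronoi.mem d d.2⟩)
    have h3 := hxrep (x + ⟨d', h.voronoi.mem d' d'.2⟩)
    rw [he'] at h2
    have h4 := Λ'.sub_mem h2 h3
    simp only [Submodule.coe_add, sub_sub_sub_cancel_right, add_sub_add_left_eq_sub] at h4
    exact Subtype.ext (h.rep_unique (h.voronoi.mem d d.2) d.2 d'.2 (by simp) h4)
  have hb : Function.Bijective g := Finite.injective_iff_bijective.1 hg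
  calc ∑ d : V₀, ‖b (rep (x + ⟨d, h.voronoi.mem d d.2⟩))‖ ^ 2
      = ∑ d : V₀, ‖b (g d)‖ ^ 2 := rfl
    _ = ∑ d : V₀, ‖b d‖ ^ 2 := hb.sum_comp fun d : V₀ => ‖b d‖ ^ 2
    _ = ∑ d ∈ V₀, ‖b d‖ ^ 2 := Finset.sum_coe_sort V₀ fun d => ‖b d‖ ^ 2
    _ = ∑ s ∈ S, ‖s‖ ^ 2 := Finset.sum_nbij b (fun v hv => h.bijOn.mapsTo hv) h.bijOn.injOn
        h.bijOn.surjOn fun _ _ => rfl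

end LabelData

end EdgeLengths

/-! ### The side distortion -/

section Distortion

variable {L : ℕ} {Λ : Submodule ℤ (Space L)} {p : ℝ → ℝ}

theorem IsNearest.aemeasurable_comp [Countable Λ] {F : Type*} [MeasurableSpace F]
    [MeasurableSpace.CountablyGenerated F] {Q : Space L → Λ} (hQ : IsNearest Λ Q) {β : ℝ}
    (hβ : 0 < β) (g : Λ → F) : AEMeasurable (fun x => g (Q (β⁻¹ • x))) := by
  refine NullMeasurable.aemeasurable fun s _ => ?_
  have : (fun x => g (Q (β⁻¹ • x))) ⁻¹' s = ⋃ u : g ⁻¹' s, (fun x => Q (β⁻¹ • x)) ⁻¹' {u.1} := by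
    ext x; simp
  rw [this]
  exact NullMeasurableSet.iUnion fun u => hQ.nullMeasurableSet_scaled_fiber hβ u.1

theorem midpoint_identity (x y z : Space L) :
    (sqNorm (x - y) + sqNorm (x - z)) / 2 =
      (‖x - (2 : ℝ)⁻¹ • (y + z)‖ ^ 2 + ‖y - z‖ ^ 2 / 4) / L := by
  have h := edgeDistortion_eq x y (z - y)
  rw [add_sub_cancel] at h
  have h1 : x - y - (2 : ℝ)⁻¹ • (z - y) = x - (2 : ℝ)⁻¹ • (y + z) := by
    have : y = (2 : ℝ)⁻¹ • y + (2 : ℝ)⁻¹ • y := by rw [← add_smul]; norm_num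
    rw [smul_sub, smul_add]
    nth_rewrite 1 [this]
    abel
  rw [h1, norm_sub_rev z y] at h
  exact h

theorem integrable_blockDensity_mul (hp : IsDensity p) {f : Space L → ℝ}
    (hf : AEStronglyMeasurable f volume) {C : ℝ} (hC : ∀ x, |f x| ≤ C) :
    Integrable (fun x => blockDensity p L x * f x) :=
  hp.integrable_blockDensity.mul_bdd hf (ae_of_all _ fun x => by simpa using hC x)

/-- A bounded function that is periodic on average under the translations by `β d`, `d ∈ V`, has
almost the same mean under a density that is almost invariant under these translations. -/
theorem abs_integral_sub_average_le [Countable Λ] (hp : IsDensity p) {Q : Space L → Λ}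
    (hQ : IsNearest Λ Q) {β : ℝ} (hβ : 0 < β) {W : Λ → ℝ} {C A η : ℝ} (hW0 : ∀ u, |W u| ≤ C)
    {ι : Type*} [Fintype ι] [Nonempty ι] (d : ι → Λ) (hA : ∀ u, ∑ i, W (u + d i) = A)
    (hη : ∀ i, ∫ x, |blockDensity p L (x - β • (d i : Space L)) - blockDensity p L x| ≤ η) :
    |(∫ x, blockDensity p L x * W (Q (β⁻¹ • x))) - A / Fintype.card ι| ≤ C * η := by
  set P := blockDensity p L
  have hC : 0 ≤ C := (abs_nonneg _).trans (hW0 0)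
  have hm : ∀ u : Λ, AEStronglyMeasurable (fun x => W (Q (β⁻¹ • x) + u)) :=
    fun u => (hQ.aemeasurable_comp hβ fun v => W (v + u)).aestronglyMeasurable
  have hm0 : AEStronglyMeasurable (fun x => W (Q (β⁻¹ • x))) :=
    (hQ.aemeasurable_comp hβ W).aestronglyMeasurable
  have hi : ∀ i, Integrable (fun x => P x * W (Q (β⁻¹ • x) + d i)) := fun i =>
    integrable_blockDensity_mul hp (hm _) fun x => hW0 _
  have hi0 : Integrable (fun x => P x * W (Q (β⁻¹ • x))) :=
    integrable_blockDensity_mul hp hm0 fun x => hW0 _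
  have hcard : (0 : ℝ) < Fintype.card ι := by exact_mod_cast Fintype.card_pos
  have hsum : ∑ i, ∫ x, P x * W (Q (β⁻¹ • x) + d i) = A := by
    rw [← integral_finsetSum _ fun i _ => hi i]
    simp only [← Finset.mul_sum, hA]
    rw [integral_mul_const, hp.integral_blockDensity, one_mul]
  have hone : ∀ i, |(∫ x, P x * W (Q (β⁻¹ • x))) - ∫ x, P x * W (Q (β⁻¹ • x) + d i)| ≤ C * η := by
    intro i
    -- By equivariance of `Q`, a change of variables moves the shift from the label to the density,
    -- where `L¹` continuity can be used.
    have h1 : ∫ x, P x * W (Q (β⁻¹ • x) + d i) =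
        ∫ x, P (x - β • (d i : Space L)) * W (Q (β⁻¹ • x)) := by
      rw [← integral_sub_right_eq_self (fun x => P x * W (Q (β⁻¹ • x) + d i)) (β • (d i : Space L))]
      refine integral_congr_ae ?_
      filter_upwards [(measurePreserving_sub_right volume
        (β • (d i : Space L))).quasiMeasurePreserving.ae (hQ.ae_map_add hβ)] with x hx
      have := hx (d i)
      rw [sub_add_cancel] at this
      rw [this]
    have hi1 : Integrable (fun x => P (x - β • (d i : Space L)) * W (Q (β⁻¹ • x))) :=
      (hp.integrable_blockDensity.comp_sub_right _).mul_bdd hm0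
        (ae_of_all _ fun x => by simpa using hW0 (Q (β⁻¹ • x)))
    have hi2 : Integrable (fun x => |P (x - β • (d i : Space L)) - P x|) :=
      ((hp.integrable_blockDensity.comp_sub_right _).sub hp.integrable_blockDensity).abs
    rw [h1, ← integral_sub hi0 hi1]
    rw [← Real.norm_eq_abs]
    refine (norm_integral_le_of_norm_le (hi2.const_mul C) (ae_of_all _ fun x => ?_)).trans ?_
    · rw [← sub_mul, Real.norm_eq_abs, abs_mul, abs_sub_comm, mul_comm]
      exact mul_le_mul_of_nonneg_right (hW0 _) (abs_nonneg _)
    · rw [integral_const_mul]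
      exact mul_le_mul_of_nonneg_left (hη i) hC
  have hsplit : (∫ x, P x * W (Q (β⁻¹ • x))) - A / Fintype.card ι =
      (∑ i, ((∫ x, P x * W (Q (β⁻¹ • x))) - ∫ x, P x * W (Q (β⁻¹ • x) + d i))) /
        Fintype.card ι := by
    rw [Finset.sum_sub_distrib, hsum, Finset.sum_const, Finset.card_univ, nsmul_eq_mul]
    field_simp
  rw [hsplit, abs_div, abs_of_pos hcard, div_le_iff₀ hcard]
  refine (Finset.abs_sum_le_sum_abs _ _).trans ((Finset.sum_le_card_nsmul _ _ _
    fun i _ => hone i).trans (le_of_eq ?_))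
  rw [Finset.card_univ, nsmul_eq_mul, mul_comm]

namespace Quantizer

variable (M : Quantizer Λ) {c D : ℝ} {O : Space L ≃ₗᵢ[ℝ] Space L}
  {V₀ S : Finset (Space L)} {b : Space L → Space L}

theorem isNearest : IsNearest Λ M.nearest := M.nearest_le

/-- The midpoint of the label of the code vector of `x`. -/
noncomputable def midpoint (x : Space L) : Space L :=
  (2 : ℝ)⁻¹ • (((M.encode x).1 : Space L) + (M.encode x).2)

/-- The squared length of the edge that labels a lattice point. -/
noncomputable def edgeSq (u : Λ) : ℝ := ‖((M.label u).1 : Space L) - (M.label u).2‖ ^ 2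

theorem error_add (x : Space L) : (M.error₁ x + M.error₂ x) / 2 =
    (‖x - M.scale • M.midpoint x‖ ^ 2 +
      M.scale ^ 2 / 4 * M.edgeSq (M.nearest (M.scale⁻¹ • x))) / L := by
  rw [error₁, error₂, midpoint_identity, ← smul_add, smul_comm, ← smul_sub, norm_smul,
    Real.norm_of_nonneg M.scale_pos.le, midpoint, edgeSq]
  change (_ + (M.scale * ‖((M.encode x).1 : Space L) - (M.encode x).2‖) ^ 2 / 4) / _ =
    (_ + M.scale ^ 2 / 4 * ‖((M.encode x).1 : Space L) - (M.encode x).2‖ ^ 2) / _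
  ring

theorem norm_sub_scale_smul (x y : Space L) :
    ‖x - M.scale • y‖ = M.scale * ‖M.scale⁻¹ • x - y‖ := by
  rw [← Real.norm_of_nonneg M.scale_pos.le, ← norm_smul, smul_sub, Real.norm_of_nonneg
    M.scale_pos.le, smul_inv_smul₀ M.scale_pos.ne']

theorem norm_sub_label_le (hL : 1 ≤ L) (hsim : IsSimilarity Λ M.sub c O)
    (h : LabelData Λ M.sub M.label V₀ S b) (hD : IsLabelBound Λ D) (hc : 1 ≤ c) (x : Space L) :
    ‖x - M.scale • ((M.encode x).1 : Space L)‖ ≤ M.scale * (3 * D * c ^ 2) ∧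
      ‖x - M.scale • ((M.encode x).2 : Space L)‖ ≤ M.scale * (3 * D * c ^ 2) := by
  have h1 := hD.dist_nearest _ M.isNearest (M.scale⁻¹ • x)
  have h2 := h.norm_sub_label_le hsim hD hL hc (M.nearest (M.scale⁻¹ • x))
  have hDc : D ≤ D * c ^ 2 := le_mul_of_one_le_right hD.pos.le (one_le_pow₀ hc)
  rw [norm_sub_scale_smul, norm_sub_scale_smul]
  have key : ∀ y : Space L, ‖(M.nearest (M.scale⁻¹ • x) : Space L) - y‖ ≤ 2 * D * c ^ 2 →
      M.scale * ‖M.scale⁻¹ • x - y‖ ≤ M.scale * (3 * D * c ^ 2) := by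
    intro y hy
    refine mul_le_mul_of_nonneg_left ?_ M.scale_pos.le
    refine (norm_sub_le_norm_sub_add_norm_sub _ (M.nearest (M.scale⁻¹ • x) : Space L) _).trans ?_
    linarith
  exact ⟨key _ h2.1, key _ h2.2⟩

theorem norm_sub_midpoint_le (hL : 1 ≤ L) (hsim : IsSimilarity Λ M.sub c O)
    (h : LabelData Λ M.sub M.label V₀ S b) (hD : IsLabelBound Λ D) (hc : 1 ≤ c) (x : Space L) :
    ‖x - M.scale • M.midpoint x‖ ≤ M.scale * (2 * D * c) := by
  have h1 := hD.dist_nearest _ M.isNearest (M.scale⁻¹ • x)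
  have h2 := h.norm_sub_midpoint_le hsim hD hL (M.nearest (M.scale⁻¹ • x))
  have hDc : D ≤ D * c := le_mul_of_one_le_right hD.pos.le hc
  rw [norm_sub_scale_smul]
  refine mul_le_mul_of_nonneg_left ?_ M.scale_pos.le
  refine (norm_sub_le_norm_sub_add_norm_sub _ (M.nearest (M.scale⁻¹ • x) : Space L) _).trans ?_
  have : ‖(M.nearest (M.scale⁻¹ • x) : Space L) - M.midpoint x‖ ≤ D * c := h2
  linarith

theorem abs_error_le (hL : 1 ≤ L) (hsim : IsSimilarity Λ M.sub c O)
    (h : LabelData Λ M.sub M.label V₀ S b) (hD : IsLabelBound Λ D) (hc : 1 ≤ c) (x : Space L) :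
    |M.error₁ x| ≤ (M.scale * (3 * D * c ^ 2)) ^ 2 / L ∧
      |M.error₂ x| ≤ (M.scale * (3 * D * c ^ 2)) ^ 2 / L := by
  obtain ⟨h1, h2⟩ := M.norm_sub_label_le hL hsim h hD hc x
  rw [error₁, error₂, sqNorm, sqNorm, abs_of_nonneg (by positivity), abs_of_nonneg (by positivity)]
  exact ⟨by gcongr, by gcongr⟩

variable [Countable Λ]

theorem aestronglyMeasurable_error : AEStronglyMeasurable M.error₁ (volume : Measure (Space L)) ∧
    AEStronglyMeasurable M.error₂ (volume : Measure (Space L)) := by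
  have h1 : AEMeasurable (fun x => ((M.encode x).1 : Space L)) :=
    M.isNearest.aemeasurable_comp M.scale_pos fun u => ((M.label u).1 : Space L)
  have h2 : AEMeasurable (fun x => ((M.encode x).2 : Space L)) :=
    M.isNearest.aemeasurable_comp M.scale_pos fun u => ((M.label u).2 : Space L)
  exact ⟨((aemeasurable_id.sub (h1.const_smul M.scale)).norm.pow_const 2
      |>.div_const (L : ℝ)).aestronglyMeasurable,
    ((aemeasurable_id.sub (h2.const_smul M.scale)).norm.pow_const 2
      |>.div_const (L : ℝ)).aestronglyMeasurable⟩

theorem integrable_error (hp : IsDensity p) (hL : 1 ≤ L) (hsim : IsSimilarity Λ M.sub c O)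
    (h : LabelData Λ M.sub M.label V₀ S b) (hD : IsLabelBound Λ D) (hc : 1 ≤ c) :
    Integrable M.error₁ (sourceLaw p L) ∧ Integrable M.error₂ (sourceLaw p L) := by
  have := hp.isProbabilityMeasure (L := L)
  obtain ⟨h1, h2⟩ := M.aestronglyMeasurable_error
  exact ⟨Integrable.of_bound (h1.mono_ac sourceLaw_absolutelyContinuous) _
      (ae_of_all _ fun x => (M.abs_error_le hL hsim h hD hc x).1),
    Integrable.of_bound (h2.mono_ac sourceLaw_absolutelyContinuous) _
      (ae_of_all _ fun x => (M.abs_error_le hL hsim h hD hc x).2)⟩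

/-- Up to lower order terms, the side distortion is a quarter of the mean squared length of the
edges. -/
theorem abs_sideDistortion_sub_le (hp : IsDensity p) (hL : 1 ≤ L)
    (hsim : IsSimilarity Λ M.sub c O) (h : LabelData Λ M.sub M.label V₀ S b)
    (hD : IsLabelBound Λ D) (hc : 1 ≤ c) (hV : V₀.Nonempty) {η : ℝ}
    (hη : ∀ t : Space L, ‖t‖ ≤ M.scale * (D * c) →
      ∫ x, |blockDensity p L (x + t) - blockDensity p L x| ≤ η) :
    |M.sideDistortion p - M.scale ^ 2 / 4 * ((∑ s ∈ S, ‖s‖ ^ 2) / M.index) / L| ≤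
      ((M.scale * (2 * D * c)) ^ 2 + M.scale ^ 2 / 4 * ((D * c ^ 2) ^ 2 * η)) / L := by
  have hL0 : (0 : ℝ) < L := by exact_mod_cast hL
  set P := blockDensity p L
  have hmid : ∀ x, ‖x - M.scale • M.midpoint x‖ ^ 2 ≤ (M.scale * (2 * D * c)) ^ 2 := fun x => by
    have := M.norm_sub_midpoint_le hL hsim h hD hc x
    gcongr
  have hedge : ∀ u, |M.edgeSq u| ≤ (D * c ^ 2) ^ 2 := fun u => by
    have := h.norm_labels_sub_le hsim hD hL hc u
    rw [edgeSq, abs_of_nonneg (by positivity)]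
    gcongr
  have hmm : AEStronglyMeasurable (fun x => ‖x - M.scale • M.midpoint x‖ ^ 2)
      (volume : Measure (Space L)) := by
    have h1 : AEMeasurable (fun x => M.midpoint x) :=
      M.isNearest.aemeasurable_comp M.scale_pos fun u =>
        (2 : ℝ)⁻¹ • (((M.label u).1 : Space L) + (M.label u).2)
    exact ((aemeasurable_id.sub (h1.const_smul M.scale)).norm.pow_const 2).aestronglyMeasurable
  have hem : AEStronglyMeasurable (fun x => M.edgeSq (M.nearest (M.scale⁻¹ • x)))
      (volume : Measure (Space L)) :=
    (M.isNearest.aemeasurable_comp M.scale_pos M.edgeSq).aestronglyMeasurable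
  have hi1 : Integrable (fun x => P x * ‖x - M.scale • M.midpoint x‖ ^ 2) :=
    integrable_blockDensity_mul hp hmm fun x => by
      rw [abs_of_nonneg (by positivity)]; exact hmid x
  have hi2 : Integrable (fun x => P x * M.edgeSq (M.nearest (M.scale⁻¹ • x))) :=
    integrable_blockDensity_mul hp hem fun x => hedge _
  obtain ⟨he1, he2⟩ := M.integrable_error hp hL hsim h hD hc
  have hside : M.sideDistortion p = ((∫ x, P x * ‖x - M.scale • M.midpoint x‖ ^ 2) +
      M.scale ^ 2 / 4 * ∫ x, P x * M.edgeSq (M.nearest (M.scale⁻¹ • x))) / L := by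
    rw [sideDistortion, ← integral_add he1 he2, ← integral_div, hp.integral_sourceLaw]
    simp only [M.error_add]
    rw [← integral_const_mul, ← integral_add hi1 (hi2.const_mul _), ← integral_div]
    refine integral_congr_ae (ae_of_all _ fun x => ?_)
    simp only
    ring
  have hterm1 : |∫ x, P x * ‖x - M.scale • M.midpoint x‖ ^ 2| ≤ (M.scale * (2 * D * c)) ^ 2 := by
    rw [abs_of_nonneg (integral_nonneg fun x => mul_nonneg (hp.blockDensity_nonneg x)
      (by positivity))]
    calc _ ≤ ∫ x, P x * (M.scale * (2 * D * c)) ^ 2 :=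
          integral_mono hi1 (hp.integrable_blockDensity.mul_const _) fun x =>
            mul_le_mul_of_nonneg_left (hmid x) (hp.blockDensity_nonneg x)
      _ = _ := by rw [integral_mul_const, hp.integral_blockDensity, one_mul]
  have : Nonempty V₀ := hV.to_subtype
  -- The shifts are the points of `V₀`, of length at most `β D c` after scaling. This scale, smaller
  -- than that of the edges, is the only one on which near-invariance of the density is required.
  have hterm2 := abs_integral_sub_average_le hp M.isNearest M.scale_pos hedge
    (fun d : V₀ => ⟨d, h.voronoi.mem d d.2⟩) (fun u => h.sum_norm_labels_sub hsim.le hL u)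
    (η := η) fun d => by
      have := hη (-(M.scale • (d : Space L))) (by
        rw [norm_neg, norm_smul, Real.norm_of_nonneg M.scale_pos.le]
        exact mul_le_mul_of_nonneg_left (hD.norm_voronoi hsim h d d.2) M.scale_pos.le)
      simpa only [← sub_eq_add_neg] using this
  rw [Fintype.card_coe, h.card_voronoi] at hterm2
  rw [hside, ← sub_div, abs_div, abs_of_pos hL0, add_sub_assoc, ← mul_sub]
  refine div_le_div_of_nonneg_right ((abs_add_le _ _).trans (add_le_add hterm1 ?_)) hL0.le
  rw [abs_mul, abs_of_nonneg (by positivity)]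
  exact mul_le_mul_of_nonneg_left hterm2 (by positivity)

end Quantizer

end Distortion

/-! ### The entropy of a channel -/

section ChannelEntropy

/-- The volume of a Voronoi region of the scaled sublattice. -/
noncomputable def Quantizer.subVolume {L : ℕ} {Λ : Submodule ℤ (Space L)} (M : Quantizer Λ) : ℝ :=
  M.index * (M.scale ^ L * ZLattice.covolume Λ)

theorem Quantizer.highRate_eq {L : ℕ} {Λ : Submodule ℤ (Space L)} (M : Quantizer Λ) (p : ℝ → ℝ) :
    M.highRate p = diffEntropy p - Real.logb 2 M.subVolume / L := rfl

theorem Quantizer.entropy_ne_top {L : ℕ} {Λ : Submodule ℤ (Space L)} (M : Quantizer Λ) {p : ℝ → ℝ}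
    (h : M.rate₁ p ≠ ⊤) :
    entropy (sourceLaw p L) (fun x => (M.encode x).1) ≠ ⊤ := by
  intro h'
  rw [Quantizer.rate₁, h'] at h
  exact h (ENNReal.top_div_of_ne_top (ENNReal.natCast_ne_top L))

variable {L : ℕ} {Λ : Submodule ℤ (Space L)} [DiscreteTopology Λ] [IsZLattice ℝ Λ] {p : ℝ → ℝ}

theorem countable_of_le {Λ' : Submodule ℤ (Space L)} (h : Λ' ≤ Λ) : Countable Λ' :=
  (Submodule.inclusion_injective h).countable

theorem IsNearest.volume_scaled_preimage_le {Q : Space L → Λ} (hQ : IsNearest Λ Q) {β : ℝ}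
    (hβ : 0 < β) {F : Set Λ} (hF : F.Finite) {n : ℕ} (hn : F.ncard ≤ n) :
    volume ((fun x => Q (β⁻¹ • x)) ⁻¹' F) ≤
      ENNReal.ofReal (n * (β ^ L * ZLattice.covolume Λ)) := by
  have hset : (fun x => Q (β⁻¹ • x)) ⁻¹' F =
      ⋃ u ∈ hF.toFinset, (fun x => Q (β⁻¹ • x)) ⁻¹' {u} := by
    ext x; simp
  rw [hset]
  refine (measure_biUnion_finset_le _ _).trans ?_
  simp only [hQ.volume_scaled_fiber hβ]
  rw [Finset.sum_const, nsmul_eq_mul, ← Set.ncard_eq_toFinset_card _ hF,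
    ENNReal.ofReal_mul (Nat.cast_nonneg _), ENNReal.ofReal_natCast]
  gcongr

namespace Quantizer

variable (M : Quantizer Λ) {c D : ℝ} {O : Space L ≃ₗᵢ[ℝ] Space L}
  {V₀ S : Finset (Space L)} {b : Space L → Space L}

/-- The entropy of the first label, in nats. -/
noncomputable def labelEntropy (p : ℝ → ℝ) : ℝ :=
  ∑' u, Real.negMulLog (fiberProb volume (blockDensity p L) (fun x => (M.encode x).1) u)

theorem nullMeasurableSet_encode_fst (u : M.sub) :
    NullMeasurableSet ((fun x => (M.encode x).1) ⁻¹' {u}) (volume : Measure (Space L)) := by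
  have : (fun x => (M.encode x).1) ⁻¹' {u} =
      ⋃ v : {v : Λ | (M.label v).1 = u}, (fun x => M.nearest (M.scale⁻¹ • x)) ⁻¹' {v.1} := by
    ext x; simp [encode]
  rw [this]
  exact NullMeasurableSet.iUnion fun v => M.isNearest.nullMeasurableSet_scaled_fiber M.scale_pos _

theorem toReal_rate (hp : IsDensity p) :
    (M.rate₁ p).toReal = M.labelEntropy p / Real.log 2 / L := by
  have := countable_of_le M.similar.1
  rw [rate₁, ENNReal.toReal_div, hp.toReal_entropy M.nullMeasurableSet_encode_fst,
    ENNReal.toReal_natCast, labelEntropy]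

/-- Each cell of the first label is a union of at most `N + #B` Voronoi cells of the codebook, which
bounds its volume for `integral_negMulLog_le`. -/
theorem diffEntropy_le (hp : IsDensity p) (hh : HasFiniteDiffEntropy p) (hL : 1 ≤ L)
    (h : LabelData Λ M.sub M.label V₀ S b) (hM : 0 < M.index) (hr : M.rate₁ p ≠ ⊤)
    {B : Finset (Space L)} (hB : B ⊆ V₀)
    (hBex : ∀ v ∈ V₀, LabelData.IsExceptional M.sub b v → v ∈ B) :
    Real.log 2 * (L * diffEntropy p) ≤
      Real.log ((M.index + B.card : ℕ) * (M.scale ^ L * ZLattice.covolume Λ)) +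
        M.labelEntropy p := by
  have := countable_of_le M.similar.1
  have hν := ZLattice.covolume_pos Λ volume
  have hβ := M.scale_pos
  rw [← hh.integral_negMulLog_blockDensity hp]
  refine integral_negMulLog_le hp.blockDensity_nonneg hp.integrable_blockDensity
    hp.integral_blockDensity (hh.integrable_negMulLog_blockDensity hp)
    M.nullMeasurableSet_encode_fst (by positivity) (fun u => ?_)
    (hp.summable_of_entropy_ne_top M.nullMeasurableSet_encode_fst (M.entropy_ne_top hr))
  obtain ⟨h1, h2⟩ := h.ncard_fiber_le M.similar.1 hL u B hB hBex
  exact M.isNearest.volume_scaled_preimage_le M.scale_pos h1 h2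

/-- Gibbs' inequality, where the weight of a sublattice point is the integral of `exp ψ` over its
scaled Voronoi cell. These cells have volume `M.subVolume`, and the one around the label of `x`
consists of points where `ψ` is at least `ψ x - ε`. -/
theorem labelEntropy_le (hp : IsDensity p) (hL : 1 ≤ L) (hsim : IsSimilarity Λ M.sub c O)
    (h : LabelData Λ M.sub M.label V₀ S b) (hD : IsLabelBound Λ D) (hc : 1 ≤ c)
    {ψ : Space L → ℝ} (hexp : Integrable fun x => Real.exp (ψ x))
    (hPψ : Integrable fun x => blockDensity p L x * ψ x) {ε : ℝ}
    (hε : ∀ x y, ‖x - y‖ ≤ M.scale * (4 * D * c ^ 2) → ψ x ≤ ψ y + ε) :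
    M.labelEntropy p ≤ -Real.log M.subVolume - (∫ x, blockDensity p L x * ψ x) + ε +
      (∫ x, Real.exp (ψ x)) - 1 := by
  have := countable_of_le M.similar.1
  have := hsim.discreteTopology
  have : IsZLattice ℝ M.sub := ⟨hsim.span_top⟩
  have hν := ZLattice.covolume_pos Λ volume
  have hν' := ZLattice.covolume_pos M.sub volume
  have hβ := M.scale_pos
  set P := blockDensity p L
  have hT := hsim.isNearest_transport M.isNearest
  set T := hsim.transport M.nearest
  have hcov : M.subVolume = M.scale ^ L * ZLattice.covolume M.sub := by
    rw [subVolume, index, latticeIndex, ← ZLattice.covolume_div_covolume_eq_relIndex' M.sub Λ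
      hsim.le]
    field_simp
  have hV : 0 < M.subVolume := by rw [hcov]; positivity
  have hr := hasSum_integral_fiber (fun u => hT.nullMeasurableSet_scaled_fiber hβ u) hexp
  have hφ : Integrable fun x => P x * (-Real.log M.subVolume - ψ x + ε) := by
    have h1 := (hp.integrable_blockDensity (L := L)).mul_const (-Real.log M.subVolume + ε)
    exact (h1.sub hPψ).congr (ae_of_all _ fun x => by simp only [Pi.sub_apply]; ring)
  -- The constant is `4 = 3 + 1`: `3 D c ^ 2` from `x` to its label and `D c ≤ D c ^ 2` from the
  -- label to a point of its cell.
  have hdist : ∀ x y, T (M.scale⁻¹ • y) = (M.encode x).1 →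
      ‖x - y‖ ≤ M.scale * (4 * D * c ^ 2) := by
    intro x y hxy
    have h1 := (M.norm_sub_label_le hL hsim h hD hc x).1
    have h2 := hsim.norm_sub_transport_le (hD.dist_nearest _ M.isNearest) (M.scale⁻¹ • y)
    change ‖_ - (T (M.scale⁻¹ • y) : Space L)‖ ≤ _ at h2
    rw [← hxy] at h1
    have h3 : ‖y - M.scale • (T (M.scale⁻¹ • y) : Space L)‖ ≤ M.scale * (D * c ^ 2) := by
      rw [norm_sub_scale_smul]
      have hD0 := hD.pos
      have : D * c ≤ D * c ^ 2 := by gcongr; nlinarith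
      gcongr
      exact h2.trans this
    rw [norm_sub_rev] at h3
    refine (norm_sub_le_norm_sub_add_norm_sub _ _ _).trans ((add_le_add h1 h3).trans (le_of_eq ?_))
    ring
  obtain ⟨-, hle⟩ := summable_negMulLog_and_tsum_le hp.blockDensity_nonneg
    hp.integrable_blockDensity hp.integral_blockDensity M.nullMeasurableSet_encode_fst
    hr.summable (fun u => integral_nonneg fun x => (Real.exp_pos _).le) hφ fun x => by
      set C := (fun y => T (M.scale⁻¹ • y)) ⁻¹' {(M.encode x).1}
      have hvol : volume C = ENNReal.ofReal M.subVolume := by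
        rw [hcov]; exact hT.volume_scaled_fiber hβ _
      have hvr : volume.real C = M.subVolume := by
        rw [measureReal_def, hvol, ENNReal.toReal_ofReal hV.le]
      calc Real.exp (-(-Real.log M.subVolume - ψ x + ε))
          = ∫ y in C, Real.exp (ψ x - ε) := by
            rw [setIntegral_const, hvr, smul_eq_mul]
            nth_rewrite 2 [← Real.exp_log hV]
            rw [← Real.exp_add]
            ring_nf
        _ ≤ _ := by
            refine setIntegral_mono_on₀ (integrableOn_const (by rw [hvol]; simp)) hexp.integrableOn
              (hT.nullMeasurableSet_scaled_fiber hβ _) fun y hy => ?_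
            have := hε x y (hdist x y hy)
            exact Real.exp_le_exp.2 (by linarith)
  rw [hr.tsum_eq] at hle
  refine hle.trans (le_of_eq ?_)
  have h1 : ∫ x, P x * (-Real.log M.subVolume - ψ x + ε) =
      -Real.log M.subVolume + ε - ∫ x, P x * ψ x := by
    have h2 := (hp.integrable_blockDensity (L := L)).mul_const (-Real.log M.subVolume + ε)
    calc _ = ∫ x, (P x * (-Real.log M.subVolume + ε) - P x * ψ x) :=
          integral_congr_ae (ae_of_all _ fun x => by ring)
      _ = _ := by rw [integral_sub h2 hPψ, integral_mul_const, hp.integral_blockDensity, one_mul]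
  rw [h1]
  ring

end Quantizer

end ChannelEntropy

/-! ### Bounds on the channel entropy, uniform over quantizers -/

section RateLimit

variable {L : ℕ} {Λ : Submodule ℤ (Space L)} [DiscreteTopology Λ] [IsZLattice ℝ Λ] {p : ℝ → ℝ}

namespace Quantizer

theorem index_eq (M : Quantizer Λ) {c : ℝ} {O : Space L ≃ₗᵢ[ℝ] Space L}
    (hsim : IsSimilarity Λ M.sub c O) : (M.index : ℝ) = c ^ L :=
  hsim.latticeIndex_eq M.isNearest

theorem index_pos (M : Quantizer Λ) : 0 < M.index := by
  obtain ⟨c, O, hsim⟩ := M.similar.exists_isSimilarity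
  have := pow_pos hsim.pos L
  rw [← M.index_eq hsim] at this
  exact_mod_cast this

theorem subVolume_pos (M : Quantizer Λ) : 0 < M.subVolume := by
  have hν := ZLattice.covolume_pos Λ volume
  have hβ := M.scale_pos
  have : (0 : ℝ) < M.index := by exact_mod_cast M.index_pos
  rw [subVolume]
  positivity

theorem summable_of_rate_ne_top (M : Quantizer Λ) (hp : IsDensity p) (hr : M.rate₁ p ≠ ⊤) :
    Summable fun u => Real.negMulLog
      (fiberProb volume (blockDensity p L) (fun x => (M.encode x).1) u) :=
  have := countable_of_le M.similar.1
  hp.summable_of_entropy_ne_top M.nullMeasurableSet_encode_fst (M.entropy_ne_top hr)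

/-- One quantizer with finite rate serves as reference for all others. The order of quantifiers
matters: `D₀` is fixed before the width `t`, which may later depend on another quantizer. -/
theorem exists_log_density (M : Quantizer Λ) (hp : IsDensity p) (hL : 1 ≤ L) (hr : M.rate₁ p ≠ ⊤) :
    ∃ D₀ : ℝ, 0 ≤ D₀ ∧ ∀ t : ℝ, 0 < t → ∃ ψ : Space L → ℝ,
      (∀ x y, ψ x - ψ y ≤ (L + 1) * Real.log (1 + ‖x - y‖ / t)) ∧
      UniformContinuous ψ ∧ Integrable (fun x => Real.exp (ψ x)) ∧
      ∫ x, Real.exp (ψ x) = t ^ L * ∫ x : Space L, bracket (L + 1 : ℝ) x ∧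
      Integrable (fun x => blockDensity p L x * ψ x) ∧
      -∫ x, blockDensity p L x * ψ x ≤
        M.labelEntropy p + (L + 1) * Real.log (1 + D₀ / t) := by
  have := countable_of_le M.similar.1
  obtain ⟨D, hD⟩ := exists_isLabelBound hL M.isNearest
  obtain ⟨c, O, hsim⟩ := M.similar.exists_isSimilarity
  obtain ⟨V₀, S, b, h⟩ := M.isLabeling.exists_labelData
  have hb := fun x => (M.norm_sub_label_le hL hsim h hD
    (LabelData.one_le_factor hL hsim M.isNearest) x).1
  refine ⟨_, (norm_nonneg _).trans (hb 0), fun t ht => ?_⟩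
  have := exists_log_density_of_entropy hp.blockDensity_nonneg hp.integrable_blockDensity
    hp.integral_blockDensity M.nullMeasurableSet_encode_fst (fun u => M.scale • (u : Space L)) hb
    (M.summable_of_rate_ne_top hp hr) ht
  simp only [finrank_euclideanSpace_fin] at this
  exact this

/-- As long as the quantizer cells do not shrink, the entropy is at most `log N + O(1)`. -/
theorem exists_labelEntropy_le (M₀ : Quantizer Λ) (hp : IsDensity p) (hL : 1 ≤ L)
    (hr : M₀.rate₁ p ≠ ⊤) {δ : ℝ} (hδ : 0 < δ) :
    ∃ C : ℝ, ∀ (M : Quantizer Λ) (c : ℝ) (O : Space L ≃ₗᵢ[ℝ] Space L),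
      IsSimilarity Λ M.sub c O → δ ≤ M.scale * c ^ 2 →
      M.labelEntropy p ≤ Real.log M.index + C := by
  obtain ⟨D, hD⟩ := exists_isLabelBound hL M₀.isNearest
  obtain ⟨D₀, hD₀, hψ'⟩ := M₀.exists_log_density hp hL hr
  have hν := ZLattice.covolume_pos Λ volume
  refine ⟨-Real.log (ZLattice.covolume Λ) + M₀.labelEntropy p +
    (L + 1) * Real.log (1 + D₀ / δ) + (L + 1) * Real.log (1 + 4 * D) +
    (∫ x : Space L, bracket (L + 1 : ℝ) x) - 1, fun M c O hsim ht => ?_⟩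
  obtain ⟨V₀, S, b, h⟩ := M.isLabeling.exists_labelData
  set t := M.scale * c ^ 2
  have ht0 : 0 < t := hδ.trans_le ht
  have hβ := M.scale_pos
  have hD0 := hD.pos
  -- With the width equal to `β c ^ 2`, the scale of the label distances, `ψ` varies by `O(1)` over
  -- them. Subtracting `L log t` makes the mass of `exp ψ` independent of `t`.
  obtain ⟨ψ, hmod, -, hexp, hI, hPψ, hle⟩ := hψ' t ht0
  have hc := LabelData.one_le_factor hL hsim M.isNearest
  have hc0 := hsim.pos
  have he : ∀ x, Real.exp (ψ x - L * Real.log t) = (t ^ L)⁻¹ * Real.exp (ψ x) := fun x => by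
    rw [Real.exp_sub, mul_comm (L : ℝ), ← Real.rpow_def_of_pos ht0, Real.rpow_natCast,
      div_eq_inv_mul]
  have hexp' : Integrable fun x => Real.exp (ψ x - L * Real.log t) := by
    simp only [he]; exact hexp.const_mul _
  have hc2 : Integrable fun x => blockDensity p L x * (L * Real.log t) :=
    (hp.integrable_blockDensity (L := L)).mul_const (L * Real.log t)
  have hPψ' : Integrable fun x => blockDensity p L x * (ψ x - L * Real.log t) := by
    simp only [mul_sub]; exact hPψ.sub hc2
  have key := M.labelEntropy_le hp hL hsim h hD hc hexp' hPψ'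
    (ε := (L + 1) * Real.log (1 + 4 * D)) fun x y hxy => by
      have h1 : ‖x - y‖ / t ≤ 4 * D := by
        rw [div_le_iff₀ ht0]
        exact hxy.trans (le_of_eq (by ring))
      have h2 : (L + 1) * Real.log (1 + ‖x - y‖ / t) ≤ (L + 1) * Real.log (1 + 4 * D) := by
        gcongr
      linarith [hmod x y]
  have hint : ∫ x, blockDensity p L x * (ψ x - L * Real.log t) =
      (∫ x, blockDensity p L x * ψ x) - L * Real.log t := by
    simp only [mul_sub]
    rw [integral_sub hPψ hc2, integral_mul_const, hp.integral_blockDensity, one_mul]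
  have hint2 : ∫ x, Real.exp (ψ x - L * Real.log t) = ∫ x : Space L, bracket (L + 1 : ℝ) x := by
    simp only [he]
    rw [integral_const_mul, hI, inv_mul_cancel_left₀ (by positivity)]
  -- Since `c ^ L = N`, the difference `L log t - log M.subVolume` is `log N - log ν`: the scale
  -- cancels.
  have hlogt : L * Real.log t = L * Real.log M.scale + 2 * Real.log M.index := by
    rw [Real.log_mul hβ.ne' (by positivity), M.index_eq hsim, Real.log_pow, Real.log_pow]
    push_cast; ring
  have hlogV : Real.log M.subVolume =
      Real.log M.index + (L * Real.log M.scale + Real.log (ZLattice.covolume Λ)) := by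
    have : (M.index : ℝ) ≠ 0 := by exact_mod_cast M.index_pos.ne'
    rw [subVolume, Real.log_mul this (by positivity), Real.log_mul (by positivity) hν.ne',
      Real.log_pow]
  have hD₀t : (L + 1) * Real.log (1 + D₀ / t) ≤ (L + 1) * Real.log (1 + D₀ / δ) := by
    gcongr
  rw [hint, hint2, hlogV, hlogt] at key
  linarith

/-- When the quantizer cells shrink, the entropy is at most the high-rate expression. -/
theorem exists_forall_labelEntropy_le (M₀ : Quantizer Λ) (hp : IsDensity p)
    (hh : HasFiniteDiffEntropy p) (hL : 1 ≤ L) (hr : M₀.rate₁ p ≠ ⊤) {ε : ℝ} (hε : 0 < ε) :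
    ∃ δ > 0, ∀ (M : Quantizer Λ) (c : ℝ) (O : Space L ≃ₗᵢ[ℝ] Space L),
      IsSimilarity Λ M.sub c O → M.scale * c ^ 2 < δ →
      M.labelEntropy p ≤
        Real.log 2 * (L * diffEntropy p) - Real.log M.subVolume + ε := by
  obtain ⟨D, hD⟩ := exists_isLabelBound hL M₀.isNearest
  obtain ⟨D₀, hD₀, hψ'⟩ := M₀.exists_log_density hp hL hr
  -- Any width will do: only uniform continuity and integrability of the starting function matter.
  obtain ⟨ψ₀, -, huc, hexp₀, -, hPψ₀, -⟩ := hψ' 1 one_pos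
  obtain ⟨ψ, hψ, hexp, hPψ, hle⟩ := exists_uniformContinuous_crossEntropy_le
    hp.measurable_blockDensity hp.blockDensity_nonneg hp.integrable_blockDensity
    (hh.integrable_negMulLog_blockDensity hp) huc hexp₀ hPψ₀ (half_pos hε)
  rw [hh.integral_negMulLog_blockDensity hp, hp.integral_blockDensity] at hle
  obtain ⟨δ, hδ, hδψ⟩ := Metric.uniformContinuous_iff.1 hψ (ε / 2) (half_pos hε)
  have hD0 := hD.pos
  refine ⟨δ / (4 * D), by positivity, fun M c O hsim hlt => ?_⟩
  obtain ⟨V₀, S, b, h⟩ := M.isLabeling.exists_labelData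
  rw [lt_div_iff₀ (by positivity)] at hlt
  have key := M.labelEntropy_le hp hL hsim h hD (LabelData.one_le_factor hL hsim M.isNearest)
    hexp hPψ (ε := ε / 2) fun x y hxy => by
      have := hδψ (a := x) (b := y) (by
        rw [dist_eq_norm]
        refine hxy.trans_lt (lt_of_eq_of_lt ?_ hlt)
        ring)
      rw [Real.dist_eq] at this
      linarith [(abs_lt.1 this).2]
  linarith

/-- The entropy is at least the high-rate expression, up to a small error. -/
theorem exists_le_labelEntropy {Q : Space L → Λ} (hQ : IsNearest Λ Q) (hp : IsDensity p)
    (hh : HasFiniteDiffEntropy p) (hL : 1 ≤ L) :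
    ∃ C : ℝ, ∀ (M : Quantizer Λ) (c : ℝ) (O : Space L ≃ₗᵢ[ℝ] Space L),
      IsSimilarity Λ M.sub c O → M.rate₁ p ≠ ⊤ →
      Real.log 2 * (L * diffEntropy p) - Real.log M.subVolume - C / c ≤ M.labelEntropy p := by
  obtain ⟨C, hC0, hC⟩ := exists_card_exceptional_le hL hQ
  refine ⟨C, fun M c O hsim hr => ?_⟩
  obtain ⟨V₀, S, b, h⟩ := M.isLabeling.exists_labelData
  obtain ⟨B, hB, hBex, hBc⟩ := hC _ c O _ V₀ S b hsim h
    (LabelData.one_le_factor hL hsim M.isNearest)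
  have hc0 := hsim.pos
  have hν := ZLattice.covolume_pos Λ volume
  have hβ := M.scale_pos
  have hN : (0 : ℝ) < M.index := by exact_mod_cast M.index_pos
  have key := M.diffEntropy_le hp hh hL h M.index_pos hr hB hBex
  -- Exceptional classes form a fraction at most `C / c` of all `N` and cost only `log (1 + C / c) ≤
  -- C / c`.
  have hlog : Real.log ((M.index + B.card : ℕ) * (M.scale ^ L * ZLattice.covolume Λ)) ≤
      Real.log M.subVolume + C / c := by
    have h1 : ((M.index + B.card : ℕ) : ℝ) * (M.scale ^ L * ZLattice.covolume Λ) =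
        (1 + B.card / M.index) * M.subVolume := by
      rw [subVolume]; push_cast; field_simp
    have h2 : (B.card : ℝ) / M.index ≤ C / c := by
      rw [div_le_div_iff₀ hN hc0, M.index_eq hsim]
      exact hBc
    have h3 : (0 : ℝ) < 1 + B.card / M.index := by positivity
    have h4 := Real.log_le_sub_one_of_pos h3
    rw [h1, Real.log_mul h3.ne' M.subVolume_pos.ne']
    linarith
  linarith

end Quantizer

end RateLimit

/-! ### Passage to the limit: rates and side distortion -/

section Limits

/-- The `L¹` modulus of continuity of an integrable function tends to zero. -/
theorem exists_translation_modulus {L : ℕ} {f : Space L → ℝ} (hf : Integrable f) :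
    ∃ η : ℝ → ℝ, Tendsto η (𝓝 0) (𝓝 0) ∧
      ∀ s t, ‖t‖ ≤ s → ∫ x, |f (x + t) - f x| ≤ η s := by
  have hbd : ∀ t, ∫ x, |f (x + t) - f x| ≤ 2 * ∫ x, |f x| := by
    intro t
    have h1 := hf.comp_add_right t
    calc ∫ x, |f (x + t) - f x| ≤ ∫ x, (|f (x + t)| + |f x|) :=
          integral_mono (h1.sub hf).abs (h1.abs.add hf.abs) fun x => abs_sub _ _
      _ = _ := by
          rw [integral_add h1.abs hf.abs, integral_add_right_eq_self fun x => |f x|]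
          ring
  set I : Space L → ℝ := fun t => ∫ x, |f (x + t) - f x| with hI
  -- For `s < 0` the set is empty and the supremum takes its default value `0`, so the two-sided
  -- limit at `0` causes no trouble.
  refine ⟨fun s => sSup (I '' {t | ‖t‖ ≤ s}), ?_, fun s t ht => ?_⟩
  · refine Metric.tendsto_nhds.2 fun ε hε => ?_
    obtain ⟨δ, hδ, hδI⟩ := exists_forall_integral_translate_sub_le hf (half_pos hε)
    refine Metric.eventually_nhds_iff.2 ⟨δ, hδ, fun s hs => ?_⟩
    rw [Real.dist_eq, sub_zero] at hs ⊢
    rw [abs_of_nonneg (Real.sSup_nonneg ?_)]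
    · refine lt_of_le_of_lt (Real.sSup_le ?_ (half_pos hε).le) (half_lt_self hε)
      rintro _ ⟨t, ht, rfl⟩
      exact (hδI t (lt_of_le_of_lt ht (lt_of_abs_lt hs))).le
    · rintro _ ⟨t, -, rfl⟩
      exact integral_nonneg fun x => abs_nonneg _
  · refine le_csSup ⟨2 * ∫ x, |f x|, ?_⟩ ⟨t, ht, rfl⟩
    rintro _ ⟨t, -, rfl⟩
    exact hbd t

variable {L : ℕ} {Λ : Submodule ℤ (Space L)} [DiscreteTopology Λ] [IsZLattice ℝ Λ] {p : ℝ → ℝ}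

theorem tendsto_rpow_atTop {f : ℕ → ℝ} (hf : Tendsto f atTop atTop) :
    Tendsto (fun k => (2 : ℝ) ^ f k) atTop atTop :=
  (tendsto_rpow_atTop_of_base_gt_one 2 one_lt_two).comp hf

theorem factor_eq (hL : 1 ≤ L) {c N s : ℝ} (hc : 0 < c) (h1 : N = c ^ L)
    (h2 : N = (2 : ℝ) ^ ((L : ℝ) * s)) : c = (2 : ℝ) ^ s := by
  rw [h1, mul_comm, Real.rpow_mul two_pos.le, Real.rpow_natCast] at h2
  exact (pow_left_inj₀ hc.le (by positivity) (by omega)).1 h2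

/-- The rate of the first channel is asymptotically given by the high-rate expression. -/
theorem tendsto_highRate_sub (hL : 1 ≤ L) (hp : IsDensity p) (hh : HasFiniteDiffEntropy p)
    {a : ℝ} (ha₀ : 0 < a) (ha₁ : a < 1) (M : ℕ → Quantizer Λ) {R : ℕ → ℝ}
    (hR : Tendsto R atTop atTop)
    (hN : ∀ k, ((M k).index : ℝ) = (2 : ℝ) ^ ((L : ℝ) * (a * R k + 1)))
    (hrate : Tendsto (fun k => ((M k).rate₁ p).toReal - R k) atTop (𝓝 0)) :
    Tendsto (fun k => (M k).highRate p - R k) atTop (𝓝 0) := by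
  choose c O hsim using fun k => (M k).similar.exists_isSimilarity
  have hL0 : (0 : ℝ) < L := by exact_mod_cast hL
  have hl2 : 0 < Real.log 2 := Real.log_pos one_lt_two
  have hc : ∀ k, c k = (2 : ℝ) ^ (a * R k + 1) := fun k =>
    factor_eq hL (hsim k).pos ((M k).index_eq (hsim k)) (hN k)
  have hct : Tendsto c atTop atTop := by
    rw [funext hc]
    exact tendsto_rpow_atTop (tendsto_atTop_add_const_right _ _ (hR.const_mul_atTop ha₀))
  have hlow : ∀ᶠ k in atTop, R k - 1 ≤ ((M k).rate₁ p).toReal := by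
    filter_upwards [hrate.eventually_const_lt (show (-1 : ℝ) < 0 by norm_num)] with k hk
    linarith
  -- An infinite rate has `toReal` equal to `0`, which is excluded once `R k - 1` is positive.
  have hfin : ∀ᶠ k in atTop, (M k).rate₁ p ≠ ⊤ := by
    filter_upwards [hlow, hR.eventually_gt_atTop 1] with k h1 h2 h3
    rw [h3, ENNReal.toReal_top] at h1
    linarith
  obtain ⟨k₀, hk₀⟩ := hfin.exists
  -- Otherwise the coarse bound `log N + C` with `log N = L (a R + 1) log 2` gives `R - 1 ≤ a R + 1
  -- + C / (L log 2)`, which is impossible for large `R` because `a < 1`.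
  have hscale : ∀ δ > 0, ∀ᶠ k in atTop, (M k).scale * c k ^ 2 < δ := by
    intro δ hδ
    obtain ⟨C, hC⟩ := (M k₀).exists_labelEntropy_le hp hL hk₀ hδ
    have hb := hR.eventually_gt_atTop ((2 + C / (Real.log 2 * L)) / (1 - a))
    filter_upwards [hlow, hb] with k h1 h2
    by_contra! h3
    have h4 := hC (M k) (c k) (O k) (hsim k) h3
    rw [hN, Real.log_rpow two_pos] at h4
    rw [(M k).toReal_rate hp, div_div, le_div_iff₀ (by positivity)] at h1
    rw [div_lt_iff₀ (by linarith)] at h2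
    have h5 : C = C / (Real.log 2 * L) * (Real.log 2 * L) := by field_simp
    have h6 := mul_lt_mul_of_pos_right h2 (mul_pos hl2 hL0)
    nlinarith
  obtain ⟨C, hC⟩ := Quantizer.exists_le_labelEntropy (M k₀).isNearest hp hh hL
  have hCc : Tendsto (fun k => C / c k) atTop (𝓝 0) := hct.const_div_atTop C
  have hhigh : ∀ k, (M k).highRate p =
      (Real.log 2 * (L * diffEntropy p) - Real.log (M k).subVolume) / Real.log 2 / L := by
    intro k
    rw [Quantizer.highRate_eq, Real.logb]
    field_simp
  have hdiff : Tendsto (fun k => (M k).labelEntropy p -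
      (Real.log 2 * (L * diffEntropy p) - Real.log (M k).subVolume)) atTop (𝓝 0) := by
    refine Metric.tendsto_nhds.2 fun ε hε => ?_
    obtain ⟨δ, hδ, hup⟩ := (M k₀).exists_forall_labelEntropy_le hp hh hL hk₀ (half_pos hε)
    filter_upwards [hscale δ hδ, hfin, hCc.eventually_lt_const hε] with k h1 h2 h3
    have h4 := hup (M k) (c k) (O k) (hsim k) h1
    have h5 := hC (M k) (c k) (O k) (hsim k) h2
    rw [Real.dist_eq, sub_zero, abs_lt]
    exact ⟨by linarith, by linarith⟩
  have := hrate.sub ((hdiff.div_const (Real.log 2)).div_const (L : ℝ))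
  simp only [zero_div, sub_zero] at this
  refine this.congr fun k => ?_
  rw [(M k).toReal_rate hp, hhigh]
  ring

/-- The high-rate expression for the rate determines the limit of the side distortion. -/
theorem tendsto_sideDistortion (hL : 1 ≤ L) (hp : IsDensity p)
    {a : ℝ} (ha₀ : 0 < a) (M : ℕ → Quantizer Λ) {R : ℕ → ℝ}
    (hR : Tendsto R atTop atTop)
    (hN : ∀ k, ((M k).index : ℝ) = (2 : ℝ) ^ ((L : ℝ) * (a * R k + 1)))
    (hrate : Tendsto (fun k => (M k).highRate p - R k) atTop (𝓝 0)) :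
    Tendsto (fun k => (M k).sideDistortion p * (2 : ℝ) ^ (2 * R k * (1 - a))) atTop
      (𝓝 (sphereSecondMoment L * (2 : ℝ) ^ (2 * diffEntropy p))) := by
  choose c O hsim using fun k => (M k).similar.exists_isSimilarity
  choose V₀ S b h using fun k => (M k).isLabeling.exists_labelData
  have hQ := (M 0).isNearest
  have hL0 : (0 : ℝ) < L := by exact_mod_cast hL
  have hν := ZLattice.covolume_pos Λ volume
  have hc : ∀ k, c k = (2 : ℝ) ^ (a * R k + 1) := fun k =>
    factor_eq hL (hsim k).pos ((M k).index_eq (hsim k)) (hN k)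
  have hc1 : ∀ k, 1 ≤ c k := fun k => LabelData.one_le_factor hL (hsim k) hQ
  have hct : Tendsto c atTop atTop := by
    rw [funext hc]
    exact tendsto_rpow_atTop (tendsto_atTop_add_const_right _ _ (hR.const_mul_atTop ha₀))
  set ν : ℝ := ZLattice.covolume Λ ^ (1 / (L : ℝ)) with hνdef
  have hν0 : 0 < ν := by positivity
  have hνL : ν ^ L = ZLattice.covolume Λ := by
    rw [hνdef, one_div, Real.rpow_inv_natCast_pow hν.le (by omega)]
  set w : ℕ → ℝ := fun k => (M k).highRate p - R k with hw
  -- Here `ν` is the `L`-th root of the covolume, so the left side is the `L`-th root of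
  -- `subVolume`; `w` is the vanishing gap between the high-rate expression and `R`.
  have hβc : ∀ k, (M k).scale * c k * ν = (2 : ℝ) ^ (diffEntropy p - R k - w k) := by
    intro k
    have hβ := (M k).scale_pos
    have hc0 := (hsim k).pos
    refine factor_eq (N := (M k).subVolume) hL (by positivity) ?_ ?_
    · rw [Quantizer.subVolume, (M k).index_eq (hsim k), ← hνL]
      ring
    · have h1 : (L : ℝ) * (diffEntropy p - R k - w k) = Real.logb 2 (M k).subVolume := by
        simp only [hw, Quantizer.highRate_eq]
        field_simp
        ring
      rw [h1, Real.rpow_logb two_pos (by norm_num) (M k).subVolume_pos]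
  have hβc0 : Tendsto (fun k => (M k).scale * c k) atTop (𝓝 0) := by
    have h1 : Tendsto (fun k => -(diffEntropy p - R k - w k)) atTop atTop := by
      have := (hR.atTop_add hrate).atTop_add (tendsto_const_nhds (x := -diffEntropy p))
      refine this.congr fun k => ?_
      ring
    have h2 := (tendsto_rpow_atTop h1).inv_tendsto_atTop.mul_const ν⁻¹
    rw [zero_mul] at h2
    refine h2.congr fun k => ?_
    simp only [Pi.inv_apply]
    rw [Real.rpow_neg two_pos.le, inv_inv, ← hβc, mul_inv_cancel_right₀ hν0.ne']
  -- The squared edge scale, normalized. The powers of `R` cancel: `2 ^ (-2R)` from `(β c) ^ 2` and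
  -- `2 ^ (2aR + 2)` from `c ^ 2`, whose surplus `4` absorbs the quarter in the distortion.
  set Y : ℕ → ℝ := fun k => ((M k).scale * c k ^ 2) ^ 2 * (2 : ℝ) ^ (2 * R k * (1 - a)) with hY
  have hYeq : ∀ k, Y k = 4 / ν ^ 2 * (2 : ℝ) ^ (2 * (diffEntropy p - w k)) := by
    intro k
    have h1 : Y k = ((M k).scale * c k * ν) ^ 2 * c k ^ 2 * (2 : ℝ) ^ (2 * R k * (1 - a)) /
        ν ^ 2 := by
      rw [hY]; field_simp
    rw [h1, hβc, hc, ← Real.rpow_natCast, ← Real.rpow_natCast, ← Real.rpow_mul two_pos.le,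
      ← Real.rpow_mul two_pos.le, ← Real.rpow_add two_pos, ← Real.rpow_add two_pos]
    have h2 : (4 : ℝ) = (2 : ℝ) ^ (2 : ℝ) := by norm_num
    rw [h2, div_mul_eq_mul_div, ← Real.rpow_add two_pos]
    push_cast
    ring_nf
  have hYt : Tendsto Y atTop (𝓝 (4 / ν ^ 2 * (2 : ℝ) ^ (2 * diffEntropy p))) := by
    rw [funext hYeq]
    have h1 : Tendsto (fun k => 2 * (diffEntropy p - w k)) atTop (𝓝 (2 * diffEntropy p)) := by
      have := (hrate.const_sub (diffEntropy p)).const_mul 2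
      rwa [sub_zero] at this
    exact ((Real.continuous_const_rpow two_ne_zero).continuousAt.tendsto.comp h1).const_mul _
  choose S₀ hS₀c hS₀s _ hS₀m using fun k => (hsim k).exists_shortest (h k).edges
  have hS₀N : ∀ k, ((S₀ k).card : ℝ) = (M k).index := fun k => by rw [hS₀c]; rfl
  have hNt : Tendsto (fun k => ((S₀ k).card : ℝ)) atTop atTop := by
    simp only [hS₀N, hN]
    exact tendsto_rpow_atTop ((tendsto_atTop_add_const_right _ _
      (hR.const_mul_atTop ha₀)).const_mul_atTop hL0)
  have hmom := tendsto_moment hQ S₀ (fun k => Finset.card_pos.1 (by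
    rw [hS₀c]; exact (M k).index_pos)) hS₀s hNt
  obtain ⟨D, hD⟩ := exists_isLabelBound hL hQ
  obtain ⟨η, hη0, hη⟩ := exists_translation_modulus (hp.integrable_blockDensity (L := L))
  have hηt : Tendsto (fun k => η ((M k).scale * (D * c k))) atTop (𝓝 0) := by
    refine hη0.comp ?_
    have := hβc0.const_mul D
    rw [mul_zero] at this
    exact this.congr fun k => by ring
  set m : ℕ → ℝ := fun k => (∑ v ∈ S₀ k, ‖(v : Space L)‖ ^ 2) / (S₀ k).card /
    ((S₀ k).card * ZLattice.covolume Λ) ^ (2 / (L : ℝ)) with hm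
  have hmain : ∀ k, (M k).scale ^ 2 / 4 * ((∑ s ∈ S k, ‖s‖ ^ 2) / (M k).index) / L *
      (2 : ℝ) ^ (2 * R k * (1 - a)) = Y k * (ν ^ 2 / 4) * m k / L := by
    intro k
    have hc0 := (hsim k).pos
    have h1 : ((S₀ k).card * ZLattice.covolume Λ) ^ (2 / (L : ℝ)) = (c k * ν) ^ 2 := by
      rw [hS₀N, (M k).index_eq (hsim k), ← hνL, ← mul_pow, ← Real.rpow_natCast,
        ← Real.rpow_mul (by positivity), mul_div_cancel₀ _ hL0.ne', Real.rpow_ofNat]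
    simp only [hm, hY]
    rw [h1, hS₀m, ← hS₀N]
    field_simp
  -- The first term is the midpoint contribution, smaller by `c ^ 2` than the main term; the second
  -- is the failure of translation invariance of the density at distance `β D c`.
  have herr : Tendsto (fun k => (4 * D ^ 2 * (Y k / c k ^ 2) +
      D ^ 2 / 4 * (Y k * η ((M k).scale * (D * c k)))) / L) atTop (𝓝 0) := by
    have h1 := ((hYt.div_atTop ((tendsto_pow_atTop two_ne_zero).comp hct)).const_mul
      (4 * D ^ 2)).add ((hYt.mul hηt).const_mul (D ^ 2 / 4))
    have h2 := h1.div_const (L : ℝ)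
    simpa using h2
  have hlim : Tendsto (fun k => Y k * (ν ^ 2 / 4) * m k / L) atTop
      (𝓝 (sphereSecondMoment L * (2 : ℝ) ^ (2 * diffEntropy p))) := by
    have := ((hYt.mul_const (ν ^ 2 / 4)).mul hmom).div_const (L : ℝ)
    refine this.trans_eq ?_
    rw [sphereSecondMoment_eq]
    congr 1
    field_simp
  have hsub : Tendsto (fun k => (M k).sideDistortion p * (2 : ℝ) ^ (2 * R k * (1 - a)) -
      Y k * (ν ^ 2 / 4) * m k / L) atTop (𝓝 0) := by
    refine squeeze_zero_norm (fun k => ?_) herr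
    have hN0 : 0 < latticeIndex Λ (M k).sub := (M k).index_pos
    have hc0 := (hsim k).pos
    have key := (M k).abs_sideDistortion_sub_le hp hL (hsim k) (h k) hD (hc1 k)
      (Finset.card_pos.1 (by rw [(h k).card_voronoi]; exact hN0)) (hη ((M k).scale * (D * c k)))
    rw [← hmain, ← sub_mul, norm_mul, Real.norm_eq_abs, Real.norm_of_nonneg (by positivity)]
    refine (mul_le_mul_of_nonneg_right key (by positivity)).trans (le_of_eq ?_)
    rw [hY]
    field_simp
    ring
  have := hsub.add hlim
  rw [zero_add] at this
  exact this.congr fun k => by ring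

end Limits

end MDQ

theorem mainTheorem1 {L : ℕ} (hL : 1 ≤ L)
    (Λ : Submodule ℤ (MDQ.Space L)) [DiscreteTopology Λ] [IsZLattice ℝ Λ]
    (p : ℝ → ℝ) (hp : MDQ.IsDensity p) (hh : MDQ.HasFiniteDiffEntropy p)
    (a : ℝ) (ha₀ : 0 < a) (ha₁ : a < 1)
    (M : ℕ → MDQ.Quantizer Λ) (R : ℕ → ℝ) (hR : Tendsto R atTop atTop)
    (hN : ∀ k, ((M k).index : ℝ) = (2 : ℝ) ^ ((L : ℝ) * (a * R k + 1)))
    (hrate :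
      (Tendsto (fun k => ((M k).rate₁ p).toReal - R k) atTop (𝓝 0) ∧
        Tendsto (fun k => ((M k).rate₂ p).toReal - R k) atTop (𝓝 0)) ∨
      Tendsto (fun k => (M k).highRate p - R k) atTop (𝓝 0)) :
    (∀ k, Integrable (M k).error₁ (MDQ.sourceLaw p L) ∧
      Integrable (M k).error₂ (MDQ.sourceLaw p L)) ∧
    Tendsto (fun k => (M k).sideDistortion p * (2 : ℝ) ^ (2 * R k * (1 - a))) atTop
      (𝓝 (MDQ.sphereSecondMoment L * (2 : ℝ) ^ (2 * MDQ.diffEntropy p))) := by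
  refine ⟨fun k => ?_, MDQ.tendsto_sideDistortion hL hp ha₀ M hR hN ?_⟩
  · obtain ⟨c, O, hsim⟩ := (M k).similar.exists_isSimilarity
    obtain ⟨V₀, S, b, h⟩ := (M k).isLabeling.exists_labelData
    obtain ⟨D, hD⟩ := MDQ.exists_isLabelBound hL (M k).isNearest
    exact (M k).integrable_error hp hL hsim h hD
      (MDQ.LabelData.one_le_factor hL hsim (M k).isNearest)
  · exact hrate.elim (fun h => MDQ.tendsto_highRate_sub hL hp hh ha₀ ha₁ M hR hN h.1) id
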